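/- Let $m,n,s\ge 1$ and $r,g\ge 0$ be integers with $2g-2+m+n=rs$. For tuples of positive integers $\mu=(\mu_1,\dots,\mu_m)$ and $\nu=(\nu_1,\dots,\nu_n)$ with $\sum_i\mu_i=\sum_j\nu_j=d$, let $$h^s(\mu,\nu)=\frac{1}{\prod_{i}\mu_i\prod_j\nu_j}\sum_{\lambda\vdash d}\chi^\lambda_\mu\left(\frac{p_{r+1}(\lambda)}{(r+1)!}\right)^{s}\chi^\lambda_\nu$$ be the (disconnected) double Hurwitz number with $s$ completed $(r+1)$-cycles, where $\chi^\lambda_\mu$ is the value of the irreducible character of $S_d$ indexed by the partition $\lambda$ on the permutations with cycle lengths $\mu_1,\dots,\mu_m$, and $p_k(\lambda)=\sum_{i\ge1}\bigl((\lambda_i-i+\tfrac12)^k-(-i+\tfrac12)^k\bigr)$. Let $V$ be the set of all such pairs $(\mu,\nu)$ (with $m,n$ fixed and $d$ arbitrary). For non-empty proper subsets $I\subset\{1,\dots,m\}$ and $J\subset\{1,\dots,n\}$ the wall $W_{I,J}\subset V$ is given by $\sum_{i\in I}\mu_i=\sum_{j\in J}\nu_j$. A chamber is the set of all points of $V$ that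 lie strictly on the same side of every wall as a given point of $V$ that lies on no wall. Then for every chamber $\mathfrak c$ there are polynomials $P^s_{\mathfrak c,0},\dots,P^s_{\mathfrak c,g}$ with rational coefficients in the $m+n$ variables $(\mu,\nu)$ such that $$h^s(\mu,\nu)=\sum_{k=0}^{g}(-1)^kP^s_{\mathfrak c,k}(\mu,\nu)\qquad\text{for all }(\mu,\nu)\in\mathfrak c,$$ where $P^s_{\mathfrak c,k}$ is homogeneous of degree $(r+1)s+1-m-n-2k\ge 0$ and $P^s_{\mathfrak c,k}(\mu,\nu)>0$ for all $(\mu,\nu)\in\mathfrak c$. In particular the polynomial $Q=\sum_{k=0}^g(-1)^kP^s_{\mathfrak c,k}$ is even or odd, according to the parity of $D=(r+1)s+1-m-n$, and, among the degrees whose homogeneous component of $Q$ does not vanish identically on $V$, the largest is $D$ and the smallest is $D-2g$. -/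

import Mathlib

namespace CompletedHurwitz

open Finset

noncomputable section

/-! ### Irreducible characters of the symmetric group -/

/-- The `i`-th part (counted from `0`) of a partition, in weakly decreasing order, and `0` beyond
the last part. -/
def part {d : ℕ} (lam : Nat.Partition d) (i : ℕ) : ℕ :=
  (lam.parts.sort (· ≥ ·)).getD i 0

/-- The boxes of the Young diagram of `lam`: row `i`, column `j < lam_i`. -/
abbrev Box {d : ℕ} (lam : Nat.Partition d) : Type :=
  Σ i : Fin (lam.parts.sort (· ≥ ·)).length, Fin (part lam i)

theorem card_box {d : ℕ} (lam : Nat.Partition d) : Fintype.card (Box lam) = d := by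
  have h : ∀ l : List ℕ, ∑ i : Fin l.length, l.getD i 0 = l.sum := by
    intro l
    simp [← List.sum_ofFn]
  rw [Fintype.card_sigma]
  simp only [Fintype.card_fin]
  simp only [part]
  rw [h, ← Multiset.sum_coe, Multiset.sort_eq, lam.parts_sum]

/-- A Young tableau of shape `lam`, that is, a bijective filling of the boxes by `Fin d`. (The
isomorphism class of the Specht module below does not depend on it.) -/
def tableau {d : ℕ} (lam : Nat.Partition d) : Fin d ≃ Box lam :=
  (Fintype.equivFinOfCardEq (card_box lam)).symm

/-- The permutations that preserve the rows of the tableau. -/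
def rowGroup {d : ℕ} (lam : Nat.Partition d) : Set (Equiv.Perm (Fin d)) :=
  {σ | ∀ k, ((tableau lam (σ k)).1 : ℕ) = (tableau lam k).1}

/-- The permutations that preserve the columns of the tableau. -/
def colGroup {d : ℕ} (lam : Nat.Partition d) : Set (Equiv.Perm (Fin d)) :=
  {σ | ∀ k, ((tableau lam (σ k)).2 : ℕ) = (tableau lam k).2}

open Classical in
/-- The row symmetrizer `a`, the sum of the elements of the row group. -/
def rowSymmetrizer {d : ℕ} (lam : Nat.Partition d) : MonoidAlgebra ℚ (Equiv.Perm (Fin d)) :=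
  ∑ σ with σ ∈ rowGroup lam, MonoidAlgebra.of ℚ _ σ

open Classical in
/-- The column antisymmetrizer `b`, the signed sum of the elements of the column group. -/
def colAntisymmetrizer {d : ℕ} (lam : Nat.Partition d) :
    MonoidAlgebra ℚ (Equiv.Perm (Fin d)) :=
  ∑ σ with σ ∈ colGroup lam, ((Equiv.Perm.sign σ : ℤ) : ℚ) • MonoidAlgebra.of ℚ _ σ

/-- The irreducible representation of `S_d` given by the partition `lam`: the Specht module, which
is the left ideal of the group algebra generated by the Young symmetrizer `a * b`. -/
abbrev Specht {d : ℕ} (lam : Nat.Partition d) : Ideal (MonoidAlgebra ℚ (Equiv.Perm (Fin d))) :=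
  Ideal.span {rowSymmetrizer lam * colAntisymmetrizer lam}

/-- The character of the irreducible representation given by `lam`: the trace of the left
multiplication by `σ`. -/
def irredCharacter {d : ℕ} (lam : Nat.Partition d) (σ : Equiv.Perm (Fin d)) : ℚ :=
  LinearMap.trace ℚ (Specht lam) (Algebra.lsmul ℚ ℚ (Specht lam) (MonoidAlgebra.of ℚ _ σ))

open Classical in
/-- The value `χ_μ^λ` of the character given by `lam` on the conjugacy class of the permutations
whose cycle lengths (fixed points included) are `μ_1, …, μ_m`. If there are no such permutations,
it is `0` by convention. -/
def chi {d m : ℕ} (lam : Nat.Partition d) (μ : Fin m → ℕ) : ℚ :=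
  if h : ∃ σ : Equiv.Perm (Fin d), σ.partition.parts = Multiset.map μ univ.val then
    irredCharacter lam h.choose
  else 0

/-! ### Hurwitz numbers with completed cycles -/

/-- The shifted symmetric power sum `p_k(λ) = ∑_{i ≥ 1} ((λ_i - i + 1/2)^k - (-i + 1/2)^k)`. The
index `i` of the code is shifted by one, and the terms beyond the `d`-th vanish. -/
def shiftedPowerSum (k : ℕ) {d : ℕ} (lam : Nat.Partition d) : ℚ :=
  ∑ i ∈ range d,
    (((part lam i : ℚ) - ((i : ℚ) + 1) + 1 / 2) ^ k - (-((i : ℚ) + 1) + 1 / 2) ^ k)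

/-- The disconnected double Hurwitz number `h^{(r),s}_{μ,ν}` with `s` completed `(r+1)`-cycles. -/
def hurwitz (r s : ℕ) {m n : ℕ} (μ : Fin m → ℕ) (ν : Fin n → ℕ) : ℚ :=
  1 / ((∏ i, (μ i : ℚ)) * ∏ j, (ν j : ℚ)) *
    ∑ lam : Nat.Partition (∑ i, μ i),
      chi lam μ * (shiftedPowerSum (r + 1) lam / ((r + 1).factorial : ℚ)) ^ s * chi lam ν

/-! ### The hyperplane arrangement -/

/-- The domain `V`: pairs of tuples of positive integers of lengths `m`, `n` and equal sums. -/
def domain (m n : ℕ) : Set ((Fin m → ℕ) × (Fin n → ℕ)) :=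
  {p | (∀ i, 0 < p.1 i) ∧ (∀ j, 0 < p.2 j) ∧ ∑ i, p.1 i = ∑ j, p.2 j}

/-- The linear form `x_I - y_J`. -/
def wallForm {m n : ℕ} (I : Finset (Fin m)) (J : Finset (Fin n))
    (p : (Fin m → ℕ) × (Fin n → ℕ)) : ℤ :=
  ∑ i ∈ I, (p.1 i : ℤ) - ∑ j ∈ J, (p.2 j : ℤ)

/-- The pairs `(I, J)` of non-empty proper subsets, which index the walls `x_I - y_J = 0`. -/
def IsWallIndex {m n : ℕ} (I : Finset (Fin m)) (J : Finset (Fin n)) : Prop :=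
  I.Nonempty ∧ I ≠ univ ∧ J.Nonempty ∧ J ≠ univ

/-- A chamber of the arrangement: the set of all points of `V` that lie strictly on the same side
of every wall as some given point of `V` that lies on no wall. -/
def IsChamber {m n : ℕ} (c : Set ((Fin m → ℕ) × (Fin n → ℕ))) : Prop :=
  ∃ p ∈ domain m n,
    (∀ I J, IsWallIndex I J → wallForm I J p ≠ 0) ∧
    c = {q ∈ domain m n | ∀ I J, IsWallIndex I J →
      SignType.sign (wallForm I J q) = SignType.sign (wallForm I J p)}

/-- The coordinates of a pair `(μ, ν)`, as a point at which polynomials in `m + n` variables are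
evaluated. -/
def coords {m n : ℕ} (p : (Fin m → ℕ) × (Fin n → ℕ)) : Fin m ⊕ Fin n → ℚ :=
  Sum.elim (fun i => (p.1 i : ℚ)) (fun j => (p.2 j : ℚ))

/-- The degrees that occur in a polynomial, regarded as a function on `V`: those `e` for which the
homogeneous component of degree `e` does not vanish identically on `V`. -/
def occurringDegrees {m n : ℕ} (Q : MvPolynomial (Fin m ⊕ Fin n) ℚ) : Set ℕ :=
  {e | ∃ p ∈ domain m n, MvPolynomial.eval (coords p) (MvPolynomial.homogeneousComponent e Q) ≠ 0}

end

end CompletedHurwitz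

/-! The Hurwitz number is turned into a vacuum expectation of one-particle operators, which is
evaluated by commuting operators to the right. Antisymmetric functions of N particle positions are
coefficient functions of antisymmetric polynomials in N variables: the vacuum is the Vandermonde
determinant, `op (-b) 1` is multiplication by the power sum p_b, and an operator of energy 0 is
diagonal on the configurations of partitions, a completed cycle being the one with weight
x^(r+1)/(r+1)!. With the Frobenius formula (`chi_eq_frob`) this gives `sum_chi_eq_vev`: the product
of all μ_i, all ν_j and h^s is the expectation of lowering operators μ_i, s diagonal operators and
raising operators ν_j. Finitely many particles suffice, since a state of energy e fills every level
below N - e.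

The Frobenius formula is proved by norms. The Heisenberg relations yield the column orthogonality of
its right-hand side, hence, the matrix being square, its rows have norm 1. Young symmetrizers show
that the Specht character has norm 1 and inner product 1 with that right-hand side, so the two
agree.

By `commutator`, a commutator is again a one-particle operator, with weight `bracket`, plus a scalar
`centeredSum` when the energies cancel. An operator of energy at most 0 on the far left kills the
expectation. In a chamber all relevant partial sums of μ minus ν have constant signs, so the same
commutations work for all its points; a scalar term survives only for the last two operators.

Positivity rests on evaluating weights half-way along each move. For energies a > 0 ≥ b,
`bracket_eq` then expresses the commutator without subtraction, so weights keep homogeneous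
coefficients that are non-negative on the chamber. Signs enter only with the final scalar: in
`centeredSum_pow_even` they are those of B_{2k}(1/2), which alternate because ζ(2k) > 0. Every μ_i
and ν_j can be divided out, since a commutator with a constant weight carries the energy as a
factor. Strict positivity of all g + 1 components needs one branch of the computation whose final
weight has a positive coefficient of x^(2g); `rep_true` follows such a branch. -/

namespace CompletedHurwitz

open Finset

noncomputable section

section

/-! ### Sums of powers over centered arithmetic progressions -/

/-- The sum of the values of `F` at the `a` points `-(a-1)/2, -(a-3)/2, …, (a-1)/2`. -/
def centeredSum (a : ℕ) (F : Polynomial ℚ) : ℚ :=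
  ∑ j ∈ range a, F.eval ((j : ℚ) + 1 / 2 - a / 2)

theorem centeredSum_add (a : ℕ) (F G : Polynomial ℚ) :
    centeredSum a (F + G) = centeredSum a F + centeredSum a G := by
  simp [centeredSum, sum_add_distrib]

theorem centeredSum_sum {ι : Type*} (a : ℕ) (s : Finset ι) (F : ι → Polynomial ℚ) :
    centeredSum a (∑ i ∈ s, F i) = ∑ i ∈ s, centeredSum a (F i) := by
  simp only [centeredSum, Polynomial.eval_finsetSum]
  exact sum_comm

theorem centeredSum_C_mul (a : ℕ) (q : ℚ) (F : Polynomial ℚ) :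
    centeredSum a (Polynomial.C q * F) = q * centeredSum a F := by
  simp [centeredSum, mul_sum]

theorem centeredSum_pow_odd (a j : ℕ) : centeredSum a (Polynomial.X ^ (2 * j + 1)) = 0 := by
  have h : centeredSum a (Polynomial.X ^ (2 * j + 1))
      = -centeredSum a (Polynomial.X ^ (2 * j + 1)) := by
    conv_lhs => rw [centeredSum, ← sum_range_reflect]
    rw [centeredSum, ← sum_neg_distrib]
    refine sum_congr rfl fun i hi => ?_
    have hi := mem_range.1 hi
    have e : ((a - 1 - i : ℕ) : ℚ) = a - 1 - i := by
      rw [Nat.sub_sub, Nat.cast_sub (by lia)]; push_cast; ring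
    simp only [Polynomial.eval_pow, Polynomial.eval_X]
    rw [e, ← Odd.neg_pow ⟨j, rfl⟩]
    congr 1; ring
  linarith

theorem sum_range_shift_pow (a p : ℕ) (y : ℚ) :
    (p + 1) * ∑ i ∈ range a, ((i : ℚ) + y) ^ p
      = (Polynomial.bernoulli (p + 1)).eval (a + y) - (Polynomial.bernoulli (p + 1)).eval y := by
  induction a with
  | zero => simp
  | succ a ih =>
    rw [sum_range_succ, mul_add, ih]
    have := Polynomial.bernoulli_eval_one_add (p + 1) (a + y)
    rw [show (((a + 1 : ℕ) : ℚ) + y) = 1 + (a + y) by push_cast; ring, this]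
    push_cast
    ring

/-- The Bernoulli polynomials form an Appell sequence; in this form it supplies their Taylor
coefficients about 1/2. -/
theorem hasseDeriv_bernoulli (n j : ℕ) (hj : j ≤ n) :
    Polynomial.hasseDeriv j (Polynomial.bernoulli n)
      = Polynomial.C (n.choose j : ℚ) * Polynomial.bernoulli (n - j) := by
  ext i
  rw [Polynomial.hasseDeriv_coeff, Polynomial.coeff_C_mul, Polynomial.coeff_bernoulli,
    Polynomial.coeff_bernoulli]
  by_cases h : i + j ≤ n
  · rw [if_pos h, if_pos (by lia)]
    have e := Nat.choose_mul (n := n) (k := i + j) (s := j) (by lia)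
    have e' : i + j - j = i := by lia
    rw [e'] at e
    have e2 : n - j - i = n - (i + j) := by lia
    rw [e2]
    have e3 : ((n.choose (i + j) : ℚ)) * ((i + j).choose j) = n.choose j * (n - j).choose i := by
      exact_mod_cast e
    linear_combination bernoulli (n - (i + j)) * e3
  · rw [if_neg h, if_neg (by lia)]; simp

theorem bernoulli_eval_half_add (n : ℕ) (y : ℚ) :
    (Polynomial.bernoulli n).eval (1 / 2 + y) = ∑ l ∈ range (n + 1),
      (n.choose l : ℚ) * (Polynomial.bernoulli (n - l)).eval (1 / 2) * y ^ l := by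
  have h : (Polynomial.bernoulli n).eval (1 / 2 + y)
      = (Polynomial.taylor (1 / 2 : ℚ) (Polynomial.bernoulli n)).eval y := by
    rw [Polynomial.taylor_eval, add_comm]
  have hd : (Polynomial.taylor (1 / 2 : ℚ) (Polynomial.bernoulli n)).natDegree < n + 1 := by
    rw [Polynomial.natDegree_taylor, Nat.lt_succ_iff, Polynomial.natDegree_le_iff_coeff_eq_zero]
    intro N hN
    rw [Polynomial.coeff_bernoulli, if_neg (by lia)]
  rw [h, Polynomial.eval_eq_sum_range' hd]
  refine sum_congr rfl fun l hl => ?_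
  rw [Polynomial.taylor_coeff, hasseDeriv_bernoulli n l (by have := mem_range.1 hl; lia)]
  simp

theorem bernoulli_eval_half (k : ℕ) :
    (Polynomial.bernoulli k).eval (1 / 2) = (2 / 2 ^ k - 1) * bernoulli k := by
  have h := bernoulliFun_eval_half k
  rw [bernoulliFun, show (2⁻¹ : ℝ) = algebraMap ℚ ℝ (1 / 2) by norm_num,
    Polynomial.eval_map_algebraMap, Polynomial.aeval_algebraMap_apply] at h
  simp only [Polynomial.coe_aeval_eq_eval, eq_ratCast] at h
  have h' : (((Polynomial.bernoulli k).eval (1 / 2) : ℚ) : ℝ)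
      = (((2 / 2 ^ k - 1) * bernoulli k : ℚ) : ℝ) := by
    rw [h]; push_cast; rfl
  exact_mod_cast h'

/-- Euler's formula gives ζ(2k) as a positive multiple of (-1)^(k+1) B_{2k}, and ζ(2k) > 0 as a
series of non-negative terms with a positive one. -/
theorem neg_one_pow_mul_bernoulli_neg (k : ℕ) (hk : k ≠ 0) : (-1) ^ k * bernoulli (2 * k) < 0 := by
  have h := hasSum_zeta_nat hk
  have hpos : (0 : ℝ) < (-1 : ℝ) ^ (k + 1) * (2 : ℝ) ^ (2 * k - 1) * Real.pi ^ (2 * k) *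
      bernoulli (2 * k) / (2 * k).factorial := by
    rw [← h.tsum_eq]
    exact h.summable.tsum_pos (fun n => by positivity) 1 (by simp)
  have e : (-1 : ℝ) ^ (k + 1) * (2 : ℝ) ^ (2 * k - 1) * Real.pi ^ (2 * k) *
      bernoulli (2 * k) / (2 * k).factorial = ((2 : ℝ) ^ (2 * k - 1) * Real.pi ^ (2 * k) /
        (2 * k).factorial) * (-((-1) ^ k * bernoulli (2 * k))) := by rw [pow_succ]; ring
  rw [e] at hpos
  have := (mul_pos_iff_of_pos_left
    (by have := Real.pi_pos; positivity)).1 hpos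
  have h2 : (-1 : ℝ) ^ k * bernoulli (2 * k) < 0 := by linarith
  exact_mod_cast h2

/-- The source of every sign in the theorem. For k > 0 the factor 2 / 2^(2k) - 1 relating
B_{2k}(1/2) to B_{2k} is negative, which reverses the sign of the previous lemma. -/
theorem neg_one_pow_mul_bernoulli_eval_half_pos (k : ℕ) :
    0 < (-1) ^ k * (Polynomial.bernoulli (2 * k)).eval (1 / 2) := by
  rw [bernoulli_eval_half]
  rcases Nat.eq_zero_or_pos k with rfl | hk
  · norm_num
  · have h := neg_one_pow_mul_bernoulli_neg k hk.ne'
    have h2 : (2 : ℚ) / 2 ^ (2 * k) < 1 := by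
      rw [div_lt_one (by positivity)]
      calc (2 : ℚ) < 2 ^ 2 := by norm_num
        _ ≤ 2 ^ (2 * k) := pow_le_pow_right₀ (by norm_num) (by lia)
    nlinarith

/-- The absolute value of the coefficient of `a ^ (2 * j + 1 - 2 * k)` in
`centeredSum a (X ^ (2 * j))`. -/
def centeredCoeff (j k : ℕ) : ℚ :=
  (-1) ^ k * (Polynomial.bernoulli (2 * k)).eval (1 / 2) *
    (2 * (2 * j + 1).choose (2 * k) / ((2 * j + 1) * 2 ^ (2 * j + 1 - 2 * k)))

theorem centeredCoeff_pos {j k : ℕ} (h : k ≤ j) : 0 < centeredCoeff j k := by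
  refine mul_pos (neg_one_pow_mul_bernoulli_eval_half_pos k) ?_
  have : 0 < (2 * j + 1).choose (2 * k) := Nat.choose_pos (by lia)
  positivity

theorem sum_range_two_mul {M : Type*} [AddCommMonoid M] (f : ℕ → M) (n : ℕ) :
    ∑ l ∈ range (2 * n), f l = ∑ i ∈ range n, (f (2 * i) + f (2 * i + 1)) := by
  induction n with
  | zero => simp
  | succ n ih => rw [Nat.mul_succ, sum_range_succ, sum_range_succ, ih, sum_range_succ, add_assoc]

/-- The sum telescopes to the difference of B_{2j+1} at 1/2 + a/2 and at 1/2 - a/2. In the Taylor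
expansion about 1/2 only odd powers of a survive, with coefficients proportional to the alternating
numbers B_{2k}(1/2). -/
theorem centeredSum_pow_even (a j : ℕ) : centeredSum a (Polynomial.X ^ (2 * j)) =
    ∑ k ∈ range (j + 1), (-1) ^ k * centeredCoeff j k * (a : ℚ) ^ (2 * j + 1 - 2 * k) := by
  have h := sum_range_shift_pow a (2 * j) (1 / 2 - a / 2)
  have e1 : (a : ℚ) + (1 / 2 - a / 2) = 1 / 2 + a / 2 := by ring
  have e2 : (1 / 2 - a / 2 : ℚ) = 1 / 2 + (-(a / 2)) := by ring
  rw [e1] at h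
  conv_rhs at h => rw [e2]
  rw [bernoulli_eval_half_add, bernoulli_eval_half_add, ← sum_sub_distrib,
    show 2 * j + 1 + 1 = 2 * (j + 1) by ring, sum_range_two_mul] at h
  -- After the reflection the index k belongs to the power 2 (j - k) + 1 of a.
  conv_rhs at h => rw [← sum_range_reflect]
  have h0 : ((2 * j : ℕ) : ℚ) + 1 ≠ 0 := by positivity
  have hc : centeredSum a (Polynomial.X ^ (2 * j))
      = ∑ i ∈ range a, ((i : ℚ) + (1 / 2 - a / 2)) ^ (2 * j) := by
    simp only [centeredSum, Polynomial.eval_pow, Polynomial.eval_X, add_sub_assoc]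
  rw [hc]
  refine mul_left_cancel₀ h0 ?_
  rw [h, mul_sum]
  refine sum_congr rfl fun k hk => ?_
  have hk := mem_range.1 hk
  have e3 : j + 1 - 1 - k = j - k := by lia
  rw [e3]
  have e4 : 2 * j + 1 - (2 * (j - k) + 1) = 2 * k := by lia
  have e5 : 2 * j + 1 - 2 * k = 2 * (j - k) + 1 := by lia
  rw [e4, centeredCoeff, e5]
  have e6 : (-(a / 2 : ℚ)) ^ (2 * (j - k)) = (a / 2) ^ (2 * (j - k)) := Even.neg_pow (by simp) _
  have e7 : (-(a / 2 : ℚ)) ^ (2 * (j - k) + 1) = -(a / 2) ^ (2 * (j - k) + 1) :=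
    Odd.neg_pow ⟨_, rfl⟩ _
  have e8 : (2 * j + 1).choose (2 * (j - k) + 1) = (2 * j + 1).choose (2 * k) :=
    Nat.choose_symm_of_eq_add (by lia)
  have e9 : ((-1 : ℚ) ^ k) * (-1) ^ k = 1 := by rw [← mul_pow]; simp
  rw [e6, e7, e8]
  simp only [div_pow]
  push_cast at h0 ⊢
  field_simp
  linear_combination (-2 : ℚ) * e9 * 2 ^ (2 * (j - k)) * ((2 * j + 1).choose (2 * k) : ℚ) *
    a ^ (2 * (j - k) + 1) *
    Polynomial.eval (1 / 2) (Polynomial.bernoulli (2 * k))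

end

section

/-! ### Antisymmetric functions on configurations of particles -/

/-- The positions of `N` particles that fill the lowest levels, in decreasing order. -/
def stair (N : ℕ) : Fin N → ℤ := fun i => (N : ℤ) - 1 - i

theorem stair_injective (N : ℕ) : Function.Injective (stair N) := by
  intro i j h
  simp only [stair] at h
  exact Fin.ext (by lia)

theorem stair_nonneg {N : ℕ} (i : Fin N) : 0 ≤ stair N i := by
  have := i.isLt
  simp only [stair]
  lia

theorem sum_stair (N : ℕ) : ∑ i, stair N i = ∑ v ∈ range N, (v : ℤ) := by
  rw [← Fin.sum_univ_eq_sum_range (fun v => (v : ℤ)), ← Equiv.sum_comp Fin.revPerm]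
  refine sum_congr rfl fun i _ => ?_
  have := i.isLt
  simp only [stair, Fin.revPerm_apply, Fin.val_rev]
  lia

theorem sum_stair_le {N : ℕ} {k : Fin N → ℤ} (hk : Function.Injective k) (h0 : ∀ i, 0 ≤ k i) :
    ∑ i, stair N i ≤ ∑ i, k i := by
  have h := sum_range_le_sum (s := univ.map ⟨k, hk⟩) (c := 0) (by simpa using h0)
  simpa [sum_stair] using h

/-- If level v were empty, all particles above it could move down by one and stay distinct and
non-negative. At most v particles lie below v, so at least N - v of them move, and the sum would
fall below that of the staircase. -/
theorem exists_eq_of_sum_lt {N : ℕ} {k : Fin N → ℤ} (hk : Function.Injective k)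
    (h0 : ∀ i, 0 ≤ k i) {v : ℤ} (hv : 0 ≤ v)
    (hs : ∑ i, k i < ∑ i, stair N i + (N - v)) : ∃ i, k i = v := by
  by_contra! hne
  let k' : Fin N → ℤ := fun i => if k i < v then k i else k i - 1
  have hk' : Function.Injective k' := by
    intro i j hij
    have := hne i; have := hne j
    apply hk
    simp only [k'] at hij
    split_ifs at hij <;> lia
  have h0' : ∀ i, 0 ≤ k' i := by
    intro i
    have := hne i; have := h0 i
    simp only [k']
    split_ifs <;> lia
  have h1 := sum_stair_le hk' h0'
  have h2 : ∑ i, k i = ∑ i, k' i + (#{i | ¬ k i < v} : ℤ) := by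
    rw [card_filter, Nat.cast_sum, ← sum_add_distrib]
    refine sum_congr rfl fun i _ => ?_
    simp only [k']
    split_ifs <;> simp
  have h3 : #{i | k i < v} ≤ v.toNat := by
    have := card_le_card_of_injOn (s := univ.filter fun i => k i < v) (t := Ico 0 v) k
      (by intro i hi; simp only [coe_filter, mem_univ, true_and, Set.mem_ofPred_eq] at hi
          simp [h0 i, hi])
      (hk.injOn)
    simpa using this
  have h4 : #{i | k i < v} + #{i | ¬ k i < v} = N := by
    rw [card_filter_add_card_filter_not]; simp
  lia

variable {N : ℕ}

/-- The antisymmetric functions on configurations of `N` particles at non-negative positions, of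
total energy `e` above the lowest one. -/
structure IsState (e : ℤ) (ψ : (Fin N → ℤ) → ℚ) : Prop where
  anti : ∀ (π : Equiv.Perm (Fin N)) k, ψ (k ∘ π) = ((Equiv.Perm.sign π : ℤ) : ℚ) * ψ k
  nonneg : ∀ k, ψ k ≠ 0 → ∀ i, 0 ≤ k i
  degree : ∀ k, ψ k ≠ 0 → ∑ i, k i = ∑ i, stair N i + e

theorem eq_zero_of_anti {ψ : (Fin N → ℤ) → ℚ}
    (h : ∀ (π : Equiv.Perm (Fin N)) k, ψ (k ∘ π) = ((Equiv.Perm.sign π : ℤ) : ℚ) * ψ k)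
    {k : Fin N → ℤ} (hk : ¬ Function.Injective k) : ψ k = 0 := by
  simp only [Function.Injective, not_forall] at hk
  obtain ⟨i, j, hij, hne⟩ := hk
  have h1 := h (Equiv.swap i j) k
  have h2 : k ∘ (Equiv.swap i j) = k := by
    funext l
    simp only [Function.comp, Equiv.swap_apply_def]
    split_ifs with h1 h2
    · rw [h1, hij]
    · rw [h2, hij]
    · rfl
  rw [h2, Equiv.Perm.sign_swap hne] at h1
  simp only [Units.val_neg, Units.val_one, Int.cast_neg, Int.cast_one] at h1
  linarith

theorem IsState.injective {e : ℤ} {ψ : (Fin N → ℤ) → ℚ} (h : IsState e ψ) {k : Fin N → ℤ}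
    (hk : ψ k ≠ 0) : Function.Injective k := by
  by_contra hc
  exact hk (eq_zero_of_anti h.anti hc)

theorem IsState.eq_zero_of_neg {e : ℤ} {ψ : (Fin N → ℤ) → ℚ} (h : IsState e ψ) (he : e < 0)
    (k : Fin N → ℤ) : ψ k = 0 := by
  by_contra hc
  have h1 := sum_stair_le (h.injective hc) (h.nonneg k hc)
  have h2 := h.degree k hc
  lia

/-- The Dirac sea: excitations of energy e cannot reach the levels below N - e. This is what lets N
particles replace the infinite wedge. -/
theorem IsState.occupied {e : ℤ} {ψ : (Fin N → ℤ) → ℚ} (h : IsState e ψ) {k : Fin N → ℤ}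
    (hk : ψ k ≠ 0) {v : ℤ} (hv : 0 ≤ v) (hv' : v < N - e) : ∃ i, k i = v :=
  exists_eq_of_sum_lt (h.injective hk) (h.nonneg k hk) hv (by rw [h.degree k hk]; lia)

/-- The sum over all particles of the one-particle operator that moves a particle by `a` and has
weight `w`. -/
def shiftOp (w : ℤ → ℚ) (a : ℤ) (ψ : (Fin N → ℤ) → ℚ) (k : Fin N → ℤ) : ℚ :=
  ∑ i, w (k i) * ψ (k + Pi.single i a)

theorem add_single_comp_perm (k : Fin N → ℤ) (π : Equiv.Perm (Fin N)) (i : Fin N) (a : ℤ) :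
    k ∘ π + Pi.single i a = (k + Pi.single (π i) a) ∘ π := by
  funext j
  by_cases h : j = i
  · subst h; simp
  · simp [h]

theorem shiftOp_anti {ψ : (Fin N → ℤ) → ℚ}
    (h : ∀ (π : Equiv.Perm (Fin N)) k, ψ (k ∘ π) = ((Equiv.Perm.sign π : ℤ) : ℚ) * ψ k)
    (w : ℤ → ℚ) (a : ℤ) (π : Equiv.Perm (Fin N)) (k : Fin N → ℤ) :
    shiftOp w a ψ (k ∘ π) = ((Equiv.Perm.sign π : ℤ) : ℚ) * shiftOp w a ψ k := by
  simp only [shiftOp]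
  rw [mul_sum, ← Equiv.sum_comp π (fun i => _ * (w (k i) * _))]
  refine sum_congr rfl fun i _ => ?_
  rw [add_single_comp_perm, h]
  simp only [Function.comp]
  ring

/-- The weight of the move by `a` of a particle at position `x`, given by a polynomial `φ` of the
half-integral level half-way between the two positions. -/
def weight (N : ℕ) (a : ℤ) (φ : Polynomial ℚ) (x : ℤ) : ℚ :=
  φ.eval ((x : ℚ) + a / 2 - N + 1 / 2)

/-- The value on the vacuum of the operator of energy `0`, which is subtracted. -/
def vacuumConst (N : ℕ) (a : ℤ) (φ : Polynomial ℚ) : ℚ :=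
  if a = 0 then ∑ v ∈ range N, φ.eval ((v : ℚ) - N + 1 / 2) else 0

open Classical in
/-- The operator that lowers the energy by `a`, with weight polynomial `φ`. -/
def op (a : ℤ) (φ : Polynomial ℚ) (ψ : (Fin N → ℤ) → ℚ) (k : Fin N → ℤ) : ℚ :=
  if ∀ i, 0 ≤ k i then shiftOp (weight N a φ) a ψ k - vacuumConst N a φ * ψ k else 0

theorem op_of_nonneg (a : ℤ) (φ : Polynomial ℚ) (ψ : (Fin N → ℤ) → ℚ) {k : Fin N → ℤ}
    (hk : ∀ i, 0 ≤ k i) :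
    op a φ ψ k = shiftOp (weight N a φ) a ψ k - vacuumConst N a φ * ψ k := if_pos hk

theorem IsState.op {e : ℤ} {ψ : (Fin N → ℤ) → ℚ} (h : IsState e ψ) (a : ℤ) (φ : Polynomial ℚ) :
    IsState (e - a) (op a φ ψ) where
  anti π k := by
    by_cases hk : ∀ i, 0 ≤ k i
    · rw [op_of_nonneg _ _ _ hk, op_of_nonneg _ _ _ (k := k ∘ π) (fun i => hk (π i)),
        shiftOp_anti h.anti,
        h.anti]
      ring
    · rw [CompletedHurwitz.op, CompletedHurwitz.op, if_neg hk, if_neg, mul_zero]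
      intro hc
      exact hk fun i => by simpa using hc (π.symm i)
  nonneg k hk := by
    by_contra hc
    exact hk (if_neg hc)
  degree k hk := by
    by_cases hk0 : ∀ i, 0 ≤ k i
    swap
    · exact absurd (if_neg hk0) hk
    rw [op_of_nonneg _ _ _ hk0] at hk
    by_cases hs : ∃ i, ψ (k + Pi.single i a) ≠ 0
    · obtain ⟨i, hi⟩ := hs
      have := h.degree _ hi
      simp only [Pi.add_apply, sum_add_distrib, Finset.sum_pi_single', mem_univ, if_true] at this
      lia
    · push Not at hs
      have h1 : shiftOp (weight N a φ) a ψ k = 0 := sum_eq_zero fun i _ => by rw [hs, mul_zero]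
      by_cases ha : a = 0
      · have := h.degree k (by rintro h0; exact hk (by rw [h1, h0]; simp))
        lia
      · exact absurd (by rw [h1, vacuumConst, if_neg ha]; simp) hk

/-- The vacuum: the antisymmetric function that is `1` at `stair N` and vanishes at all
configurations but its permutations. -/
def vacuum (N : ℕ) (k : Fin N → ℤ) : ℚ :=
  ∑ π : Equiv.Perm (Fin N), if k = stair N ∘ π then ((Equiv.Perm.sign π : ℤ) : ℚ) else 0

theorem exists_of_vacuum_ne_zero {k : Fin N → ℤ} (hk : vacuum N k ≠ 0) :
    ∃ π : Equiv.Perm (Fin N), k = stair N ∘ π := by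
  by_contra! hc
  exact hk (sum_eq_zero fun π _ => if_neg (hc π))

theorem vacuum_stair (N : ℕ) : vacuum N (stair N) = 1 := by
  rw [vacuum, sum_eq_single 1]
  · simp
  · intro π _ hπ
    rw [if_neg]
    intro h
    apply hπ
    ext i
    have := congrFun h i
    simp only [Function.comp] at this
    rw [← stair_injective N this]
    rfl
  · simp

theorem isState_vacuum (N : ℕ) : IsState 0 (vacuum N) where
  anti π k := by
    simp only [vacuum]
    rw [mul_sum, ← Equiv.sum_comp (Equiv.mulRight π)]
    refine sum_congr rfl fun τ _ => ?_
    have : k ∘ π = stair N ∘ (Equiv.mulRight π τ) ↔ k = stair N ∘ τ := by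
      constructor
      · intro h
        funext i
        have := congrFun h (π.symm i)
        simpa using this
      · rintro rfl; rfl
    simp only [this, mul_ite, mul_zero]
    refine if_congr Iff.rfl ?_ rfl
    simp [mul_comm]
  nonneg k hk := by
    obtain ⟨π, rfl⟩ := exists_of_vacuum_ne_zero hk
    exact fun i => stair_nonneg _
  degree k hk := by
    obtain ⟨π, rfl⟩ := exists_of_vacuum_ne_zero hk
    simpa using Equiv.sum_comp π (stair N)

end

section

/-! ### Commutation relations -/

/-- The weight polynomial of the commutator of operators with weights `φ`, `χ` and energies `2u`,
`2v`. -/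
def bracket {R : Type*} [CommRing R] (u v : R) (φ χ : Polynomial R) : Polynomial R :=
  Polynomial.taylor (-v) φ * Polynomial.taylor u χ
    - Polynomial.taylor v φ * Polynomial.taylor (-u) χ

/-- The midpoint of a move by a differs from the midpoint of the total move a + b by -b/2 or b/2,
according to whether it is made before or after the move by b; likewise for b with a/2. Hence the
four Taylor shifts in `bracket`. -/
theorem weight_bracket (N : ℕ) (a b : ℤ) (φ χ : Polynomial ℚ) (x : ℤ) :
    weight N (a + b) (bracket ((a : ℚ) / 2) ((b : ℚ) / 2) φ χ) x
      = weight N a φ x * weight N b χ (x + a) - weight N b χ x * weight N a φ (x + b) := by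
  simp only [weight, bracket, Polynomial.eval_sub, Polynomial.eval_mul, Polynomial.taylor_eval]
  push_cast
  ring_nf

/-- The central term. Over the N filled levels the bracket sums to a difference of a terms at the
Fermi level and a terms at the bottom. The second sum on the left, which comes from the cutoff at 0,
cancels the bottom terms. -/
theorem vacuumConst_bracket (N a : ℕ) (φ χ : Polynomial ℚ) :
    vacuumConst N 0 (bracket ((a : ℚ) / 2) (-(a : ℚ) / 2) φ χ)
      + ∑ v ∈ range a, weight N (-a) χ v * weight N a φ ((v : ℤ) - a)
      = centeredSum a (φ * χ) := by
  let F : ℕ → ℚ := fun v => (φ * χ).eval ((v : ℚ) - N + 1 / 2 - a / 2)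
  have h1 : vacuumConst N 0 (bracket ((a : ℚ) / 2) (-(a : ℚ) / 2) φ χ)
      = ∑ v ∈ range N, F (a + v) - ∑ v ∈ range N, F v := by
    rw [vacuumConst, if_pos rfl, ← sum_sub_distrib]
    refine sum_congr rfl fun v _ => ?_
    simp only [F, bracket, Polynomial.eval_sub, Polynomial.eval_mul, Polynomial.taylor_eval]
    push_cast
    ring_nf
  have h2 : ∑ v ∈ range a, weight N (-a) χ v * weight N a φ ((v : ℤ) - a)
      = ∑ v ∈ range a, F v := by
    refine sum_congr rfl fun v _ => ?_
    simp only [F, weight, Polynomial.eval_mul]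
    push_cast
    ring_nf
  have h3 : centeredSum a (φ * χ) = ∑ v ∈ range a, F (N + v) := by
    refine sum_congr rfl fun v _ => ?_
    simp only [F]
    congr 1
    push_cast
    ring
  have h4 := sum_range_add F a N
  have h5 := sum_range_add F N a
  rw [add_comm N a] at h5
  rw [h1, h2, h3]
  linarith

variable {N : ℕ}

/-- Pauli exclusion: if the configuration after moving particle i supports ψ, the deep level k i
must still be occupied there, hence by another particle, which shares that level with particle i in
k. -/
theorem shiftOp_cutoff_of_ne {e : ℤ} {ψ : (Fin N → ℤ) → ℚ} (h : IsState e ψ) {a b : ℤ}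
    (hb : b ≤ N - e) (ha : a ≠ 0) (w : ℤ → ℚ) {k : Fin N → ℤ} (hk : ∀ i, 0 ≤ k i) :
    shiftOp (fun x => if x < b then w x else 0) a ψ k = 0 := by
  by_cases hinj : Function.Injective k
  swap
  · exact eq_zero_of_anti (fun π k => shiftOp_anti h.anti _ a π k) hinj
  refine sum_eq_zero fun i _ => ?_
  simp only
  split_ifs with hi
  swap
  · rw [zero_mul]
  by_cases hz : ψ (k + Pi.single i a) = 0
  · rw [hz, mul_zero]
  obtain ⟨j, hj⟩ := h.occupied hz (hk i) (by lia)
  by_cases hij : j = i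
  · subst hij
    simp at hj
    exact absurd hj ha
  · simp only [Pi.add_apply, Pi.single_eq_of_ne hij, add_zero] at hj
    exact absurd (hinj hj) hij

/-- The levels below b are all full in the support of ψ, each with one particle, so the sum over
particles is a sum over levels and does not depend on k. -/
theorem shiftOp_cutoff_zero {e : ℤ} {ψ : (Fin N → ℤ) → ℚ} (h : IsState e ψ) {b : ℕ}
    (hb : b ≤ N - e) (w : ℤ → ℚ) (k : Fin N → ℤ) :
    shiftOp (fun x => if x < b then w x else 0) 0 ψ k = (∑ v ∈ range b, w v) * ψ k := by
  by_cases hz : ψ k = 0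
  · simp [shiftOp, hz]
  simp only [shiftOp, Pi.single_zero, add_zero, ← sum_mul]
  congr 1
  rw [← sum_filter]
  symm
  refine sum_bij_ne_zero (fun v _ _ => (h.occupied hz (v := (v : ℤ)) (by lia)
      (by have := mem_range.1 ‹_›; lia)).choose) ?_ ?_ ?_ ?_
  · intro v hv _
    have := (h.occupied hz (v := (v : ℤ)) (by lia) (by have := mem_range.1 hv; lia)).choose_spec
    have := mem_range.1 hv
    simp only [mem_filter, mem_univ, true_and]
    lia
  · intro v hv _ v' hv' _ hvv
    have h1 := (h.occupied hz (v := (v : ℤ)) (by lia) (by have := mem_range.1 hv; lia)).choose_spec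
    have h2 := (h.occupied hz (v := (v' : ℤ)) (by lia)
      (by have := mem_range.1 hv'; lia)).choose_spec
    rw [hvv, h2] at h1
    exact_mod_cast h1.symm
  · intro i hi hw
    have hi := (mem_filter.1 hi).2
    have h0 := h.nonneg k hz i
    have hm : (k i).toNat ∈ range b := mem_range.2 (by lia)
    have hc : (((k i).toNat : ℕ) : ℤ) = k i := Int.toNat_of_nonneg h0
    refine ⟨(k i).toNat, hm, by rwa [hc], ?_⟩
    apply h.injective hz
    have h1 := (h.occupied hz (v := (((k i).toNat : ℕ) : ℤ)) (by lia)
      (by have := mem_range.1 hm; lia)).choose_spec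
    exact h1.trans hc
  · intro v hv _
    have h1 := (h.occupied hz (v := (v : ℤ)) (by lia) (by have := mem_range.1 hv; lia)).choose_spec
    rw [h1]

/-- Moves of two different particles commute, and two moves of the same particle give the bracket.
The last term corrects for the moves by b to a negative level: `op` suppresses them if they are made
before the move by a. -/
theorem commutator_of_nonneg {e : ℤ} {ψ : (Fin N → ℤ) → ℚ} (h : IsState e ψ) {a b : ℤ}
    (ha : 0 < a) (φ χ : Polynomial ℚ) {k : Fin N → ℤ} (hk : ∀ i, 0 ≤ k i) :
    op a φ (op b χ ψ) k = op b χ (op a φ ψ) k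
      + shiftOp (weight N (a + b) (bracket ((a : ℚ) / 2) ((b : ℚ) / 2) φ χ)) (a + b) ψ k
      + shiftOp (fun x => if x < -b then weight N b χ x * weight N a φ (x + b) else 0)
          (a + b) ψ k := by
  have hva : vacuumConst N a φ = 0 := if_neg ha.ne'
  have hka : ∀ i j : Fin N, 0 ≤ (k + Pi.single i a : Fin N → ℤ) j := by
    intro i j
    have := hk j
    by_cases hij : j = i
    · subst hij; simp; lia
    · simp [hij]; lia
  have e1 : op a φ (op b χ ψ) k = ∑ i, ∑ j, weight N a φ (k i) *
      (weight N b χ ((k + Pi.single i a : Fin N → ℤ) j) * ψ (k + Pi.single i a + Pi.single j b))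
      - vacuumConst N b χ * ∑ i, weight N a φ (k i) * ψ (k + Pi.single i a) := by
    rw [op_of_nonneg _ _ _ hk, hva, zero_mul, sub_zero, shiftOp, mul_sum, ← sum_sub_distrib]
    refine sum_congr rfl fun i _ => ?_
    rw [op_of_nonneg _ _ _ (hka i), shiftOp, ← mul_sum]
    ring
  have e2 : op b χ (op a φ ψ) k = ∑ j, ∑ i, (if 0 ≤ k j + b then weight N b χ (k j) *
      (weight N a φ ((k + Pi.single j b : Fin N → ℤ) i) *
        ψ (k + Pi.single j b + Pi.single i a)) else 0)
      - vacuumConst N b χ * ∑ i, weight N a φ (k i) * ψ (k + Pi.single i a) := by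
    rw [op_of_nonneg _ _ _ hk, op_of_nonneg _ _ _ hk, hva, zero_mul, sub_zero, shiftOp]
    congr 1
    refine sum_congr rfl fun j _ => ?_
    by_cases hj : 0 ≤ k j + b
    · have hkb : ∀ i, 0 ≤ (k + Pi.single j b : Fin N → ℤ) i := by
        intro i
        have := hk i
        by_cases hij : i = j
        · subst hij; simpa using hj
        · simp [hij]; lia
      simp only [if_pos hj]
      rw [op_of_nonneg _ _ _ hkb, hva, zero_mul, sub_zero, shiftOp, mul_sum]
    · simp only [if_neg hj, sum_const_zero]
      rw [op, if_neg, mul_zero]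
      intro hc
      have := hc j
      simp at this
      lia
  rw [e1, e2, sum_comm (γ := Fin N)]
  have e3 : ∀ i j, weight N a φ (k i) *
      (weight N b χ ((k + Pi.single i a : Fin N → ℤ) j) * ψ (k + Pi.single i a + Pi.single j b))
      = (if 0 ≤ k j + b then weight N b χ (k j) *
      (weight N a φ ((k + Pi.single j b : Fin N → ℤ) i) *
        ψ (k + Pi.single j b + Pi.single i a)) else 0)
      + if i = j then (weight N (a + b) (bracket ((a : ℚ) / 2) ((b : ℚ) / 2) φ χ) (k i)
        + if k i < -b then weight N b χ (k i) * weight N a φ (k i + b) else 0)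
          * ψ (k + Pi.single i (a + b)) else 0 := by
    intro i j
    have hc : k + Pi.single j b + Pi.single i a = k + Pi.single i a + Pi.single j b :=
      add_right_comm _ _ _
    by_cases hij : i = j
    · subst hij
      rw [if_pos rfl, weight_bracket, hc, add_assoc k, ← Pi.single_add]
      simp only [Pi.add_apply, Pi.single_eq_same]
      by_cases h1 : 0 ≤ k i + b
      · rw [if_pos h1, if_neg (by lia)]; ring
      · rw [if_neg h1, if_pos (by lia)]; ring
    · rw [if_neg hij, hc]
      simp only [Pi.add_apply, Pi.single_eq_of_ne hij, Pi.single_eq_of_ne (Ne.symm hij), add_zero]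
      -- For different particles the cutoff is harmless: if particle j lands below 0, ψ vanishes
      -- there in either order.
      split_ifs with h1
      · ring
      · by_cases hz : ψ (k + Pi.single i a + Pi.single j b) = 0
        · rw [hz]; ring
        · have := h.nonneg _ hz j
          simp [Ne.symm hij] at this
          exact absurd this h1
  simp only [e3, sum_add_distrib, sum_ite_eq', mem_univ, if_true, shiftOp, add_mul]
  ring

/-- The hypothesis on -b says that the levels affected by the cutoff lie in the full part of the
sea. The correction then vanishes if a + b ≠ 0, and otherwise combines with the vacuum constant of
the bracket into a scalar. -/
theorem commutator {e : ℤ} {ψ : (Fin N → ℤ) → ℚ} (h : IsState e ψ) {a b : ℤ}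
    (ha : 0 < a) (hbN : -b ≤ N - e) (φ χ : Polynomial ℚ) :
    op a φ (op b χ ψ) = op b χ (op a φ ψ)
      + op (a + b) (bracket ((a : ℚ) / 2) ((b : ℚ) / 2) φ χ) ψ
      + (if a + b = 0 then centeredSum a.toNat (φ * χ) else 0) • ψ := by
  funext k
  simp only [Pi.add_apply, Pi.smul_apply, smul_eq_mul]
  by_cases hk : ∀ i, 0 ≤ k i
  swap
  · have : ψ k = 0 := by
      by_contra hc
      exact hk (h.nonneg k hc)
    simp only [this, op, if_neg hk]
    simp
  rw [commutator_of_nonneg h ha φ χ hk, op_of_nonneg (a + b) _ _ hk]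
  by_cases hab : a + b = 0
  · obtain ⟨n, rfl⟩ := Int.eq_ofNat_of_zero_le ha.le
    obtain rfl : b = -(n : ℤ) := by lia
    have h1 := shiftOp_cutoff_zero h (b := n) (by lia)
      (fun x => weight N (-n) χ x * weight N n φ (x + (-n))) k
    have h2 := vacuumConst_bracket N n φ χ
    rw [if_pos hab]
    simp only [hab, neg_neg, h1, Int.toNat_natCast, ← h2]
    push_cast
    simp only [sub_eq_add_neg]
    ring
  · rw [shiftOp_cutoff_of_ne h hbN hab _ hk, if_neg hab, vacuumConst, if_neg hab]
    ring

/-! ### Vacuum expectations -/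

theorem op_add (a : ℤ) (φ : Polynomial ℚ) (ψ ψ' : (Fin N → ℤ) → ℚ) :
    op a φ (ψ + ψ') = op a φ ψ + op a φ ψ' := by
  funext k
  simp only [op, shiftOp, Pi.add_apply, mul_add, sum_add_distrib]
  split_ifs <;> ring

theorem op_smul (a : ℤ) (φ : Polynomial ℚ) (q : ℚ) (ψ : (Fin N → ℤ) → ℚ) :
    op a φ (q • ψ) = q • op a φ ψ := by
  funext k
  simp only [op, shiftOp, Pi.smul_apply, smul_eq_mul, mul_left_comm _ q, ← mul_sum]
  split_ifs <;> ring

theorem op_C_mul (a : ℤ) (φ : Polynomial ℚ) (q : ℚ) (ψ : (Fin N → ℤ) → ℚ) :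
    op a (Polynomial.C q * φ) ψ = q • op a φ ψ := by
  funext k
  simp only [op, shiftOp, weight, vacuumConst, Pi.smul_apply, smul_eq_mul, Polynomial.eval_mul,
    Polynomial.eval_C, mul_assoc, ← mul_sum]
  split_ifs <;> ring

/-- The product of the operators of the list `L`, applied to `ψ`. -/
def applyOps (L : List (ℤ × Polynomial ℚ)) (ψ : (Fin N → ℤ) → ℚ) : (Fin N → ℤ) → ℚ :=
  L.foldr (fun x ψ => op x.1 x.2 ψ) ψ

@[simp] theorem applyOps_nil (ψ : (Fin N → ℤ) → ℚ) : applyOps [] ψ = ψ := rfl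

@[simp] theorem applyOps_cons (x : ℤ × Polynomial ℚ) (L : List (ℤ × Polynomial ℚ))
    (ψ : (Fin N → ℤ) → ℚ) : applyOps (x :: L) ψ = op x.1 x.2 (applyOps L ψ) := rfl

theorem applyOps_append (L L' : List (ℤ × Polynomial ℚ)) (ψ : (Fin N → ℤ) → ℚ) :
    applyOps (L ++ L') ψ = applyOps L (applyOps L' ψ) := by
  simp [applyOps]

theorem applyOps_add (L : List (ℤ × Polynomial ℚ)) (ψ ψ' : (Fin N → ℤ) → ℚ) :
    applyOps L (ψ + ψ') = applyOps L ψ + applyOps L ψ' := by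
  induction L with
  | nil => rfl
  | cons x L ih => simp [ih, op_add]

theorem applyOps_smul (L : List (ℤ × Polynomial ℚ)) (q : ℚ) (ψ : (Fin N → ℤ) → ℚ) :
    applyOps L (q • ψ) = q • applyOps L ψ := by
  induction L with
  | nil => rfl
  | cons x L ih => simp [ih, op_smul]

theorem applyOps_zero (L : List (ℤ × Polynomial ℚ)) :
    applyOps L (0 : (Fin N → ℤ) → ℚ) = 0 := by
  simpa using applyOps_smul L 0 (0 : (Fin N → ℤ) → ℚ)

theorem IsState.applyOps {e : ℤ} {ψ : (Fin N → ℤ) → ℚ} (h : IsState e ψ)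
    (L : List (ℤ × Polynomial ℚ)) :
    IsState (e - (L.map Prod.fst).sum) (applyOps L ψ) := by
  induction L with
  | nil => simpa using h
  | cons x L ih =>
    have := ih.op x.1 x.2
    simpa [sub_sub, add_comm] using this

/-- The vacuum expectation of the product of the operators of the list `L`. -/
def vev (N : ℕ) (L : List (ℤ × Polynomial ℚ)) : ℚ :=
  applyOps L (vacuum N) (stair N)

theorem vev_nil (N : ℕ) : vev N [] = 1 := vacuum_stair N

/-- For energy 0 the subtracted constant is exactly the eigenvalue on the vacuum. For negative
energy the operators to its right would have to produce a state below the vacuum. -/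
theorem vev_cons_nonpos {x : ℤ × Polynomial ℚ} (hx : x.1 ≤ 0) (L : List (ℤ × Polynomial ℚ)) :
    vev N (x :: L) = 0 := by
  have hs := (isState_vacuum N).applyOps L
  rw [vev, applyOps_cons]
  rcases hx.eq_or_lt with h0 | h0
  · rw [op_of_nonneg _ _ _ stair_nonneg, shiftOp, vacuumConst, h0, if_pos rfl]
    simp only [Pi.single_zero, add_zero, ← sum_mul, weight]
    rw [← sub_mul, ← Fin.sum_univ_eq_sum_range (fun v => x.2.eval ((v : ℚ) - N + 1 / 2)),
      ← Equiv.sum_comp Fin.revPerm, ← sum_sub_distrib, sum_eq_zero, zero_mul]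
    intro i _
    have : ((stair N (Fin.revPerm i) : ℤ) : ℚ) = (i : ℕ) := by
      have := i.isLt
      simp only [stair, Fin.revPerm_apply, Fin.val_rev]
      rw [Nat.cast_sub (by lia)]
      push_cast
      ring
    rw [this]
    simp
  · by_contra hc
    have h1 := (hs.op x.1 x.2).degree _ hc
    have h2 : ¬ (-(L.map Prod.fst).sum < 0) := by
      intro hneg
      apply hc
      have : applyOps L (vacuum N) = 0 := by
        funext k
        exact hs.eq_zero_of_neg (by lia) k
      rw [this]
      have := op_smul x.1 x.2 0 (0 : (Fin N → ℤ) → ℚ)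
      simp only [zero_smul] at this
      rw [this]
      rfl
    lia

theorem vev_append_pos {x : ℤ × Polynomial ℚ} (hx : 0 < x.1) (L : List (ℤ × Polynomial ℚ)) :
    vev N (L ++ [x]) = 0 := by
  have hs := (isState_vacuum N).op x.1 x.2
  have : op x.1 x.2 (vacuum N) = 0 := by
    funext k
    exact hs.eq_zero_of_neg (by lia) k
  rw [vev, applyOps_append, applyOps_cons, applyOps_nil, this, applyOps_zero]
  rfl

theorem sum_map_abs_le (L : List (ℤ × Polynomial ℚ)) :
    -(L.map Prod.fst).sum ≤ (L.map fun x => |x.1|).sum := by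
  induction L with
  | nil => simp
  | cons x L ih =>
    have := neg_le_abs x.1
    simp only [List.map_cons, List.sum_cons]
    lia

theorem sum_map_abs_nonneg (L : List (ℤ × Polynomial ℚ)) : 0 ≤ (L.map fun x => |x.1|).sum :=
  List.sum_nonneg (by simp only [List.mem_map]; rintro _ ⟨x, -, rfl⟩; exact abs_nonneg _)

/-- The total of the absolute energies bounds both the energy of the state built by `L'` and the
depth of the cutoff, so this many particles justify `commutator`. -/
theorem vev_commute (L L' : List (ℤ × Polynomial ℚ)) {a b : ℤ} (ha : 0 < a)
    (φ χ : Polynomial ℚ)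
    (hN : ((L ++ (a, φ) :: (b, χ) :: L').map fun x => |x.1|).sum ≤ N) :
    vev N (L ++ (a, φ) :: (b, χ) :: L') = vev N (L ++ (b, χ) :: (a, φ) :: L')
      + vev N (L ++ (a + b, bracket ((a : ℚ) / 2) ((b : ℚ) / 2) φ χ) :: L')
      + (if a + b = 0 then centeredSum a.toNat (φ * χ) else 0) * vev N (L ++ L') := by
  have hs := (isState_vacuum N).applyOps L'
  have hbN : -b ≤ N - (0 - (L'.map Prod.fst).sum) := by
    have h1 := sum_map_abs_le L'
    have h2 := sum_map_abs_nonneg L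
    have h3 := neg_le_abs b
    have h4 := abs_nonneg a
    simp only [List.map_append, List.map_cons, List.sum_append, List.sum_cons] at hN
    lia
  simp only [vev, applyOps_append, applyOps_cons]
  rw [commutator hs ha hbN, applyOps_add, applyOps_add, applyOps_smul]
  rfl

theorem vev_C_mul (L L' : List (ℤ × Polynomial ℚ)) (a : ℤ) (q : ℚ) (φ : Polynomial ℚ) :
    vev N (L ++ (a, Polynomial.C q * φ) :: L') = q * vev N (L ++ (a, φ) :: L') := by
  simp only [vev, applyOps_append, applyOps_cons, op_C_mul, applyOps_smul]
  rfl

end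

section

/-! ### Parts of partitions -/

theorem sort_pairwise {d : ℕ} (lam : Nat.Partition d) :
    (lam.parts.sort (· ≥ ·)).Pairwise (· ≥ ·) := Multiset.pairwise_sort _ _

theorem part_antitone {d : ℕ} (lam : Nat.Partition d) : Antitone (part lam) := by
  intro i j hij
  unfold part
  rcases lt_or_ge j (lam.parts.sort (· ≥ ·)).length with hj | hj
  · rw [List.getD_eq_getElem _ _ hj, List.getD_eq_getElem _ _ (hij.trans_lt hj)]
    rcases hij.eq_or_lt with rfl | h
    · exact le_rfl
    · exact List.pairwise_iff_getElem.1 (sort_pairwise lam) i j _ hj h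
  · rw [List.getD_eq_default _ _ hj]
    exact Nat.zero_le _

theorem length_sort_le {d : ℕ} (lam : Nat.Partition d) :
    (lam.parts.sort (· ≥ ·)).length ≤ d := by
  rw [Multiset.length_sort]
  have h := Multiset.card_nsmul_le_sum (s := lam.parts) (a := 1)
    (fun x hx => lam.parts_pos hx)
  rw [lam.parts_sum] at h
  simpa using h

theorem part_eq_zero {d : ℕ} (lam : Nat.Partition d) {i : ℕ} (hi : d ≤ i) : part lam i = 0 :=
  List.getD_eq_default _ _ ((length_sort_le lam).trans hi)

theorem part_pos_iff {d : ℕ} (lam : Nat.Partition d) (i : ℕ) :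
    0 < part lam i ↔ i < (lam.parts.sort (· ≥ ·)).length := by
  unfold part
  constructor
  · intro h
    by_contra hc
    rw [List.getD_eq_default _ _ (not_lt.1 hc)] at h
    exact lt_irrefl _ h
  · intro h
    rw [List.getD_eq_getElem _ _ h]
    exact lam.parts_pos ((Multiset.mem_sort (r := (· ≥ ·))).1 (List.getElem_mem h))

theorem partition_ext {d N : ℕ} (lam lam' : Nat.Partition d) (hN : d ≤ N)
    (h : ∀ i < N, part lam i = part lam' i) : lam = lam' := by
  have h' : ∀ i, part lam i = part lam' i := by
    intro i
    rcases lt_or_ge i N with hi | hi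
    · exact h i hi
    · rw [part_eq_zero _ (hN.trans hi), part_eq_zero _ (hN.trans hi)]
  have hl : (lam.parts.sort (· ≥ ·)).length = (lam'.parts.sort (· ≥ ·)).length := by
    refine le_antisymm ?_ ?_ <;> refine le_of_forall_lt fun i hi => ?_
    · rwa [← part_pos_iff, ← h', part_pos_iff]
    · rwa [← part_pos_iff, h', part_pos_iff]
  have : lam.parts.sort (· ≥ ·) = lam'.parts.sort (· ≥ ·) := by
    refine List.ext_getElem hl fun i h1 h2 => ?_
    have := h' i
    unfold part at this
    rwa [List.getD_eq_getElem _ _ h1, List.getD_eq_getElem _ _ h2] at this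
  ext1
  rw [← Multiset.sort_eq lam.parts (· ≥ ·), this, Multiset.sort_eq]

theorem getD_filter_ne_zero {l : List ℕ} (h : l.Pairwise (· ≥ ·)) (i : ℕ) :
    (l.filter (· ≠ 0)).getD i 0 = l.getD i 0 := by
  induction l generalizing i with
  | nil => rfl
  | cons x l ih =>
    rw [List.pairwise_cons] at h
    by_cases hx : x = 0
    · have hz : ∀ y ∈ x :: l, y = 0 := by
        intro y hy
        rcases List.mem_cons.1 hy with rfl | hy
        · exact hx
        · have := h.1 y hy; lia
      have : (x :: l).filter (· ≠ 0) = [] := by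
        rw [List.filter_eq_nil_iff]
        intro y hy
        simp [hz y hy]
      rw [this]
      rcases lt_or_ge i (x :: l).length with hi | hi
      · rw [List.getD_eq_getElem _ _ hi, hz _ (List.getElem_mem hi)]; simp
      · rw [List.getD_eq_default _ _ hi]; simp
    · rw [List.filter_cons_of_pos (by simpa using hx)]
      cases i with
      | zero => simp
      | succ i => simpa using ih h.2 i

theorem exists_partition {d N : ℕ} (f : Fin N → ℕ) (hf : Antitone f) (hs : ∑ i, f i = d) :
    ∃ lam : Nat.Partition d, ∀ i : Fin N, part lam i = f i := by
  have hp : (List.ofFn f).Pairwise (· ≥ ·) := List.pairwise_ofFn.2 fun i j hij => hf hij.le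
  let lam : Nat.Partition d :=
    { parts := ((List.ofFn f).filter (· ≠ 0) : List ℕ)
      parts_pos := by
        intro i hi
        simp only [Multiset.mem_coe, List.mem_filter] at hi
        simpa [Nat.pos_iff_ne_zero] using hi.2
      parts_sum := by
        rw [Multiset.sum_coe, ← hs, ← List.sum_ofFn]
        induction List.ofFn f with
        | nil => rfl
        | cons x l ih =>
          by_cases hx : x = 0
          · simp [hx] at ih ⊢; exact ih
          · rw [List.filter_cons_of_pos (by simpa using hx), List.sum_cons, ih, List.sum_cons] }
  refine ⟨lam, fun i => ?_⟩
  have hsort : lam.parts.sort (· ≥ ·) = (List.ofFn f).filter (· ≠ 0) := by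
    refine List.Perm.eq_of_pairwise' (r := (· ≥ ·)) (sort_pairwise lam) (hp.filter _) ?_
    rw [← Multiset.coe_eq_coe, Multiset.sort_eq]
  rw [part, hsort, getD_filter_ne_zero hp]
  simp

end

section

/-! ### Partitions as configurations -/

/-- The configuration of `N` particles given by a partition. -/
def shape (N : ℕ) {d : ℕ} (lam : Nat.Partition d) (i : Fin N) : ℤ := part lam i + stair N i

theorem shape_strictAnti (N : ℕ) {d : ℕ} (lam : Nat.Partition d) : StrictAnti (shape N lam) := by
  intro i j hij
  have h1 := part_antitone lam (show (i : ℕ) ≤ j from hij.le)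
  have h2 : (i : ℕ) < j := hij
  simp only [shape, stair]
  lia

theorem shape_nonneg {N d : ℕ} (lam : Nat.Partition d) (i : Fin N) : 0 ≤ shape N lam i := by
  have := stair_nonneg i
  simp only [shape]
  lia

/-- For integers, strict decrease means a drop of at least one per step. This makes the difference
with the staircase weakly decreasing, that is, a partition. -/
theorem StrictAnti.add_id_le {N : ℕ} {k : Fin N → ℤ} (hk : StrictAnti k) {i j : Fin N}
    (hij : i ≤ j) : k j + j ≤ k i + i := by
  obtain ⟨i, hi⟩ := i
  obtain ⟨j, hj⟩ := j
  simp only [Fin.mk_le_mk] at hij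
  obtain ⟨t, rfl⟩ := Nat.exists_eq_add_of_le hij
  induction t with
  | zero => simp
  | succ t ih =>
    have h1 := ih (by lia) (by lia)
    have h2 := @hk ⟨i + t, by lia⟩ ⟨i + (t + 1), hj⟩ (by simp [Fin.lt_def])
    simp only at h1 h2 ⊢
    push_cast at h1 ⊢
    lia

theorem exists_shape {N d : ℕ} {k : Fin N → ℤ} (hk : Function.Injective k) (h0 : ∀ i, 0 ≤ k i)
    (hs : ∑ i, k i = ∑ i, stair N i + d) :
    ∃ (lam : Nat.Partition d) (π : Equiv.Perm (Fin N)), k = shape N lam ∘ π := by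
  let τ : Equiv.Perm (Fin N) := Fin.revPerm.trans (Tuple.sort k)
  have hanti : Antitone (k ∘ τ) := by
    intro i j hij
    exact Tuple.monotone_sort k (Fin.rev_le_rev.2 hij)
  have hstrict : StrictAnti (k ∘ τ) :=
    hanti.strictAnti_of_injective (hk.comp τ.injective)
  have hge : ∀ i, stair N i ≤ k (τ i) := by
    intro i
    have hi := i.isLt
    have h1 := StrictAnti.add_id_le hstrict (i := i) (j := ⟨N - 1, by lia⟩)
      (by simp [Fin.le_def]; lia)
    have h2 := h0 (τ ⟨N - 1, by lia⟩)
    simp only [Function.comp] at h1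
    simp only [stair]
    lia
  obtain ⟨lam, hlam⟩ := exists_partition (d := d) (fun i => (k (τ i) - stair N i).toNat)
    (by
      intro i j hij
      have h1 := StrictAnti.add_id_le hstrict hij
      have := hge i; have := hge j
      simp only [Function.comp, stair] at h1 this ⊢
      lia)
    (by
      zify
      have : ∀ i, ((k (τ i) - stair N i).toNat : ℤ) = k (τ i) - stair N i := fun i =>
        Int.toNat_of_nonneg (by have := hge i; lia)
      simp only [this, sum_sub_distrib]
      rw [Equiv.sum_comp τ k, hs]
      ring)
  refine ⟨lam, τ⁻¹, ?_⟩
  funext i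
  have h1 := hlam (τ⁻¹ i)
  have h2 := hge (τ⁻¹ i)
  simp only [Function.comp, shape, h1]
  rw [Int.toNat_of_nonneg (by lia)]
  simp

theorem shape_comp_inj {N d : ℕ} (hN : d ≤ N) {lam lam' : Nat.Partition d}
    {π π' : Equiv.Perm (Fin N)} (h : shape N lam ∘ π = shape N lam' ∘ π') :
    lam = lam' ∧ π = π' := by
  have h1 : shape N lam = shape N lam' ∘ (π' * π⁻¹) := by
    funext i
    have := congrFun h (π⁻¹ i)
    simpa using this
  have hmono : StrictMono (π' * π⁻¹) := by
    intro i j hij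
    have := shape_strictAnti N lam hij
    rw [h1] at this
    exact (shape_strictAnti N lam').lt_iff_gt.1 this
  have hid : ⇑(π' * π⁻¹) = id :=
    congrArg DFunLike.coe (Subsingleton.elim
      (hmono.orderIsoOfSurjective _ (π' * π⁻¹).surjective) (OrderIso.refl (Fin N)))
  have hπ : π' * π⁻¹ = 1 := Equiv.ext fun i => congrFun hid i
  refine ⟨partition_ext lam lam' hN fun i hi => ?_, (mul_inv_eq_one.1 hπ).symm⟩
  rw [hid] at h1
  have := congrFun h1 ⟨i, hi⟩
  simp only [shape, Function.comp, id] at this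
  lia

/-- Expansion in the Schur basis: a configuration in the support has distinct entries and sorts, in
a unique way, to the shape of one partition. At least d particles are needed for a partition to be
determined by its shape. -/
theorem IsState.eq_sum_shape {N d : ℕ} (hN : d ≤ N) {ψ : (Fin N → ℤ) → ℚ} (h : IsState d ψ)
    (k : Fin N → ℤ) : ψ k = ∑ lam : Nat.Partition d, ∑ π : Equiv.Perm (Fin N),
      if k = shape N lam ∘ π then ((Equiv.Perm.sign π : ℤ) : ℚ) * ψ (shape N lam) else 0 := by
  by_cases hk : ψ k = 0
  · rw [hk, sum_eq_zero]
    intro lam _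
    rw [sum_eq_zero]
    intro π _
    split_ifs with h1
    · rw [← h.anti, ← h1, hk]
    · rfl
  · obtain ⟨lam, π, rfl⟩ := exists_shape (h.injective hk) (h.nonneg k hk) (h.degree k hk)
    rw [sum_eq_single lam, sum_eq_single π]
    · rw [if_pos rfl, h.anti]
    · intro π' _ hne
      rw [if_neg]
      intro hc
      exact hne (shape_comp_inj hN hc).2.symm
    · simp
    · intro lam' _ hne
      refine sum_eq_zero fun π' _ => if_neg ?_
      intro hc
      exact hne (shape_comp_inj hN hc).1.symm
    · simp

/-! ### Products of operators with constant weight -/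

variable {N : ℕ}

/-- The total displacement, when the `i`-th of the moves `a` is made by the particle `g i`. -/
def content {m : ℕ} (a : Fin m → ℤ) (g : Fin m → Fin N) : Fin N → ℤ :=
  ∑ i, Pi.single (g i) (a i)

theorem content_nonneg {m : ℕ} {a : Fin m → ℤ} (ha : ∀ i, 0 ≤ a i) (g : Fin m → Fin N)
    (c : Fin N) : 0 ≤ content a g c := by
  rw [content, Finset.sum_apply]
  refine sum_nonneg fun i _ => ?_
  by_cases h : c = g i
  · subst h; simpa using ha i
  · simp [h]

theorem content_cons {m : ℕ} (a : Fin (m + 1) → ℤ) (i : Fin N) (g : Fin m → Fin N) :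
    content a (Fin.cons i g) = Pi.single i (a 0) + content (fun j => a j.succ) g := by
  simp [content, Fin.sum_univ_succ]

theorem content_comp_perm {m : ℕ} (a : Fin m → ℤ) (g : Fin m → Fin N)
    (π : Equiv.Perm (Fin N)) : content a (π ∘ g) ∘ π = content a g := by
  funext c
  simp only [content, Function.comp, Finset.sum_apply]
  refine sum_congr rfl fun i _ => ?_
  by_cases h : c = g i
  · subst h; simp
  · simp [h]

theorem sum_cons {m : ℕ} {M : Type*} [AddCommMonoid M] (F : (Fin (m + 1) → Fin N) → M) :
    ∑ g, F g = ∑ i, ∑ g, F (Fin.cons i g) := by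
  rw [← (Fin.consEquiv fun _ => Fin N).sum_comp, Fintype.sum_prod_type]
  rfl

theorem weight_one (a : ℤ) (x : ℤ) : weight N a 1 x = 1 := by simp [weight]

theorem applyOps_lower {m : ℕ} {a : Fin m → ℤ} (ha : ∀ i, 0 < a i) (ψ : (Fin N → ℤ) → ℚ)
    {k : Fin N → ℤ} (hk : ∀ i, 0 ≤ k i) :
    applyOps (List.ofFn fun i => (a i, 1)) ψ k = ∑ g, ψ (k + content a g) := by
  induction m generalizing k with
  | zero => simp [content]
  | succ m ih =>
    rw [List.ofFn_succ, applyOps_cons, op_of_nonneg _ _ _ hk, sum_cons]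
    simp only [vacuumConst, if_neg (ha 0).ne', zero_mul, sub_zero, shiftOp, weight_one, one_mul]
    refine sum_congr rfl fun i _ => ?_
    rw [ih (fun j => ha j.succ)]
    · simp only [content_cons, add_assoc]
    · intro j
      have := hk j
      have := ha 0
      by_cases h : j = i
      · subst h; simp; lia
      · simpa [h]

/-- The cutoff in `op` is invisible here: if k has a negative entry, so has every k - content, and ψ
vanishes there. -/
theorem applyOps_raise {m : ℕ} {a : Fin m → ℤ} (ha : ∀ i, 0 < a i) {ψ : (Fin N → ℤ) → ℚ}
    {e : ℤ} (h : IsState e ψ) (k : Fin N → ℤ) :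
    applyOps (List.ofFn fun i => (-a i, 1)) ψ k = ∑ g, ψ (k - content a g) := by
  induction m generalizing k with
  | zero => simp [content]
  | succ m ih =>
    by_cases hk : ∀ i, 0 ≤ k i
    · rw [List.ofFn_succ, applyOps_cons, op_of_nonneg _ _ _ hk, sum_cons]
      simp only [vacuumConst, if_neg (neg_ne_zero.2 (ha 0).ne'), zero_mul, sub_zero, shiftOp,
        weight_one, one_mul]
      refine sum_congr rfl fun i _ => ?_
      rw [ih (fun j => ha j.succ)]
      simp only [content_cons, Pi.single_neg, ← sub_eq_add_neg, sub_sub]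
    · rw [List.ofFn_succ, applyOps_cons, op, if_neg hk, sum_eq_zero]
      intro g _
      by_contra hc
      apply hk
      intro i
      have h1 := h.nonneg _ hc i
      have h2 := content_nonneg (fun i => (ha i).le) g i
      simp only [Pi.sub_apply] at h1
      lia

/-- The value at the configuration `k` of the state obtained from the vacuum by the moves `a`. -/
def frob (k : Fin N → ℤ) {m : ℕ} (a : Fin m → ℤ) : ℚ := ∑ g, vacuum N (k - content a g)

/-- Lowering is adjoint to raising. A way to move up from the staircase to a permuted shape is,
after relabelling the particles, a way to move down from the shape to a permuted staircase, with the
same sign. -/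
theorem sum_stair_add_content {d m : ℕ} (hN : d ≤ N) {ψ : (Fin N → ℤ) → ℚ} (h : IsState d ψ)
    (a : Fin m → ℤ) :
    ∑ g, ψ (stair N + content a g)
      = ∑ lam : Nat.Partition d, frob (shape N lam) a * ψ (shape N lam) := by
  simp only [h.eq_sum_shape hN (stair N + content a _), frob, sum_mul]
  rw [sum_comm]
  refine sum_congr rfl fun lam _ => ?_
  simp only [vacuum, sum_mul]
  rw [sum_comm]
  conv_rhs => rw [sum_comm]
  refine Fintype.sum_equiv (Equiv.inv (Equiv.Perm (Fin N))) _ _ fun π => ?_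
  refine Fintype.sum_equiv (Equiv.arrowCongr (Equiv.refl (Fin m)) π) _ _ fun g => ?_
  have hiff : stair N + content a g = shape N lam ∘ π
      ↔ shape N lam - content a (π ∘ g) = stair N ∘ ⇑π⁻¹ := by
    rw [sub_eq_iff_eq_add]
    have h1 := content_comp_perm a g π
    constructor
    · intro h
      funext i
      have h2 := congrFun h (π⁻¹ i)
      have h3 := congrFun h1 (π⁻¹ i)
      simp only [Pi.add_apply, Function.comp, Equiv.Perm.coe_inv, Equiv.apply_symm_apply]
        at h2 h3 ⊢
      rw [← h2, h3]
    · intro h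
      funext i
      have h2 := congrFun h (π i)
      have h3 := congrFun h1 i
      simp only [Pi.add_apply, Function.comp, Equiv.Perm.coe_inv, Equiv.symm_apply_apply]
        at h2 h3 ⊢
      rw [h2, h3]
  have hg : (Equiv.arrowCongr (Equiv.refl (Fin m)) π) g = π ∘ g := rfl
  simp only [hg, hiff, ite_mul, zero_mul, Equiv.inv_apply, Equiv.Perm.sign_inv]

/-- The eigenvalue, on the configuration of a partition, of the operator of energy `0`. -/
def eigenvalue (φ : Polynomial ℚ) {d : ℕ} (lam : Nat.Partition d) : ℚ :=
  ∑ i ∈ range d,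
    (φ.eval ((part lam i : ℚ) - ((i : ℚ) + 1) + 1 / 2) - φ.eval (-((i : ℚ) + 1) + 1 / 2))

theorem applyOps_replicate {d : ℕ} (hN : d ≤ N) (lam : Nat.Partition d) (φ : Polynomial ℚ) (s : ℕ)
    (ψ : (Fin N → ℤ) → ℚ) :
    applyOps (List.replicate s (0, φ)) ψ (shape N lam)
      = eigenvalue φ lam ^ s * ψ (shape N lam) := by
  induction s with
  | zero => simp
  | succ s ih =>
    rw [List.replicate_succ, applyOps_cons, op_of_nonneg _ _ _ (shape_nonneg lam), shiftOp,
      vacuumConst, if_pos rfl]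
    simp only [Pi.single_zero, add_zero, ← sum_mul, ih]
    rw [← sub_mul, pow_succ', mul_assoc]
    congr 1
    have h1 : eigenvalue φ lam = ∑ i ∈ range N, (φ.eval ((part lam i : ℚ) - ((i : ℚ) + 1) + 1 / 2)
        - φ.eval (-((i : ℚ) + 1) + 1 / 2)) := by
      refine sum_subset (by simpa using hN) fun i _ hi => ?_
      rw [part_eq_zero lam (by simpa using hi)]
      simp
    rw [h1, sum_sub_distrib, ← sum_range_reflect (fun v : ℕ => φ.eval ((v : ℚ) - N + 1 / 2)),
      ← Fin.sum_univ_eq_sum_range (fun i => φ.eval ((part lam i : ℚ) - ((i : ℚ) + 1) + 1 / 2))]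
    congr 1
    · refine sum_congr rfl fun i _ => ?_
      simp only [weight, shape, stair]
      push_cast
      ring_nf
    · refine sum_congr rfl fun i hi => ?_
      have hi := mem_range.1 hi
      rw [Nat.sub_sub, Nat.cast_sub (by lia)]
      push_cast
      ring_nf

/-- The Schur basis is inserted to the right of the lowering operators; the operators of energy 0
act on it by eigenvalues. -/
theorem vev_eq_sum_partition {d m n : ℕ} (hN : d ≤ N) {a : Fin m → ℤ} {b : Fin n → ℤ}
    (ha : ∀ i, 0 < a i) (hb : ∀ i, 0 < b i) (hd : ∑ i, b i = d) (φ : Polynomial ℚ) (s : ℕ) :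
    vev N (List.ofFn (fun i => (a i, 1)) ++ (List.replicate s (0, φ)
      ++ List.ofFn (fun i => (-b i, 1)))) = ∑ lam : Nat.Partition d,
        frob (shape N lam) a * eigenvalue φ lam ^ s * frob (shape N lam) b := by
  have hs : IsState d (applyOps (List.replicate s (0, φ) ++ List.ofFn (fun i => (-b i, 1)))
      (vacuum N)) := by
    have := (isState_vacuum N).applyOps
      (List.replicate s (0, φ) ++ List.ofFn (fun i => (-b i, 1)))
    convert this using 1
    simp [List.sum_ofFn, Function.comp_def, ← hd]
  rw [vev, applyOps_append, applyOps_lower ha _ stair_nonneg, sum_stair_add_content hN hs]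
  refine sum_congr rfl fun lam _ => ?_
  rw [applyOps_append, applyOps_replicate hN, applyOps_raise hb (isState_vacuum N), mul_assoc]
  rfl

end

section

/-! ### Orthogonality -/

/-- The product of the elements of a multiset and of the factorials of its multiplicities. -/
def zee (s : Multiset ℕ) : ℕ := s.prod * ∏ x ∈ s.toFinset, (s.count x).factorial

theorem prod_count_factorial {s : Multiset ℕ} {T : Finset ℕ} (h : s.toFinset ⊆ T) :
    ∏ x ∈ s.toFinset, (s.count x).factorial = ∏ x ∈ T, (s.count x).factorial :=
  prod_subset h fun x _ hx => by
    rw [Multiset.mem_toFinset] at hx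
    rw [Multiset.count_eq_zero_of_notMem hx, Nat.factorial_zero]

theorem zee_cons (a : ℕ) (s : Multiset ℕ) : zee (a ::ₘ s) = a * (s.count a + 1) * zee s := by
  have ha : a ∈ (a ::ₘ s).toFinset := by simp
  have hs : s.toFinset ⊆ (a ::ₘ s).toFinset := by intro x; simp +contextual
  rw [zee, zee, prod_count_factorial hs, ← mul_prod_erase _ _ ha, ← mul_prod_erase _ _ ha,
    Multiset.count_cons_self, Nat.factorial_succ, Multiset.prod_cons]
  have : ∏ x ∈ (a ::ₘ s).toFinset.erase a, ((a ::ₘ s).count x).factorial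
      = ∏ x ∈ (a ::ₘ s).toFinset.erase a, (s.count x).factorial :=
    prod_congr rfl fun x hx => by
      rw [Multiset.count_cons_of_ne (ne_of_mem_erase hx)]
  rw [this]
  ring

theorem zee_pos {s : Multiset ℕ} (h : ∀ x ∈ s, 0 < x) : 0 < zee s := by
  refine Nat.mul_pos ?_ (prod_pos fun x _ => Nat.factorial_pos _)
  rw [Nat.pos_iff_ne_zero]
  intro hc
  have := h 0 (Multiset.prod_eq_zero_iff.1 hc)
  exact lt_irrefl _ this

variable {N : ℕ}

/-- The list of the operators of energies `A` with weight `1`. -/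
def lowering (A : List ℕ) : List (ℤ × Polynomial ℚ) := A.map fun a : ℕ => ((a : ℤ), 1)

/-- The list of the operators of energies `-B` with weight `1`. -/
def raising (B : List ℕ) : List (ℤ × Polynomial ℚ) := B.map fun b : ℕ => (-(b : ℤ), 1)

theorem op_raise {b : ℕ} (hb : 0 < b) {e : ℤ} {ψ : (Fin N → ℤ) → ℚ} (h : IsState e ψ)
    (k : Fin N → ℤ) : op (-b) 1 ψ k = ∑ i, ψ (k - Pi.single i (b : ℤ)) := by
  have h1 := applyOps_raise (m := 1) (a := fun _ => (b : ℤ)) (fun _ => by exact_mod_cast hb) h k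
  rw [sum_cons] at h1
  simpa [content_cons, content] using h1

theorem op_raise_comm {b c : ℕ} (hb : 0 < b) (hc : 0 < c) {e : ℤ} {ψ : (Fin N → ℤ) → ℚ}
    (h : IsState e ψ) : op (-b) 1 (op (-c) 1 ψ) = op (-c) 1 (op (-b) 1 ψ) := by
  funext k
  rw [op_raise hb (h.op _ _), op_raise hc (h.op _ _)]
  simp only [op_raise hb h, op_raise hc h]
  rw [sum_comm]
  simp only [sub_right_comm]

theorem applyOps_raising_perm {B B' : List ℕ} (h : B.Perm B') (hB : ∀ b ∈ B, 0 < b) :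
    applyOps (raising B) (vacuum N) = applyOps (raising B') (vacuum N) := by
  induction h with
  | nil => rfl
  | cons x _ ih =>
    simp only [raising, List.map_cons, applyOps_cons] at ih ⊢
    rw [ih fun b hb => hB b (List.mem_cons_of_mem _ hb)]
  | swap x y l =>
    simp only [raising, List.map_cons, applyOps_cons]
    exact op_raise_comm (hB y (by simp)) (hB x (by simp)) ((isState_vacuum N).applyOps _)
  | trans h1 _ ih1 ih2 =>
    rw [ih1 hB, ih2 fun b hb => hB b (h1.mem_iff.2 hb)]

theorem centeredSum_one (a : ℕ) : centeredSum a 1 = a := by simp [centeredSum]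

theorem vev_zero_weight (L L' : List (ℤ × Polynomial ℚ)) (a : ℤ) :
    vev N (L ++ (a, 0) :: L') = 0 := by
  have := vev_C_mul (N := N) L L' a 0 0
  simpa using this

/-- Heisenberg relations: the bracket of constant weights is 0 and the central term is a. The
lowering operator moves right, removes each raising operator of its own energy in turn, and dies on
the vacuum. -/
theorem vev_absorb {a : ℕ} (ha : 0 < a) (B : List ℕ) (hB : ∀ b ∈ B, 0 < b)
    (L : List (ℤ × Polynomial ℚ))
    (hN : ((L ++ ((a : ℤ), 1) :: raising B).map fun x => |x.1|).sum ≤ N) :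
    vev N (L ++ ((a : ℤ), 1) :: raising B) = a * B.count a * vev N (L ++ raising (B.erase a)) := by
  induction B generalizing L with
  | nil =>
    have := vev_append_pos (N := N) (x := ((a : ℤ), 1)) (Int.natCast_pos.2 ha) L
    simpa [raising] using this
  | cons b B ih =>
    have ha' : (0 : ℤ) < a := by exact_mod_cast ha
    have hB' : ∀ b ∈ B, 0 < b := fun b hb => hB b (List.mem_cons_of_mem _ hb)
    have hr : raising (b :: B) = (-(b : ℤ), 1) :: raising B := rfl
    rw [hr] at hN ⊢
    rw [vev_commute L (raising B) ha' 1 1 hN]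
    have hz : bracket (((a : ℤ) : ℚ) / 2) (((-(b : ℤ) : ℤ) : ℚ) / 2) 1 1 = 0 := by
      simp [bracket]
    have h1 := ih hB' (L ++ [(-(b : ℤ), 1)]) (by
      refine le_trans (le_of_eq ?_) hN
      simp only [List.map_append, List.map_cons, List.sum_append, List.sum_cons, List.map_nil,
        List.sum_nil]
      ring)
    simp only [List.append_assoc, List.singleton_append] at h1
    rw [h1, hz, vev_zero_weight, add_zero, mul_one, Int.toNat_natCast, centeredSum_one]
    by_cases hab : b = a
    · subst hab
      rw [if_pos (by simp), List.count_cons_self, List.erase_cons_head]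
      -- If b occurs again, the inductive term has b in front of `B` with one b erased; raising
      -- operators commute, so this is `B` up to order and the two contributions add.
      by_cases hm : b ∈ B
      · have hp : applyOps (raising (b :: B.erase b)) (vacuum N)
            = applyOps (raising B) (vacuum N) :=
          applyOps_raising_perm (List.perm_cons_erase hm).symm (by
            intro x hx
            rcases List.mem_cons.1 hx with rfl | hx
            · exact ha
            · exact hB' x (List.mem_of_mem_erase hx))
        have : vev N (L ++ (-(b : ℤ), 1) :: raising (B.erase b)) = vev N (L ++ raising B) := by
          rw [vev, applyOps_append, vev, applyOps_append, ← hp]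
          rfl
        rw [this]
        push_cast
        ring
      · rw [List.count_eq_zero_of_not_mem hm]
        simp
    · rw [if_neg (by lia), List.count_cons_of_ne (by simpa using hab),
        List.erase_cons_tail (by simpa using hab), zero_mul, add_zero]
      rfl

theorem vev_lowering_raising (A B : List ℕ) (hA : ∀ a ∈ A, 0 < a) (hB : ∀ b ∈ B, 0 < b)
    (hN : A.sum + B.sum ≤ N) :
    vev N (lowering A ++ raising B) = if (A : Multiset ℕ) = B then (zee A : ℚ) else 0 := by
  induction A using List.reverseRecOn generalizing B with
  | nil =>
    cases B with
    | nil => simp [lowering, raising, vev_nil, zee]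
    | cons b B =>
      have hr : raising (b :: B) = (-(b : ℤ), 1) :: raising B := rfl
      rw [if_neg (by simp [eq_comm])]
      simp only [lowering, List.map_nil, List.nil_append, hr]
      exact vev_cons_nonpos (by simp) _
  | append_singleton A a ih =>
    have ha : 0 < a := hA a (by simp)
    have hA' : ∀ x ∈ A, 0 < x := fun x hx => hA x (by simp [hx])
    have hl : lowering (A ++ [a]) ++ raising B = lowering A ++ ((a : ℤ), 1) :: raising B := by
      simp [lowering]
    have hsum : ((lowering A ++ ((a : ℤ), 1) :: raising B).map fun x => |x.1|).sum ≤ N := by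
      have e : ((lowering A ++ ((a : ℤ), 1) :: raising B).map fun x => |x.1|).sum
          = ((A.sum + a + B.sum : ℕ) : ℤ) := by
        simp [lowering, raising, Function.comp_def]
        ring
      rw [e]
      simp only [List.sum_append, List.sum_singleton] at hN
      exact_mod_cast hN
    rw [hl, vev_absorb ha B hB _ hsum]
    have hAa : ((A ++ [a] : List ℕ) : Multiset ℕ) = a ::ₘ (A : Multiset ℕ) := by
      rw [← Multiset.coe_add, add_comm]; rfl
    by_cases hm : a ∈ B
    · have hsE : a + (B.erase a).sum = B.sum := List.sum_erase hm
      rw [ih (B.erase a) hA' (fun b hb => hB b (List.mem_of_mem_erase hb))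
        (by simp only [List.sum_append, List.sum_singleton] at hN; lia), hAa, zee_cons]
      have hBm : (B : Multiset ℕ) = a ::ₘ ((B.erase a : List ℕ) : Multiset ℕ) := by
        rw [Multiset.cons_coe, Multiset.coe_eq_coe]
        exact List.perm_cons_erase hm
      simp only [hBm, Multiset.cons_inj_right]
      by_cases hAB : (A : Multiset ℕ) = (B.erase a : List ℕ)
      · rw [if_pos hAB, if_pos hAB, hAB, Multiset.coe_count, List.count_erase_self]
        have : 0 < B.count a := List.count_pos_iff.2 hm
        have h2 : B.count a - 1 + 1 = B.count a := by lia
        rw [h2]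
        push_cast
        ring
      · rw [if_neg hAB, if_neg hAB, mul_zero]
    · rw [List.count_eq_zero_of_not_mem hm, if_neg]
      · simp
      · intro hc
        rw [hAa] at hc
        apply hm
        rw [← Multiset.mem_coe, ← hc]
        simp

/-- Column orthogonality: both sides compute the expectation of lowering operators times raising
operators. The bound 2 d is the total of the absolute energies. -/
theorem sum_frob_mul_frob {d m n : ℕ} (hN : 2 * d ≤ N) {a : Fin m → ℕ} {b : Fin n → ℕ}
    (ha : ∀ i, 0 < a i) (hb : ∀ i, 0 < b i) (had : ∑ i, a i = d) (hbd : ∑ i, b i = d) :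
    ∑ lam : Nat.Partition d,
      frob (shape N lam) (fun i => (a i : ℤ)) * frob (shape N lam) (fun i => (b i : ℤ))
      = if univ.val.map a = univ.val.map b then (zee (univ.val.map a) : ℚ) else 0 := by
  have h1 := vev_eq_sum_partition (N := N) (d := d) (by lia) (a := fun i => (a i : ℤ))
    (b := fun i => (b i : ℤ)) (fun i => by exact_mod_cast ha i) (fun i => by exact_mod_cast hb i)
    (by exact_mod_cast hbd) 0 0
  have h2 := vev_lowering_raising (N := N) (List.ofFn a) (List.ofFn b)
    (by simpa [List.mem_ofFn] using ha) (by simpa [List.mem_ofFn] using hb)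
    (by rw [List.sum_ofFn, List.sum_ofFn, had, hbd]; lia)
  simp only [List.replicate_zero, List.nil_append, pow_zero, mul_one] at h1
  have hm : ∀ {m : ℕ} (a : Fin m → ℕ), ((List.ofFn a : List ℕ) : Multiset ℕ) = univ.val.map a :=
    fun a => (Fin.univ_val_map a).symm
  rw [← h1, ← hm, ← hm, ← h2]
  simp only [lowering, raising, List.map_ofFn]
  rfl

end

section

/-! ### Functions that are constant on the cycles of a permutation -/

theorem exists_equiv_comp_eq {α β γ : Type*} [Fintype α] [Fintype β] [DecidableEq γ]
    (f : α → γ) (g : β → γ) (h : ∀ c, #{a | f a = c} = #{b | g b = c}) :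
    ∃ e : α ≃ β, g ∘ e = f := by
  have hc : ∀ c, Fintype.card {a // f a = c} = Fintype.card {b // g b = c} := by
    intro c
    rw [Fintype.card_subtype, Fintype.card_subtype, h]
  let e : α ≃ β := (Equiv.sigmaFiberEquiv f).symm.trans
    ((Equiv.sigmaCongrRight fun c => Fintype.equivOfCardEq (hc c)).trans (Equiv.sigmaFiberEquiv g))
  refine ⟨e, funext fun a => ?_⟩
  exact (Fintype.equivOfCardEq (hc (f a)) ⟨a, rfl⟩).2

theorem exists_equiv_of_map_eq {α β γ : Type*} [Fintype α] [Fintype β] [DecidableEq γ]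
    (f : α → γ) (g : β → γ) (h : univ.val.map f = univ.val.map g) :
    ∃ e : α ≃ β, g ∘ e = f := by
  refine exists_equiv_comp_eq f g fun c => ?_
  have h1 := congrArg (Multiset.count c) h
  rw [Multiset.count_map, Multiset.count_map] at h1
  simp only [eq_comm (a := c)] at h1
  exact h1

/-- The cycles of a permutation, fixed points included. -/
abbrev Cycles {d : ℕ} (σ : Equiv.Perm (Fin d)) : Type :=
  {c // c ∈ σ.cycleFactorsFinset} ⊕ {k // σ k = k}

/-- The cycle of an element. -/
def toCycle {d : ℕ} (σ : Equiv.Perm (Fin d)) (k : Fin d) : Cycles σ :=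
  if h : σ k = k then Sum.inr ⟨k, h⟩ else
    Sum.inl ⟨σ.cycleOf k, Equiv.Perm.cycleOf_mem_cycleFactorsFinset_iff.2
      (Equiv.Perm.mem_support.2 h)⟩

/-- The length of a cycle. -/
def cycleSize {d : ℕ} (σ : Equiv.Perm (Fin d)) : Cycles σ → ℕ :=
  Sum.elim (fun c => #c.1.support) fun _ => 1

theorem toCycle_apply {d : ℕ} (σ : Equiv.Perm (Fin d)) (k : Fin d) :
    toCycle σ (σ k) = toCycle σ k := by
  by_cases h : σ k = k
  · rw [h]
  · have h' : σ (σ k) ≠ σ k := fun hc => h (σ.injective hc)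
    rw [toCycle, toCycle, dif_neg h, dif_neg h']
    congr 2
    exact Equiv.Perm.cycleOf_self_apply σ k

theorem sameCycle_of_toCycle_eq {d : ℕ} (σ : Equiv.Perm (Fin d)) {k k' : Fin d}
    (h : toCycle σ k = toCycle σ k') : σ.SameCycle k k' := by
  by_cases h1 : σ k = k <;> by_cases h2 : σ k' = k'
  · rw [toCycle, toCycle, dif_pos h1, dif_pos h2] at h
    simp only [Sum.inr.injEq, Subtype.mk.injEq] at h
    rw [h]
  · rw [toCycle, toCycle, dif_pos h1, dif_neg h2] at h
    exact absurd h (by simp)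
  · rw [toCycle, toCycle, dif_neg h1, dif_pos h2] at h
    exact absurd h (by simp)
  · rw [toCycle, toCycle, dif_neg h1, dif_neg h2] at h
    simp only [Sum.inl.injEq, Subtype.mk.injEq] at h
    exact (Equiv.Perm.sameCycle_iff_cycleOf_eq_of_mem_support (Equiv.Perm.mem_support.2 h1)
      (Equiv.Perm.mem_support.2 h2)).2 h

theorem card_toCycle_eq {d : ℕ} (σ : Equiv.Perm (Fin d)) (c : Cycles σ) :
    #{k | toCycle σ k = c} = cycleSize σ c := by
  rcases c with ⟨c, hc⟩ | ⟨k, hk⟩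
  · simp only [cycleSize, Sum.elim_inl]
    congr 1
    ext k
    simp only [mem_filter, mem_univ, true_and]
    constructor
    · intro h
      by_cases h1 : σ k = k
      · rw [toCycle, dif_pos h1] at h
        exact absurd h (by simp)
      · rw [toCycle, dif_neg h1] at h
        simp only [Sum.inl.injEq, Subtype.mk.injEq] at h
        rw [← h, Equiv.Perm.mem_support_cycleOf_iff]
        exact ⟨Equiv.Perm.SameCycle.refl _ _, Equiv.Perm.mem_support.2 h1⟩
    · intro h
      have h1 : σ k ≠ k := Equiv.Perm.mem_support.1
        (Equiv.Perm.mem_cycleFactorsFinset_support_le hc h)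
      rw [toCycle, dif_neg h1]
      simp only [Sum.inl.injEq, Subtype.mk.injEq]
      exact (Equiv.Perm.cycle_is_cycleOf h hc).symm
  · simp only [cycleSize, Sum.elim_inr]
    rw [card_eq_one]
    refine ⟨k, ?_⟩
    ext l
    simp only [mem_filter, mem_univ, true_and, mem_singleton]
    constructor
    · intro h
      by_cases h1 : σ l = l
      · rw [toCycle, dif_pos h1] at h
        simpa using h
      · rw [toCycle, dif_neg h1] at h
        exact absurd h (by simp)
    · rintro rfl
      rw [toCycle, dif_pos hk]

theorem map_cycleSize {d : ℕ} (σ : Equiv.Perm (Fin d)) :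
    univ.val.map (cycleSize σ) = σ.partition.parts := by
  rw [Equiv.Perm.parts_partition]
  have h1 : (univ : Finset (Cycles σ)) = univ.disjSum univ := (univ_disjSum_univ).symm
  have h0 : (univ : Finset (Cycles σ)).val
      = (univ : Finset {c // c ∈ σ.cycleFactorsFinset}).val.disjSum
        (univ : Finset {k // σ k = k}).val := by
    rw [h1, val_disjSum]
  rw [h0, Multiset.disjSum, Multiset.map_add, Multiset.map_map, Multiset.map_map]
  congr 1
  · rw [Equiv.Perm.cycleType_def, univ_eq_attach, attach_val]
    exact Multiset.attach_map_val' σ.cycleFactorsFinset.val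
      (fun c : Equiv.Perm (Fin d) => #c.support)
  · have : (cycleSize σ ∘ Sum.inr) = Function.const {k // σ k = k} 1 := rfl
    rw [this, Multiset.map_const]
    congr 1
    rw [card_val, card_univ, Fintype.card_subtype]
    have h2 := card_filter_add_card_filter_not (s := (univ : Finset (Fin d))) (fun k => σ k = k)
    have h3 : #{k | ¬ σ k = k} = #σ.support := by
      congr 1
    rw [card_univ] at h2
    lia

theorem exists_labelling {d m : ℕ} (σ : Equiv.Perm (Fin d)) (μ : Fin m → ℕ)
    (h : σ.partition.parts = univ.val.map μ) :
    ∃ l : Fin d → Fin m, (∀ k, l (σ k) = l k) ∧ (∀ k k', l k = l k' → σ.SameCycle k k') ∧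
      ∀ i, #{k | l k = i} = μ i := by
  obtain ⟨e, he⟩ := exists_equiv_of_map_eq (cycleSize σ) μ ((map_cycleSize σ).trans h)
  refine ⟨fun k => e (toCycle σ k), fun k => congrArg e (toCycle_apply σ k),
    fun k k' hk => sameCycle_of_toCycle_eq σ (e.injective hk), fun i => ?_⟩
  have h1 := card_toCycle_eq σ (e.symm i)
  have h2 := congrFun he (e.symm i)
  simp only [Function.comp, Equiv.apply_symm_apply] at h2
  rw [h2, ← h1]
  congr 1
  ext k
  simp [Equiv.eq_symm_apply]

theorem exists_perm_of_parts {d : ℕ} (s : Multiset ℕ) (hs : ∀ x ∈ s, 0 < x) (hd : s.sum = d) :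
    ∃ σ : Equiv.Perm (Fin d), σ.partition.parts = s := by
  have hsplit := Multiset.filter_add_not (fun x => 2 ≤ x) s
  have hone : s.filter (fun x => ¬ 2 ≤ x)
      = Multiset.replicate (s.filter (fun x => ¬ 2 ≤ x)).card 1 := by
    rw [Multiset.eq_replicate_card]
    intro x hx
    rw [Multiset.mem_filter] at hx
    have := hs x hx.1
    lia
  have hsum : (s.filter (fun x => 2 ≤ x)).sum + (s.filter (fun x => ¬ 2 ≤ x)).card = d := by
    rw [← hd]
    conv_rhs => rw [← hsplit, Multiset.sum_add, hone]
    simp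
  obtain ⟨σ, hσ⟩ := (Equiv.Perm.exists_with_cycleType_iff (Fin d)
    (m := s.filter (fun x => 2 ≤ x))).2 ⟨by rw [Fintype.card_fin]; lia, fun a ha =>
      (Multiset.mem_filter.1 ha).2⟩
  refine ⟨σ, ?_⟩
  rw [Equiv.Perm.parts_partition, ← Equiv.Perm.sum_cycleType, hσ, Fintype.card_fin]
  conv_rhs => rw [← hsplit, hone]
  congr 2
  lia

/-! ### The Frobenius formula as a function on permutations -/

variable {N d : ℕ}

/-- The right-hand side of the Frobenius character formula. -/
def permFrob (N : ℕ) (lam : Nat.Partition d) (σ : Equiv.Perm (Fin d)) : ℚ :=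
  ∑ f : Fin d → Fin N with f ∘ σ = f, vacuum N (shape N lam - content (fun _ => 1) f)

theorem apply_eq_of_sameCycle {β : Type*} {σ : Equiv.Perm (Fin d)} {f : Fin d → β}
    (hf : f ∘ σ = f) {k k' : Fin d} (h : σ.SameCycle k k') : f k = f k' := by
  have hn : ∀ (n : ℕ) (k : Fin d), f ((σ ^ n) k) = f k := by
    intro n
    induction n with
    | zero => simp
    | succ n ih =>
      intro k
      rw [pow_succ', Equiv.Perm.mul_apply]
      exact (congrFun hf _).trans (ih k)
  obtain ⟨n, hn'⟩ := h.exists_nat_pow_eq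
  rw [← hn', hn]

/-- A colouring fixed by σ is a choice of a colour for each cycle, and a cycle of length μ_i
contributes μ_i unit moves of the same particle. -/
theorem permFrob_eq_frob {m : ℕ} (lam : Nat.Partition d) (σ : Equiv.Perm (Fin d)) (μ : Fin m → ℕ)
    (hμ : ∀ i, 0 < μ i) (h : σ.partition.parts = univ.val.map μ) :
    permFrob N lam σ = frob (shape N lam) (fun i => (μ i : ℤ)) := by
  obtain ⟨l, hl1, hl2, hl3⟩ := exists_labelling σ μ h
  have hsurj : Function.Surjective l := by
    intro i
    have : 0 < #{k | l k = i} := by rw [hl3]; exact hμ i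
    obtain ⟨k, hk⟩ := card_pos.1 this
    exact ⟨k, (mem_filter.1 hk).2⟩
  rw [permFrob, frob]
  symm
  refine sum_bij (fun g _ => g ∘ l) ?_ ?_ ?_ ?_
  · intro g _
    rw [mem_filter]
    refine ⟨mem_univ _, funext fun k => ?_⟩
    simp only [Function.comp, hl1]
  · intro g _ g' _ hg
    exact hsurj.injective_comp_right hg
  · intro f hf
    rw [mem_filter] at hf
    refine ⟨fun i => f (Function.surjInv hsurj i), mem_univ _, funext fun k => ?_⟩
    exact apply_eq_of_sameCycle hf.2 (hl2 _ _ (Function.surjInv_eq hsurj (l k)))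
  · intro g _
    congr 2
    simp only [content, Function.comp]
    rw [← sum_fiberwise univ l]
    refine sum_congr rfl fun i _ => ?_
    rw [sum_congr rfl (g := fun _ => Pi.single (g i) (1 : ℤ))]
    · rw [sum_const, hl3, ← Pi.single_smul]
      simp
    · intro k hk
      rw [(mem_filter.1 hk).2]

/-- The parts of a partition, as a function on an index type. -/
def partsFn (c : Nat.Partition d) (i : Fin (c.parts.sort (· ≥ ·)).length) : ℕ :=
  (c.parts.sort (· ≥ ·)).get i

theorem map_partsFn (c : Nat.Partition d) : univ.val.map (partsFn c) = c.parts := by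
  rw [Fin.univ_val_map]
  have : List.ofFn (partsFn c) = c.parts.sort (· ≥ ·) := List.ofFn_get _
  rw [this]
  exact Multiset.sort_eq _ _

theorem partsFn_pos (c : Nat.Partition d) (i : Fin (c.parts.sort (· ≥ ·)).length) :
    0 < partsFn c i := by
  apply c.parts_pos
  rw [← map_partsFn c]
  exact Multiset.mem_map_of_mem _ (mem_univ_val _)

theorem sum_partsFn (c : Nat.Partition d) : ∑ i, partsFn c i = d := by
  have h : (univ.val.map (partsFn c)).sum = d := by rw [map_partsFn, c.parts_sum]
  exact h

/-- The cycle lengths of a permutation of `Fin d`, as a partition of `d`. -/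
def cyclePartition (σ : Equiv.Perm (Fin d)) : Nat.Partition d where
  parts := σ.partition.parts
  parts_pos := σ.partition.parts_pos
  parts_sum := by rw [σ.partition.parts_sum, Fintype.card_fin]

theorem zee_replicate_add (s : Multiset ℕ) (h : s.count 1 = 0) (j : ℕ) :
    zee (Multiset.replicate j 1 + s) = j.factorial * zee s := by
  induction j with
  | zero => simp
  | succ j ih =>
    rw [Multiset.replicate_succ, Multiset.cons_add, zee_cons, ih, Multiset.count_add,
      Multiset.count_replicate_self, h, Nat.factorial_succ]
    ring

theorem card_cyclePartition_mul_zee (c : Nat.Partition d) :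
    #{σ : Equiv.Perm (Fin d) | cyclePartition σ = c} * zee c.parts = d.factorial := by
  obtain ⟨σ, hσ⟩ := exists_perm_of_parts c.parts (fun x hx => c.parts_pos hx) c.parts_sum
  have h1 := Equiv.Perm.card_isConj_mul_eq σ
  rw [Fintype.card_fin] at h1
  have hz : zee c.parts = (d - σ.cycleType.sum).factorial * σ.cycleType.prod *
      ∏ n ∈ σ.cycleType.toFinset, (σ.cycleType.count n).factorial := by
    rw [← hσ, Equiv.Perm.parts_partition, add_comm, zee_replicate_add, Equiv.Perm.sum_cycleType,
      Fintype.card_fin, zee, mul_assoc]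
    rw [Multiset.count_eq_zero]
    intro hc
    have := Equiv.Perm.two_le_of_mem_cycleType hc
    lia
  rw [hz, ← h1]
  congr 1
  have : {h : Equiv.Perm (Fin d) | IsConj σ h}
      = ((univ.filter fun τ : Equiv.Perm (Fin d) => cyclePartition τ = c : Finset _) :
        Set (Equiv.Perm (Fin d))) := by
    ext τ
    simp only [Set.mem_ofPred_eq, coe_filter, mem_univ, true_and]
    rw [Equiv.Perm.partition_eq_of_isConj, Nat.Partition.ext_iff, Nat.Partition.ext_iff, hσ]
    exact eq_comm
  rw [this]
  simp

theorem permFrob_eq (lam : Nat.Partition d) (σ : Equiv.Perm (Fin d)) :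
    permFrob N lam σ
      = frob (shape N lam) (fun i => (partsFn (cyclePartition σ) i : ℤ)) :=
  permFrob_eq_frob lam σ _ (partsFn_pos _) (by rw [map_partsFn]; rfl)

/-- Rows and columns of the table are both indexed by partitions of d, so a left inverse is a right
inverse and column orthogonality gives row orthogonality. The class sizes d!/z convert the sum over
classes to one over permutations. -/
theorem sum_permFrob_sq (hN : 2 * d ≤ N) (lam : Nat.Partition d) :
    ∑ σ, permFrob N lam σ ^ 2 = (d.factorial : ℚ) := by
  let M : Matrix (Nat.Partition d) (Nat.Partition d) ℚ := fun lam c =>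
    frob (shape N lam) (fun i => (partsFn c i : ℤ))
  let Z : Matrix (Nat.Partition d) (Nat.Partition d) ℚ :=
    Matrix.diagonal fun c => (zee c.parts : ℚ)⁻¹
  have hz : ∀ c : Nat.Partition d, (zee c.parts : ℚ) ≠ 0 := fun c => by
    exact_mod_cast (zee_pos fun x hx => c.parts_pos hx).ne'
  have h1 : (Z * M.transpose) * M = 1 := by
    have : M.transpose * M = Matrix.diagonal fun c => (zee c.parts : ℚ) := by
      ext c c'
      rw [Matrix.mul_apply, Matrix.diagonal_apply]
      have := sum_frob_mul_frob hN (partsFn_pos c) (partsFn_pos c') (sum_partsFn c)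
        (sum_partsFn c')
      simp only [map_partsFn, ← Nat.Partition.ext_iff] at this
      exact this
    rw [mul_assoc, this, Matrix.diagonal_mul_diagonal]
    simp only [inv_mul_cancel₀ (hz _), Matrix.diagonal_one]
  have h2 := mul_eq_one_comm.1 h1
  have h3 := congrFun (congrFun h2 lam) lam
  rw [Matrix.mul_apply, Matrix.one_apply_eq] at h3
  simp only [Z, Matrix.diagonal_mul, Matrix.transpose_apply] at h3
  rw [← sum_fiberwise univ cyclePartition, ← mul_one (d.factorial : ℚ), ← h3, mul_sum]
  refine sum_congr rfl fun c _ => ?_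
  have h4 : ∀ σ ∈ univ.filter (fun σ : Equiv.Perm (Fin d) => cyclePartition σ = c),
      permFrob N lam σ ^ 2 = M lam c ^ 2 := by
    intro σ hσ
    rw [permFrob_eq, (mem_filter.1 hσ).2]
  rw [sum_congr rfl h4, sum_const, ← card_cyclePartition_mul_zee c]
  push_cast
  rw [nsmul_eq_mul]
  have := hz c
  field_simp

end

section

/-! ### Rows and columns of the tableau -/

theorem eq_range_of_downward_closed {T : Finset ℕ} (h : ∀ i ∈ T, ∀ j ≤ i, j ∈ T) :
    T = range #T := by
  have hex : ∃ n, n ∉ T := Infinite.exists_notMem_finset T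
  have : T = range (Nat.find hex) := by
    ext i
    rw [mem_range]
    constructor
    · intro hi
      by_contra hc
      exact Nat.find_spec hex (h i hi _ (not_lt.1 hc))
    · intro hi
      by_contra hc
      exact Nat.find_min hex hi hc
  rw [this, card_range]

theorem card_mul_le_sum_sdiff (S : Finset ℕ) (n : ℕ) :
    #(S \ range n) * n ≤ ∑ x ∈ S \ range n, x := by
  rw [← smul_eq_mul]
  exact card_nsmul_le_sum _ _ _ fun x hx => by
    rw [mem_sdiff, mem_range] at hx
    lia

theorem sum_range_card_le (S : Finset ℕ) : ∑ x ∈ range #S, x ≤ ∑ x ∈ S, x := by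
  rw [← sum_inter_add_sum_sdiff S (range #S), ← sum_inter_add_sum_sdiff (range #S) S,
    inter_comm]
  have h1 := card_mul_le_sum_sdiff S #S
  have h2 : ∑ x ∈ range #S \ S, x ≤ #(range #S \ S) * #S := by
    rw [← smul_eq_mul]
    exact sum_le_card_nsmul _ _ _ fun x hx => by
      rw [mem_sdiff, mem_range] at hx
      lia
  have h3 : #(range #S \ S) = #(S \ range #S) := card_sdiff_comm (by simp)
  rw [h3] at h2
  lia

theorem eq_range_of_sum_le {S : Finset ℕ} (h : ∑ x ∈ S, x ≤ ∑ x ∈ range #S, x) :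
    S = range #S := by
  rw [← sum_inter_add_sum_sdiff S (range #S), ← sum_inter_add_sum_sdiff (range #S) S,
    inter_comm] at h
  have h1 := card_mul_le_sum_sdiff S #S
  have h3 : #(range #S \ S) = #(S \ range #S) := card_sdiff_comm (by simp)
  rcases eq_or_ne (range #S \ S) ∅ with he | hne
  · have : range #S ⊆ S := sdiff_eq_empty_iff_subset.1 he
    exact (eq_of_subset_of_card_le this (by simp)).symm
  · have h2 : ∑ x ∈ range #S \ S, x < ∑ x ∈ range #S \ S, #S :=
      sum_lt_sum_of_nonempty (nonempty_iff_ne_empty.2 hne) fun x hx => by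
        rw [mem_sdiff, mem_range] at hx
        exact hx.1
    rw [sum_const, smul_eq_mul, h3] at h2
    lia

variable {d : ℕ}

/-- The row of an element of the tableau. -/
def row (lam : Nat.Partition d) (k : Fin d) : ℕ := (tableau lam k).1

/-- The column of an element of the tableau. -/
def col (lam : Nat.Partition d) (k : Fin d) : ℕ := (tableau lam k).2

theorem row_col_injective (lam : Nat.Partition d) {k k' : Fin d} (hr : row lam k = row lam k')
    (hc : col lam k = col lam k') : k = k' := by
  apply (tableau lam).injective
  unfold row at hr
  unfold col at hc
  generalize tableau lam k = x at hr hc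
  generalize tableau lam k' = y at hr hc
  obtain ⟨i, j⟩ := x
  obtain ⟨i', j'⟩ := y
  obtain rfl := Fin.ext hr
  obtain rfl := Fin.ext hc
  rfl

theorem exists_row_col (lam : Nat.Partition d) {i j : ℕ} (h : j < part lam i) :
    ∃ k, row lam k = i ∧ col lam k = j := by
  have hi := (part_pos_iff lam i).1 (by lia)
  refine ⟨(tableau lam).symm ⟨⟨i, hi⟩, ⟨j, h⟩⟩, ?_, ?_⟩
  · rw [row, Equiv.apply_symm_apply]
  · rw [col, Equiv.apply_symm_apply]

theorem col_lt_part_row (lam : Nat.Partition d) (k : Fin d) :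
    col lam k < part lam (row lam k) := (tableau lam k).2.2

theorem card_row_eq (lam : Nat.Partition d) (i : ℕ) : #{k | row lam k = i} = part lam i := by
  rw [← card_range (part lam i)]
  refine card_bij (fun k _ => col lam k) ?_ ?_ ?_
  · intro k hk
    rw [mem_range, ← (mem_filter.1 hk).2]
    exact col_lt_part_row lam k
  · intro k hk k' hk' h
    exact row_col_injective lam ((mem_filter.1 hk).2.trans (mem_filter.1 hk').2.symm) h
  · intro j hj
    obtain ⟨k, h1, h2⟩ := exists_row_col lam (mem_range.1 hj)
    exact ⟨k, by simpa using h1, h2⟩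

theorem image_row_column (lam : Nat.Partition d) (j : ℕ) :
    (univ.filter fun k => col lam k = j).image (row lam)
      = range #(univ.filter fun k => col lam k = j) := by
  have h1 : #((univ.filter fun k => col lam k = j).image (row lam))
      = #(univ.filter fun k => col lam k = j) :=
    card_image_of_injOn fun k hk k' hk' h => row_col_injective lam h
      ((mem_filter.1 hk).2.trans (mem_filter.1 hk').2.symm)
  rw [← h1]
  refine eq_range_of_downward_closed ?_
  intro i hi i' hi'
  obtain ⟨k, hk, rfl⟩ := mem_image.1 hi
  have hk := (mem_filter.1 hk).2
  have h2 := col_lt_part_row lam k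
  rw [hk] at h2
  obtain ⟨k', h3, h4⟩ := exists_row_col lam (h2.trans_le (part_antitone lam hi'))
  exact mem_image.2 ⟨k', by simpa using h4, h3⟩

theorem sum_column (lam : Nat.Partition d) (f : Fin d → ℕ) :
    ∑ k, f k = ∑ j ∈ univ.image (col lam), ∑ k with col lam k = j, f k :=
  (sum_fiberwise_of_maps_to (fun k _ => mem_image_of_mem _ (mem_univ k)) _).symm

theorem sum_row_column_le (lam : Nat.Partition d) {f : Fin d → ℕ}
    (hf : ∀ k k', f k = f k' → col lam k = col lam k' → k = k') (j : ℕ) :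
    ∑ k with col lam k = j, row lam k ≤ ∑ k with col lam k = j, f k ∧
      (∑ k with col lam k = j, f k ≤ ∑ k with col lam k = j, row lam k →
        (univ.filter fun k => col lam k = j).image f
          = (univ.filter fun k => col lam k = j).image (row lam)) := by
  have hinj : Set.InjOn f (univ.filter fun k => col lam k = j : Finset (Fin d)) :=
    fun k hk k' hk' h => hf k k' h ((mem_filter.1 hk).2.trans (mem_filter.1 hk').2.symm)
  have hinj' : Set.InjOn (row lam) (univ.filter fun k => col lam k = j : Finset (Fin d)) :=
    fun k hk k' hk' h => row_col_injective lam h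
      ((mem_filter.1 hk).2.trans (mem_filter.1 hk').2.symm)
  have h1 : ∑ k with col lam k = j, f k
      = ∑ x ∈ (univ.filter fun k => col lam k = j).image f, x :=
    (sum_image (f := fun x => x) hinj).symm
  have h2 : ∑ k with col lam k = j, row lam k
      = ∑ x ∈ (univ.filter fun k => col lam k = j).image (row lam), x :=
    (sum_image (f := fun x => x) hinj').symm
  have h3 := card_image_of_injOn hinj
  rw [h1, h2, image_row_column, ← h3]
  exact ⟨sum_range_card_le _, eq_range_of_sum_le⟩

/-- This replaces the dominance order. A colouring that is injective on columns has, on each column,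
at least the sum of the initial segment 0, 1, 2, …, which the rows attain. -/
theorem sum_row_le (lam : Nat.Partition d) {f : Fin d → ℕ}
    (hf : ∀ k k', f k = f k' → col lam k = col lam k' → k = k') :
    ∑ k, row lam k ≤ ∑ k, f k := by
  rw [sum_column lam f, sum_column lam (row lam)]
  exact sum_le_sum fun j _ => (sum_row_column_le lam hf j).1

/-- Equality of the totals forces equality on every column, and only the initial segment attains the
minimum; so f permutes the row numbers within each column. -/
theorem exists_row_eq (lam : Nat.Partition d) {f : Fin d → ℕ}
    (hf : ∀ k k', f k = f k' → col lam k = col lam k' → k = k')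
    (hs : ∑ k, f k ≤ ∑ k, row lam k) (k : Fin d) :
    ∃ k', row lam k' = f k ∧ col lam k' = col lam k := by
  have hj : col lam k ∈ univ.image (col lam) := mem_image_of_mem _ (mem_univ k)
  have h2 : ∑ k' with col lam k' = col lam k, f k'
      ≤ ∑ k' with col lam k' = col lam k, row lam k' := by
    rw [sum_column lam f, sum_column lam (row lam), ← add_sum_erase _ _ hj,
      ← add_sum_erase _ _ hj] at hs
    have h3 : ∑ j ∈ (univ.image (col lam)).erase (col lam k), ∑ k with col lam k = j, row lam k
        ≤ ∑ j ∈ (univ.image (col lam)).erase (col lam k), ∑ k with col lam k = j, f k :=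
      sum_le_sum fun j _ => (sum_row_column_le lam hf j).1
    lia
  have h4 := (sum_row_column_le lam hf (col lam k)).2 h2
  have h5 : f k ∈ (univ.filter fun k' => col lam k' = col lam k).image f :=
    mem_image_of_mem _ (by simp)
  rw [h4] at h5
  obtain ⟨k', h6, h7⟩ := mem_image.1 h5
  exact ⟨k', h7, (mem_filter.1 h6).2⟩

/-! ### Symmetrizers -/

/-- The group algebra of the symmetric group. -/
abbrev GroupAlg (d : ℕ) : Type := MonoidAlgebra ℚ (Equiv.Perm (Fin d))

/-- A permutation as an element of the group algebra. -/
abbrev gel (σ : Equiv.Perm (Fin d)) : GroupAlg d := MonoidAlgebra.of ℚ _ σ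

/-- The sum of the permutations that preserve the colouring `f`. -/
def colourSymmetrizer {γ : Type*} [DecidableEq γ] (f : Fin d → γ) : GroupAlg d := 
  ∑ σ ∈ univ.filter fun σ : Equiv.Perm (Fin d) => f ∘ ⇑σ = f, gel σ

theorem rowSymmetrizer_eq (lam : Nat.Partition d) :
    rowSymmetrizer lam = colourSymmetrizer (row lam) := by
  classical
  unfold rowSymmetrizer colourSymmetrizer
  refine sum_congr ?_ fun _ _ => rfl
  ext σ
  simp only [mem_filter, mem_univ, true_and]
  exact funext_iff.symm

theorem colourSymmetrizer_mul_gel {γ : Type*} [DecidableEq γ] {f : Fin d → γ}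
    {τ : Equiv.Perm (Fin d)}
    (h : f ∘ τ = f) : colourSymmetrizer f * gel τ = colourSymmetrizer f := by
  have h' : f ∘ ⇑τ⁻¹ = f := by
    funext k
    have := congrFun h (τ⁻¹ k)
    simpa using this.symm
  simp only [colourSymmetrizer, sum_mul, ← map_mul]
  refine sum_bij' (fun σ _ => σ * τ) (fun σ _ => σ * τ⁻¹) ?_ ?_ ?_ ?_ ?_
  · intro σ hσ
    simp only [mem_filter, mem_univ, true_and, Equiv.Perm.coe_mul] at hσ ⊢
    rw [← Function.comp_assoc, hσ, h]
  · intro σ hσ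
    simp only [mem_filter, mem_univ, true_and, Equiv.Perm.coe_mul] at hσ ⊢
    rw [← Function.comp_assoc, hσ, h']
  · intro σ _; simp
  · intro σ _; simp
  · intro σ _; rfl

theorem gel_mul_colAntisymmetrizer (lam : Nat.Partition d) {τ : Equiv.Perm (Fin d)}
    (h : ∀ k, col lam (τ k) = col lam k) :
    gel τ * colAntisymmetrizer lam
      = ((Equiv.Perm.sign τ : ℤ) : ℚ) • colAntisymmetrizer lam := by
  classical
  have h' : ∀ k, col lam (τ⁻¹ k) = col lam k := by
    intro k
    have := h (τ⁻¹ k)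
    simpa using this.symm
  simp only [colAntisymmetrizer, mul_sum, smul_sum, mul_smul_comm, ← map_mul]
  refine sum_bij' (fun σ _ => τ * σ) (fun σ _ => τ⁻¹ * σ) ?_ ?_ ?_ ?_ ?_
  · intro σ hσ
    simp only [mem_filter, mem_univ, true_and] at hσ ⊢
    intro k
    exact (h (σ k)).trans (hσ k)
  · intro σ hσ
    simp only [mem_filter, mem_univ, true_and] at hσ ⊢
    intro k
    exact (h' (σ k)).trans (hσ k)
  · intro σ _; simp
  · intro σ _; simp
  · intro σ _
    rw [smul_smul, Equiv.Perm.sign_mul]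
    congr 1
    push_cast
    have : ((Equiv.Perm.sign τ : ℤ) : ℚ) * ((Equiv.Perm.sign τ : ℤ) : ℚ) = 1 := by
      rw [← Int.cast_mul, ← Units.val_mul, Int.units_mul_self]; simp
    linear_combination (-((Equiv.Perm.sign σ : ℤ) : ℚ)) * this

/-- The swap of k and k' is absorbed with sign -1 by the column antisymmetrizer on the right, while
its conjugate by g is absorbed with sign 1 on the left. -/
theorem colourSymmetrizer_mul_gel_mul_eq_zero {γ : Type*} [DecidableEq γ] (lam : Nat.Partition d)
    {f : Fin d → γ}
    {g : Equiv.Perm (Fin d)} {k k' : Fin d} (hne : k ≠ k') (hf : f (g k) = f (g k'))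
    (hc : col lam k = col lam k') :
    colourSymmetrizer f * gel g * colAntisymmetrizer lam = 0 := by
  have h1 : f ∘ Equiv.swap (g k) (g k') = f := by
    funext l
    simp only [Function.comp, Equiv.swap_apply_def]
    split_ifs with h1 h2
    · rw [h1, hf]
    · rw [h2, hf]
    · rfl
  have h2 : ∀ l, col lam (Equiv.swap k k' l) = col lam l := by
    intro l
    simp only [Equiv.swap_apply_def]
    split_ifs with h1 h2
    · rw [h1, hc]
    · rw [h2, hc]
    · rfl
  have h3 : gel (Equiv.swap (g k) (g k')) * gel g = gel g * gel (Equiv.swap k k') := by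
    rw [gel, gel, gel, ← map_mul, ← map_mul]
    congr 1
    exact (Equiv.mul_swap_eq_swap_mul g k k').symm
  have h4 : colourSymmetrizer f * gel g * colAntisymmetrizer lam
      = -(colourSymmetrizer f * gel g * colAntisymmetrizer lam) := by
    conv_lhs => rw [← colourSymmetrizer_mul_gel h1, mul_assoc (colourSymmetrizer f), h3,
      ← mul_assoc (colourSymmetrizer f), mul_assoc _ (gel (Equiv.swap k k')),
      gel_mul_colAntisymmetrizer lam h2, Equiv.Perm.sign_swap hne]
    simp
  have h5 : (2 : ℚ) • (colourSymmetrizer f * gel g * colAntisymmetrizer lam) = 0 := by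
    rw [two_smul]
    nth_rewrite 1 [h4]
    simp
  exact (smul_eq_zero.1 h5).resolve_left (by norm_num)

theorem colourSymmetrizer_mul_mul_eq_zero (lam : Nat.Partition d) {f : Fin d → ℕ}
    (hf : ∑ k, f k < ∑ k, row lam k) (x : GroupAlg d) :
    colourSymmetrizer f * x * colAntisymmetrizer lam = 0 := by
  induction x using MonoidAlgebra.induction_on with
  | of g =>
    by_contra hc
    have h1 : ∀ k k', f (g k) = f (g k') → col lam k = col lam k' → k = k' := by
      intro k k' h1 h2
      by_contra hne
      exact hc (colourSymmetrizer_mul_gel_mul_eq_zero lam hne h1 h2)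
    have h2 := sum_row_le lam (f := f ∘ g) h1
    have h3 : ∑ k, (f ∘ g) k = ∑ k, f k := Equiv.sum_comp g f
    lia
  | add x y hx hy => rw [mul_add, add_mul, hx, hy, add_zero]
  | smul q x hx => rw [mul_smul_comm, smul_mul_assoc, hx, smul_zero]

/-- Von Neumann's lemma: a permutation either has two elements of one column sent to one row, and
contributes 0, or factors as a row permutation times a column permutation, and contributes a sign.
-/
theorem rowSymmetrizer_mul_mul (lam : Nat.Partition d) (x : GroupAlg d) :
    ∃ q : ℚ, rowSymmetrizer lam * x * colAntisymmetrizer lam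
      = q • (rowSymmetrizer lam * colAntisymmetrizer lam) := by
  rw [rowSymmetrizer_eq]
  induction x using MonoidAlgebra.induction_on with
  | of g =>
    by_cases hc : colourSymmetrizer (row lam) * gel g * colAntisymmetrizer lam = 0
    · exact ⟨0, by rw [zero_smul]; exact hc⟩
    have h1 : ∀ k k', row lam (g k) = row lam (g k') → col lam k = col lam k' → k = k' := by
      intro k k' h1 h2
      by_contra hne
      exact hc (colourSymmetrizer_mul_gel_mul_eq_zero lam hne h1 h2)
    have h3 : ∑ k, (row lam ∘ g) k = ∑ k, row lam k := Equiv.sum_comp g (row lam)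
    choose p hp1 hp2 using exists_row_eq lam (f := row lam ∘ g) h1 h3.le
    have hpi : Function.Injective p := by
      intro k k' h
      apply h1
      · have e1 := hp1 k
        rw [h, hp1 k'] at e1
        exact e1.symm
      · rw [← hp2 k, ← hp2 k', h]
    -- π preserves columns and puts k in the row of g k, so g π⁻¹ preserves rows: this is the
    -- factorization of g.
    let π : Equiv.Perm (Fin d) := Equiv.ofBijective p (Finite.injective_iff_bijective.1 hpi)
    have hr : row lam ∘ ⇑(g * π⁻¹) = row lam := by
      funext k
      have := hp1 (π⁻¹ k)
      have e : p (π⁻¹ k) = k := π.apply_symm_apply k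
      rw [e] at this
      exact this.symm
    have hg : gel g = gel (g * π⁻¹) * gel π := by
      rw [gel, gel, gel, ← map_mul, inv_mul_cancel_right]
    refine ⟨((Equiv.Perm.sign π : ℤ) : ℚ), ?_⟩
    have h4 : colourSymmetrizer (row lam) * gel g * colAntisymmetrizer lam
        = ((Equiv.Perm.sign π : ℤ) : ℚ)
          • (colourSymmetrizer (row lam) * colAntisymmetrizer lam) := by
      rw [hg, ← mul_assoc, colourSymmetrizer_mul_gel hr, mul_assoc,
        gel_mul_colAntisymmetrizer lam (τ := π) hp2, mul_smul_comm]
    exact h4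
  | add x y hx hy =>
    obtain ⟨q, hq⟩ := hx
    obtain ⟨q', hq'⟩ := hy
    exact ⟨q + q', by rw [mul_add, add_mul, hq, hq', add_smul]⟩
  | smul t x hx =>
    obtain ⟨q, hq⟩ := hx
    exact ⟨t * q, by rw [mul_smul_comm, smul_mul_assoc, hq, mul_smul]⟩

end

section

variable {d : ℕ}

/-! ### The character of the Specht module -/

/-- The Young symmetrizer. -/
def youngSymmetrizer (lam : Nat.Partition d) : GroupAlg d :=
  rowSymmetrizer lam * colAntisymmetrizer lam

theorem coeff_gel (σ τ : Equiv.Perm (Fin d)) :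
    (gel σ).coeff τ = if σ = τ then 1 else 0 := by
  rw [gel, MonoidAlgebra.of_apply, MonoidAlgebra.coeff_single, Finsupp.single_apply]

theorem eq_one_of_row_col (lam : Nat.Partition d) {σ : Equiv.Perm (Fin d)}
    (hr : σ ∈ rowGroup lam) (hc : σ ∈ colGroup lam) : σ = 1 :=
  Equiv.ext fun k => row_col_injective lam (hr k) (hc k)

/-- A permutation preserving rows and columns is trivial, so 1 arises only as 1 * 1 in the expanded
product. -/
theorem coeff_youngSymmetrizer_one (lam : Nat.Partition d) :
    (youngSymmetrizer lam).coeff 1 = 1 := by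
  classical
  have h1r : (1 : Equiv.Perm (Fin d)) ∈ rowGroup lam := fun _ => rfl
  have h1c : (1 : Equiv.Perm (Fin d)) ∈ colGroup lam := fun _ => rfl
  simp only [youngSymmetrizer, rowSymmetrizer, colAntisymmetrizer, sum_mul, mul_sum,
    mul_smul_comm, ← map_mul, MonoidAlgebra.coeff_sum, MonoidAlgebra.coeff_smul,
    Finsupp.finsetSum_apply, Finsupp.smul_apply, smul_eq_mul]
  have hterm : ∀ σ τ : Equiv.Perm (Fin d),
      (MonoidAlgebra.of ℚ (Equiv.Perm (Fin d)) (σ * τ)).coeff 1 = if σ * τ = 1 then 1 else 0 :=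
    fun σ τ => coeff_gel (σ * τ) 1
  simp only [hterm]
  rw [sum_eq_single 1, sum_eq_single 1]
  · simp
  · intro τ _ hτ
    rw [if_neg (by simpa using hτ), mul_zero]
  · intro h
    exact absurd (mem_filter.2 ⟨mem_univ _, h1r⟩) h
  · intro σ hσ hne
    refine sum_eq_zero fun τ hτ => ?_
    by_cases hst : τ * σ = 1
    · exfalso
      apply hne
      have hσ := (mem_filter.1 hσ).2
      have hτ := (mem_filter.1 hτ).2
      refine eq_one_of_row_col lam (fun k => ?_) hσ
      obtain rfl : τ = σ⁻¹ := eq_inv_of_mul_eq_one_left hst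
      have := hτ (σ k)
      rw [Equiv.Perm.inv_def, Equiv.symm_apply_apply] at this
      exact this.symm
    · rw [if_neg hst, mul_zero]
  · intro h
    exact absurd (mem_filter.2 ⟨mem_univ _, h1c⟩) h

theorem youngSymmetrizer_mem (lam : Nat.Partition d) : youngSymmetrizer lam ∈ Specht lam :=
  Ideal.subset_span rfl

theorem mem_specht_iff (lam : Nat.Partition d) {v : GroupAlg d} :
    v ∈ Specht lam ↔ ∃ y, y * youngSymmetrizer lam = v :=
  Ideal.mem_span_singleton'

/-- The trace of the action of an element of the group algebra on the Specht module. -/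
def spechtTrace (lam : Nat.Partition d) : GroupAlg d →ₗ[ℚ] ℚ :=
  (LinearMap.trace ℚ (Specht lam)).comp (Algebra.lsmul ℚ ℚ (Specht lam)).toLinearMap

theorem irredCharacter_eq (lam : Nat.Partition d) (σ : Equiv.Perm (Fin d)) :
    irredCharacter lam σ = spechtTrace lam (gel σ) := rfl

theorem spechtTrace_mul_comm (lam : Nat.Partition d) (x y : GroupAlg d) :
    spechtTrace lam (x * y) = spechtTrace lam (y * x) := by
  simp only [spechtTrace, LinearMap.comp_apply, AlgHom.toLinearMap_apply, map_mul]
  exact LinearMap.trace_mul_comm ℚ _ _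

theorem irredCharacter_conj (lam : Nat.Partition d) (g σ : Equiv.Perm (Fin d)) :
    irredCharacter lam (g * σ * g⁻¹) = irredCharacter lam σ := by
  rw [irredCharacter_eq, irredCharacter_eq, gel, map_mul, spechtTrace_mul_comm, ← map_mul]
  congr 2
  group

theorem irredCharacter_eq_of_isConj (lam : Nat.Partition d) {σ τ : Equiv.Perm (Fin d)}
    (h : IsConj σ τ) : irredCharacter lam σ = irredCharacter lam τ := by
  obtain ⟨g, rfl⟩ := isConj_iff.1 h
  rw [irredCharacter_conj]

theorem irredCharacter_inv (lam : Nat.Partition d) (σ : Equiv.Perm (Fin d)) :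
    irredCharacter lam σ⁻¹ = irredCharacter lam σ :=
  irredCharacter_eq_of_isConj lam (Equiv.Perm.isConj_iff_cycleType_eq.2 σ.cycleType_inv)

instance finite_specht (lam : Nat.Partition d) : Module.Finite ℚ (Specht lam) :=
  Module.Finite.of_injective ((Specht lam).subtype.restrictScalars ℚ) Subtype.val_injective

theorem spechtTrace_eq_zero (lam : Nat.Partition d) {x : GroupAlg d}
    (h : ∀ y, x * (y * youngSymmetrizer lam) = 0) : spechtTrace lam x = 0 := by
  have : Algebra.lsmul ℚ ℚ (Specht lam) x = 0 := by
    ext v : 1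
    obtain ⟨v, hv⟩ := v
    obtain ⟨y, rfl⟩ := (mem_specht_iff lam).1 hv
    exact Subtype.ext (h y)
  simp only [spechtTrace, LinearMap.comp_apply, AlgHom.toLinearMap_apply, this, map_zero]

/-- Such an x acts with image in the line of the Young symmetrizer, so its trace is its eigenvalue
there. The coefficient at 1 serves as coordinate on that line. -/
theorem spechtTrace_eq (lam : Nat.Partition d) {x : GroupAlg d} {q : ℚ}
    (h : ∀ y, ∃ t : ℚ, x * (y * youngSymmetrizer lam) = t • youngSymmetrizer lam)
    (hq : x * youngSymmetrizer lam = q • youngSymmetrizer lam) : spechtTrace lam x = q := by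
  let c : Specht lam := ⟨youngSymmetrizer lam, youngSymmetrizer_mem lam⟩
  let θ : Specht lam →ₗ[ℚ] ℚ :=
    { toFun := fun v => (x * v.1).coeff 1
      map_add' := fun v w => by
        rw [Submodule.coe_add, mul_add, MonoidAlgebra.coeff_add, Finsupp.add_apply]
      map_smul' := fun t v => by
        have : ((t • v : Specht lam) : GroupAlg d) = t • (v : GroupAlg d) := rfl
        rw [this, mul_smul_comm]
        rfl }
  have hx : Algebra.lsmul ℚ ℚ (Specht lam) x = θ.smulRight c := by
    ext v : 1
    obtain ⟨v, hv⟩ := v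
    obtain ⟨y, rfl⟩ := (mem_specht_iff lam).1 hv
    obtain ⟨t, ht⟩ := h y
    apply Subtype.ext
    change x * (y * youngSymmetrizer lam)
      = (x * (y * youngSymmetrizer lam)).coeff 1 • youngSymmetrizer lam
    rw [ht, MonoidAlgebra.coeff_smul_apply, coeff_youngSymmetrizer_one, smul_eq_mul, mul_one]
  have h1 : spechtTrace lam x = θ c := by
    simp only [spechtTrace, LinearMap.comp_apply, AlgHom.toLinearMap_apply, hx]
    exact LinearMap.trace_smulRight θ c
  rw [h1]
  change (x * youngSymmetrizer lam).coeff 1 = q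
  rw [hq, MonoidAlgebra.coeff_smul_apply, coeff_youngSymmetrizer_one, smul_eq_mul, mul_one]

theorem exists_youngSymmetrizer_sq (lam : Nat.Partition d) (y : GroupAlg d) : ∃ n : ℚ,
    youngSymmetrizer lam * (y * youngSymmetrizer lam) = n • youngSymmetrizer lam := by
  obtain ⟨n, hn⟩ := rowSymmetrizer_mul_mul lam (colAntisymmetrizer lam * y * rowSymmetrizer lam)
  refine ⟨n, ?_⟩
  rw [youngSymmetrizer, ← hn]
  noncomm_ring

/-- Right multiplication by the Young symmetrizer maps the group algebra to the Specht module and is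
the scalar n on it. Cyclicity of the trace moves the computation to the group algebra, where the
permutations are a basis. -/
theorem mul_irredCharacter (lam : Nat.Partition d) {n : ℚ}
    (hn : youngSymmetrizer lam * youngSymmetrizer lam = n • youngSymmetrizer lam)
    (σ : Equiv.Perm (Fin d)) :
    n * irredCharacter lam σ
      = ∑ g : Equiv.Perm (Fin d), (youngSymmetrizer lam).coeff (g⁻¹ * σ⁻¹ * g) := by
  let P : GroupAlg d →ₗ[ℚ] Specht lam :=
    { toFun := fun x => ⟨x * youngSymmetrizer lam, (mem_specht_iff lam).2 ⟨x, rfl⟩⟩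
      map_add' := fun x y => Subtype.ext (add_mul _ _ _)
      map_smul' := fun t x => Subtype.ext (smul_mul_assoc _ _ _) }
  let ι : Specht lam →ₗ[ℚ] GroupAlg d := (Specht lam).subtype.restrictScalars ℚ
  have h1 : n • Algebra.lsmul ℚ ℚ (Specht lam) (gel σ)
      = (Algebra.lsmul ℚ ℚ (Specht lam) (gel σ) ∘ₗ P) ∘ₗ ι := by
    ext v : 1
    obtain ⟨v, hv⟩ := v
    obtain ⟨y, rfl⟩ := (mem_specht_iff lam).1 hv
    apply Subtype.ext
    change n • (gel σ * (y * youngSymmetrizer lam))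
      = gel σ * ((y * youngSymmetrizer lam) * youngSymmetrizer lam)
    rw [mul_assoc y, hn, mul_smul_comm, mul_smul_comm]
  have h2 : n * irredCharacter lam σ
      = LinearMap.trace ℚ (GroupAlg d)
        (ι ∘ₗ (Algebra.lsmul ℚ ℚ (Specht lam) (gel σ) ∘ₗ P)) := by
    rw [← LinearMap.trace_comp_comm', ← h1, map_smul]
    rfl
  rw [h2, LinearMap.trace_eq_matrix_trace ℚ (MonoidAlgebra.basis (Equiv.Perm (Fin d)) ℚ),
    Matrix.trace]
  refine sum_congr rfl fun g _ => ?_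
  rw [Matrix.diag_apply, LinearMap.toMatrix_apply, MonoidAlgebra.basis_apply]
  change (MonoidAlgebra.single σ 1 * (MonoidAlgebra.single g 1 * youngSymmetrizer lam)).coeff g = _
  rw [MonoidAlgebra.coeff_single_mul_apply, MonoidAlgebra.coeff_single_mul_apply, one_mul, one_mul,
    mul_assoc]

/-- One factor of the square is expressed by `mul_irredCharacter`. As the character is a class
function, each conjugating g contributes the trace of the Young symmetrizer, which is n; then n ≠ 0
cancels. No irreducibility is needed. -/
theorem sum_irredCharacter_sq (lam : Nat.Partition d) :
    ∑ σ, irredCharacter lam σ ^ 2 = (d.factorial : ℚ) := by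
  obtain ⟨n, hn⟩ := exists_youngSymmetrizer_sq lam 1
  rw [one_mul] at hn
  have hcard : ((Fintype.card (Equiv.Perm (Fin d)) : ℕ) : ℚ) = d.factorial := by
    rw [Fintype.card_perm, Fintype.card_fin]
  -- For n = 0 the previous formula at the identity would say d! = 0.
  have hn0 : n ≠ 0 := by
    rintro rfl
    have h1 := mul_irredCharacter lam hn 1
    simp only [inv_one, mul_one, inv_mul_cancel, coeff_youngSymmetrizer_one, zero_mul, sum_const,
      nsmul_eq_mul, card_univ, hcard] at h1
    exact Nat.factorial_ne_zero d (by exact_mod_cast h1.symm)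
  have hT : spechtTrace lam (youngSymmetrizer lam) = n :=
    spechtTrace_eq lam (exists_youngSymmetrizer_sq lam) hn
  have hexp : youngSymmetrizer lam
      = ∑ τ : Equiv.Perm (Fin d), (youngSymmetrizer lam).coeff τ • gel τ := by
    apply MonoidAlgebra.coeff_injective
    ext ρ
    simp only [MonoidAlgebra.coeff_sum, MonoidAlgebra.coeff_smul, Finsupp.finsetSum_apply,
      Finsupp.smul_apply, coeff_gel, smul_eq_mul, mul_ite, mul_one, mul_zero, sum_ite_eq',
      mem_univ, if_true]
  have h3 : ∑ τ : Equiv.Perm (Fin d), (youngSymmetrizer lam).coeff τ * irredCharacter lam τ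
      = n := by
    rw [← hT]
    conv_rhs => rw [hexp, map_sum]
    simp only [map_smul, smul_eq_mul]
    rfl
  have h4 : n * ∑ σ, irredCharacter lam σ ^ 2 = n * d.factorial := by
    calc n * ∑ σ, irredCharacter lam σ ^ 2
        = ∑ σ, ∑ g : Equiv.Perm (Fin d),
            (youngSymmetrizer lam).coeff (g⁻¹ * σ * g) * irredCharacter lam σ := by
          rw [mul_sum]
          refine sum_congr rfl fun σ _ => ?_
          have := mul_irredCharacter lam hn σ⁻¹
          rw [inv_inv, irredCharacter_inv] at this
          rw [← sum_mul, ← this]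
          ring
      _ = ∑ g : Equiv.Perm (Fin d), n := by
          rw [sum_comm]
          refine sum_congr rfl fun g _ => ?_
          rw [← h3]
          refine Fintype.sum_equiv (MulAut.conj g⁻¹).toEquiv _ _ fun σ => ?_
          simp only [MulEquiv.toEquiv_eq_coe, MulEquiv.coe_toEquiv, MulAut.conj_apply, inv_inv]
          congr 1
          have := irredCharacter_conj lam g⁻¹ σ
          rw [inv_inv] at this
          exact this.symm
      _ = n * d.factorial := by
          rw [sum_const, card_univ, nsmul_eq_mul, hcard, mul_comm]
  exact mul_left_cancel₀ hn0 h4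

end

section

variable {N d : ℕ}

/-! ### The Frobenius character formula -/

theorem colourSymmetrizer_mul_self {γ : Type*} [DecidableEq γ] (f : Fin d → γ) :
    colourSymmetrizer f * colourSymmetrizer f
      = (#(univ.filter fun σ : Equiv.Perm (Fin d) => f ∘ ⇑σ = f) : ℚ) • colourSymmetrizer f := by
  conv_lhs => enter [2]; rw [colourSymmetrizer]
  rw [mul_sum, sum_congr rfl (g := fun _ => colourSymmetrizer f)]
  · rw [sum_const, Nat.cast_smul_eq_nsmul]
  · intro σ hσ
    exact colourSymmetrizer_mul_gel (mem_filter.1 hσ).2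

theorem spechtTrace_rowSymmetrizer (lam : Nat.Partition d) :
    spechtTrace lam (rowSymmetrizer lam)
      = #(univ.filter fun σ : Equiv.Perm (Fin d) => row lam ∘ ⇑σ = row lam) := by
  refine spechtTrace_eq lam (fun y => ?_) ?_
  · obtain ⟨t, ht⟩ := rowSymmetrizer_mul_mul lam (y * rowSymmetrizer lam)
    refine ⟨t, ?_⟩
    rw [youngSymmetrizer, ← ht]
    noncomm_ring
  · rw [youngSymmetrizer, ← mul_assoc, rowSymmetrizer_eq, colourSymmetrizer_mul_self,
      smul_mul_assoc]

theorem colourSymmetrizer_comp {γ : Type*} [DecidableEq γ] (f : Fin d → γ)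
    (g : Equiv.Perm (Fin d)) :
    colourSymmetrizer (f ∘ g) = gel g⁻¹ * colourSymmetrizer f * gel g := by
  simp only [colourSymmetrizer, mul_sum, sum_mul, ← map_mul]
  refine sum_bij' (fun σ _ => g * σ * g⁻¹) (fun σ _ => g⁻¹ * σ * g) ?_ ?_ ?_ ?_ ?_
  · intro σ hσ
    simp only [mem_filter, mem_univ, true_and] at hσ ⊢
    funext k
    have := congrFun hσ (g⁻¹ k)
    simpa using this
  · intro σ hσ
    simp only [mem_filter, mem_univ, true_and] at hσ ⊢
    funext k
    have := congrFun hσ (g k)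
    simpa using this
  · intro σ _; group
  · intro σ _; group
  · intro σ _; congr 1; group

theorem spechtTrace_colourSymmetrizer_comp (lam : Nat.Partition d) {γ : Type*} [DecidableEq γ]
    (f : Fin d → γ)
    (g : Equiv.Perm (Fin d)) :
    spechtTrace lam (colourSymmetrizer (f ∘ g)) = spechtTrace lam (colourSymmetrizer f) := by
  rw [colourSymmetrizer_comp, mul_assoc, spechtTrace_mul_comm, mul_assoc]
  have : gel g * gel g⁻¹ = 1 := by rw [gel, gel, ← map_mul, mul_inv_cancel, map_one]
  rw [this, mul_one]

theorem colourSymmetrizer_comp_injective {γ δ : Type*} [DecidableEq γ] [DecidableEq δ]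
    (f : Fin d → γ) {i : γ → δ}
    (hi : Function.Injective i) : colourSymmetrizer (i ∘ f) = colourSymmetrizer f := by
  unfold colourSymmetrizer
  refine sum_congr ?_ fun _ _ => rfl
  ext σ
  simp only [mem_filter, mem_univ, true_and, Function.comp_assoc]
  exact hi.comp_left.eq_iff

theorem row_lt (lam : Nat.Partition d) (k : Fin d) : row lam k < d := by
  have h1 := col_lt_part_row lam k
  by_contra hc
  rw [part_eq_zero lam (not_lt.1 hc)] at h1
  lia

theorem content_one_apply (f : Fin d → Fin N) (c : Fin N) :
    content (fun _ => 1) f c = #{k | f k = c} := by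
  rw [content, Finset.sum_apply, card_filter]
  push_cast
  refine sum_congr rfl fun k _ => ?_
  rw [Pi.single_apply]
  simp only [eq_comm]

theorem sum_val_eq (f : Fin d → Fin N) :
    ∑ k, ((f k : ℕ) : ℤ) = ∑ c : Fin N, (c : ℤ) * content (fun _ => 1) f c := by
  rw [← sum_fiberwise univ f]
  refine sum_congr rfl fun c _ => ?_
  rw [content_one_apply, sum_congr rfl (g := fun _ => (c : ℤ))]
  · rw [sum_const, nsmul_eq_mul, mul_comm]
  · intro k hk
    rw [(mem_filter.1 hk).2]

/-- The row of an element of the tableau, as an element of `Fin N`. -/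
def rowFin (hN : d ≤ N) (lam : Nat.Partition d) (k : Fin d) : Fin N :=
  ⟨row lam k, (row_lt lam k).trans_le hN⟩

theorem content_rowFin (hN : d ≤ N) (lam : Nat.Partition d) (c : Fin N) :
    content (fun _ => 1) (rowFin hN lam) c = part lam c := by
  rw [content_one_apply, ← card_row_eq lam c]
  simp only [rowFin, Fin.ext_iff]

theorem sum_row_eq (hN : d ≤ N) (lam : Nat.Partition d) :
    ∑ k, ((row lam k : ℕ) : ℤ) = ∑ c : Fin N, (c : ℤ) * part lam c := by
  simp only [← content_rowFin hN lam]
  exact sum_val_eq (rowFin hN lam)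

/-- Rearrangement: since π preserves the sum of squares, twice the left side is minus the sum of (π
c - c)². -/
theorem sum_mul_perm_sub_neg {π : Equiv.Perm (Fin N)} (h : π ≠ 1) :
    ∑ c : Fin N, (c : ℤ) * ((π c : ℤ) - c) < 0 := by
  have h1 : 2 * ∑ c : Fin N, (c : ℤ) * ((π c : ℤ) - c)
      = -∑ c : Fin N, ((π c : ℤ) - c) ^ 2 := by
    have h2 : ∑ c : Fin N, ((π c : ℕ) : ℤ) ^ 2 = ∑ c : Fin N, ((c : ℕ) : ℤ) ^ 2 :=
      Equiv.sum_comp π fun c : Fin N => ((c : ℕ) : ℤ) ^ 2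
    have h3 : ∀ c : Fin N, ((π c : ℤ) - c) ^ 2
        = ((π c : ℤ) ^ 2 - (c : ℤ) ^ 2) - 2 * ((c : ℤ) * ((π c : ℤ) - c)) := fun c => by ring
    simp only [h3, sum_sub_distrib, h2, ← mul_sum]
    ring
  have h4 : 0 < ∑ c : Fin N, ((π c : ℤ) - c) ^ 2 := by
    obtain ⟨c, hc⟩ : ∃ c, π c ≠ c := by
      by_contra! hc
      exact h (Equiv.ext hc)
    refine sum_pos' (fun _ _ => sq_nonneg _) ⟨c, mem_univ _, ?_⟩
    have : (π c : ℤ) - c ≠ 0 := by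
      intro h0
      exact hc (Fin.ext (by lia))
    positivity
  lia

/-- Expand the Vandermonde over permutations π. For π ≠ 1 the corresponding colourings have a
smaller total than the rows of the tableau, so their symmetrizer annihilates the Specht module; only
the content of the tableau remains. -/
theorem vacuum_mul_spechtTrace (hN : d ≤ N) (lam : Nat.Partition d) (f : Fin d → Fin N) :
    vacuum N (shape N lam - content (fun _ => 1) f) * spechtTrace lam (colourSymmetrizer f)
      = if content (fun _ => 1) f = content (fun _ => 1) (rowFin hN lam)
        then spechtTrace lam (colourSymmetrizer f) else 0 := by
  have hshape : shape N lam = content (fun _ => 1) (rowFin hN lam) + stair N := by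
    funext c
    rw [Pi.add_apply, content_rowFin]
    rfl
  split_ifs with h
  · rw [h, hshape, add_sub_cancel_left, vacuum_stair, one_mul]
  · by_cases hv : vacuum N (shape N lam - content (fun _ => 1) f) = 0
    · rw [hv, zero_mul]
    obtain ⟨π, hπ⟩ := exists_of_vacuum_ne_zero hv
    have hc : ∀ c, content (fun _ => 1) f c = part lam c + ((π c : ℤ) - c) := by
      intro c
      have := congrFun hπ c
      simp only [Pi.sub_apply, shape, Function.comp, stair] at this
      lia
    have hπ1 : π ≠ 1 := by
      rintro rfl
      apply h
      funext c
      rw [hc c, content_rowFin]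
      simp
    have hlt : ∑ k, ((Fin.val ∘ f) k) < ∑ k, row lam k := by
      zify
      have h1 := sum_val_eq f
      simp only [hc, mul_add, sum_add_distrib] at h1
      rw [← sum_row_eq hN] at h1
      have h2 := sum_mul_perm_sub_neg hπ1
      simp only [Function.comp]
      lia
    have h0 : spechtTrace lam (colourSymmetrizer f) = 0 := by
      rw [← colourSymmetrizer_comp_injective f Fin.val_injective]
      refine spechtTrace_eq_zero lam fun y => ?_
      have := colourSymmetrizer_mul_mul_eq_zero lam hlt (y * rowSymmetrizer lam)
      rw [youngSymmetrizer, ← this]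
      noncomm_ring
    rw [h0, mul_zero]

theorem exists_perm_of_content_eq {f g : Fin d → Fin N}
    (h : content (fun _ => 1) f = content (fun _ => 1) g) :
    ∃ e : Equiv.Perm (Fin d), g ∘ e = f := by
  refine exists_equiv_comp_eq f g fun c => ?_
  have := congrFun h c
  rw [content_one_apply, content_one_apply] at this
  exact_mod_cast this

theorem content_comp_equiv (f : Fin d → Fin N) (e : Equiv.Perm (Fin d)) :
    content (fun _ => 1) (f ∘ e) = content (fun _ => 1) f :=
  Equiv.sum_comp e fun k => (Pi.single (f k) 1 : Fin N → ℤ)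

/-- Exchanging the sums leaves traces of colour symmetrizers. The colourings that survive are
rearrangements of the rows, each with trace the number of permutations producing it, and altogether
these are all d! permutations. -/
theorem sum_permFrob_mul_irredCharacter (hN : d ≤ N) (lam : Nat.Partition d) :
    ∑ σ, permFrob N lam σ * irredCharacter lam σ = (d.factorial : ℚ) := by
  have h1 : ∑ σ, permFrob N lam σ * irredCharacter lam σ
      = ∑ f : Fin d → Fin N, vacuum N (shape N lam - content (fun _ => 1) f)
        * spechtTrace lam (colourSymmetrizer f) := by
    simp only [permFrob, sum_filter, sum_mul, ite_mul, zero_mul]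
    rw [sum_comm]
    refine sum_congr rfl fun f _ => ?_
    rw [colourSymmetrizer, map_sum, mul_sum, sum_filter]
    refine sum_congr rfl fun σ _ => ?_
    rfl
  simp only [h1, vacuum_mul_spechtTrace hN, ← sum_filter]
  have h2 : ∀ f ∈ univ.filter (fun f : Fin d → Fin N =>
      content (fun _ => 1) f = content (fun _ => 1) (rowFin hN lam)),
      spechtTrace lam (colourSymmetrizer f)
        = #(univ.filter fun g : Equiv.Perm (Fin d) => rowFin hN lam ∘ g = f) := by
    intro f hf
    obtain ⟨e, rfl⟩ := exists_perm_of_content_eq (mem_filter.1 hf).2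
    rw [spechtTrace_colourSymmetrizer_comp,
      ← colourSymmetrizer_comp_injective (rowFin hN lam) Fin.val_injective]
    have hrow : Fin.val ∘ rowFin hN lam = row lam := rfl
    rw [hrow, ← rowSymmetrizer_eq, spechtTrace_rowSymmetrizer]
    congr 1
    refine card_bij' (fun σ _ => σ * e) (fun σ _ => σ * e⁻¹) ?_ ?_ ?_ ?_
    · intro σ hσ
      simp only [mem_filter, mem_univ, true_and] at hσ ⊢
      funext k
      exact Fin.ext (congrFun hσ (e k))
    · intro σ hσ
      simp only [mem_filter, mem_univ, true_and] at hσ ⊢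
      funext k
      have h3 := congrFun hσ (e⁻¹ k)
      have h4 := congrArg Fin.val h3
      simpa [rowFin] using h4
    · intro σ _; simp
    · intro σ _; simp
  rw [sum_congr rfl h2, ← Nat.cast_sum, ← card_eq_sum_card_fiberwise, card_univ,
    Fintype.card_perm, Fintype.card_fin]
  intro g _
  simp [content_comp_equiv]

/-- Both functions have norm 1 and inner product 1, so their difference has norm 1 + 1 - 2 = 0. -/
theorem irredCharacter_eq_permFrob (hN : 2 * d ≤ N) (lam : Nat.Partition d)
    (σ : Equiv.Perm (Fin d)) : irredCharacter lam σ = permFrob N lam σ := by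
  have h1 : ∑ σ, (irredCharacter lam σ - permFrob N lam σ) ^ 2 = 0 := by
    have h2 : ∀ σ, (irredCharacter lam σ - permFrob N lam σ) ^ 2
        = irredCharacter lam σ ^ 2 + permFrob N lam σ ^ 2
          - 2 * (permFrob N lam σ * irredCharacter lam σ) := fun σ => by ring
    simp only [h2, sum_sub_distrib, sum_add_distrib, ← mul_sum, sum_irredCharacter_sq,
      sum_permFrob_sq hN, sum_permFrob_mul_irredCharacter (show d ≤ N by lia)]
    ring
  have h3 := (sum_eq_zero_iff_of_nonneg fun σ _ => sq_nonneg _).1 h1 σ (mem_univ _)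
  exact sub_eq_zero.1 ((pow_eq_zero_iff two_ne_zero).1 h3)

theorem chi_eq_frob {m : ℕ} (hN : 2 * d ≤ N) (lam : Nat.Partition d) (μ : Fin m → ℕ)
    (hμ : ∀ i, 0 < μ i) (hd : ∑ i, μ i = d) :
    chi lam μ = frob (shape N lam) (fun i => (μ i : ℤ)) := by
  have hex : ∃ σ : Equiv.Perm (Fin d), σ.partition.parts = Multiset.map μ univ.val :=
    exists_perm_of_parts _ (by simpa using hμ) hd
  rw [chi, dif_pos hex, irredCharacter_eq_permFrob hN,
    permFrob_eq_frob lam _ μ hμ hex.choose_spec]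

theorem sum_chi_eq_vev {m n : ℕ} (hN : 2 * d ≤ N) (r s : ℕ) (μ : Fin m → ℕ) (ν : Fin n → ℕ)
    (hμ : ∀ i, 0 < μ i) (hν : ∀ j, 0 < ν j) (hμd : ∑ i, μ i = d) (hνd : ∑ j, ν j = d) :
    ∑ lam : Nat.Partition d,
      chi lam μ * (shiftedPowerSum (r + 1) lam / ((r + 1).factorial : ℚ)) ^ s * chi lam ν
      = vev N (List.ofFn (fun i => ((μ i : ℤ), 1)) ++ (List.replicate s
        (0, Polynomial.C (((r + 1).factorial : ℚ)⁻¹) * Polynomial.X ^ (r + 1))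
        ++ List.ofFn (fun j => (-(ν j : ℤ), 1)))) := by
  rw [vev_eq_sum_partition (d := d) (by lia) (a := fun i => (μ i : ℤ)) (b := fun i => (ν i : ℤ))
    (fun i => by exact_mod_cast hμ i) (fun i => by exact_mod_cast hν i) (by exact_mod_cast hνd)]
  refine sum_congr rfl fun lam _ => ?_
  rw [chi_eq_frob hN lam μ hμ hμd, chi_eq_frob hN lam ν hν hνd]
  congr 3
  simp only [shiftedPowerSum, eigenvalue, sum_div, Polynomial.eval_mul, Polynomial.eval_C,
    Polynomial.eval_pow, Polynomial.eval_X]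
  refine sum_congr rfl fun i _ => ?_
  ring

end

section

/-! ### Weight polynomials with non-negative homogeneous coefficients -/

/-- The even part in `h` of `taylor h Φ`. -/
def evenShift {R : Type*} [CommRing R] (M : ℕ) (h : R) (Φ : Polynomial R) : Polynomial R :=
  ∑ i ∈ range M, Polynomial.C (h ^ (2 * i)) * Polynomial.hasseDeriv (2 * i) Φ

/-- The odd part in `h` of `taylor h Φ`, divided by `h`. -/
def oddShift {R : Type*} [CommRing R] (M : ℕ) (h : R) (Φ : Polynomial R) : Polynomial R :=
  ∑ i ∈ range M, Polynomial.C (h ^ (2 * i)) * Polynomial.hasseDeriv (2 * i + 1) Φ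

theorem taylor_eq_sum {R : Type*} [CommRing R] {n : ℕ} (h : R) {Φ : Polynomial R}
    (hn : Φ.natDegree < n) :
    Polynomial.taylor h Φ
      = ∑ i ∈ range n, Polynomial.C (h ^ i) * Polynomial.hasseDeriv i Φ := by
  ext j
  rw [Polynomial.taylor_coeff, Polynomial.finsetSum_coeff, Polynomial.eval_eq_sum_range' (n := n)]
  · refine sum_congr rfl fun i _ => ?_
    rw [Polynomial.coeff_C_mul, Polynomial.hasseDeriv_coeff, Polynomial.hasseDeriv_coeff,
      add_comm j i, Nat.choose_symm_add]
    ring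
  · exact (Polynomial.natDegree_hasseDeriv_le Φ j).trans_lt (by lia)

theorem taylor_eq_add {R : Type*} [CommRing R] {M : ℕ} (h : R) {Φ : Polynomial R}
    (hM : Φ.natDegree < M) :
    Polynomial.taylor h Φ = evenShift M h Φ + Polynomial.C h * oddShift M h Φ := by
  rw [taylor_eq_sum h (n := 2 * M) (by lia), sum_range_two_mul, sum_add_distrib, evenShift,
    oddShift, mul_sum]
  congr 1
  refine sum_congr rfl fun i _ => ?_
  rw [pow_succ', Polynomial.C_mul, mul_assoc]

theorem evenShift_neg {R : Type*} [CommRing R] (M : ℕ) (h : R) (Φ : Polynomial R) :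
    evenShift M (-h) Φ = evenShift M h Φ :=
  sum_congr rfl fun i _ => by rw [Even.neg_pow (by simp)]

theorem oddShift_neg {R : Type*} [CommRing R] (M : ℕ) (h : R) (Φ : Polynomial R) :
    oddShift M (-h) Φ = oddShift M h Φ :=
  sum_congr rfl fun i _ => by rw [Even.neg_pow (by simp)]

theorem taylor_neg_eq_sub {R : Type*} [CommRing R] {M : ℕ} (h : R) {Φ : Polynomial R}
    (hM : Φ.natDegree < M) :
    Polynomial.taylor (-h) Φ = evenShift M h Φ - Polynomial.C h * oddShift M h Φ := by
  rw [taylor_eq_add (-h) hM, evenShift_neg, oddShift_neg, Polynomial.C_neg]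
  ring

theorem map_hasseDeriv {R S : Type*} [CommRing R] [CommRing S] (f : R →+* S) (k : ℕ)
    (Φ : Polynomial R) :
    (Polynomial.hasseDeriv k Φ).map f = Polynomial.hasseDeriv k (Φ.map f) := by
  ext j
  simp [Polynomial.hasseDeriv_coeff]

theorem map_evenShift {R S : Type*} [CommRing R] [CommRing S] (f : R →+* S) (M : ℕ) (h : R)
    (Φ : Polynomial R) : (evenShift M h Φ).map f = evenShift M (f h) (Φ.map f) := by
  simp [evenShift, Polynomial.map_sum, map_hasseDeriv]

theorem map_oddShift {R S : Type*} [CommRing R] [CommRing S] (f : R →+* S) (M : ℕ) (h : R)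
    (Φ : Polynomial R) : (oddShift M h Φ).map f = oddShift M (f h) (Φ.map f) := by
  simp [oddShift, Polynomial.map_sum, map_hasseDeriv]

/-- The two products in `bracket` differ by the signs of both shifts, so only the terms odd in
exactly one shift survive, doubled. For a > 0 ≥ b all of a, -b and the shifts are non-negative: no
subtraction is left. -/
theorem bracket_eq {M M' : ℕ} {φ χ : Polynomial ℚ} (hM : φ.natDegree < M)
    (hM' : χ.natDegree < M') (a b : ℚ) :
    bracket (a / 2) (b / 2) φ χ
      = Polynomial.C a * (evenShift M (-b / 2) φ * oddShift M' (a / 2) χ)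
        + Polynomial.C (-b) * (oddShift M (-b / 2) φ * evenShift M' (a / 2) χ) := by
  rw [bracket, show b / 2 = -(-b / 2) by ring, neg_neg, taylor_eq_add _ hM, taylor_eq_add _ hM',
    taylor_neg_eq_sub _ hM, taylor_neg_eq_sub _ hM']
  have h1 : Polynomial.C a = Polynomial.C (a / 2) + Polynomial.C (a / 2) := by
    rw [← Polynomial.C_add]; congr 1; ring
  have h2 : Polynomial.C (-b) = Polynomial.C (-b / 2) + Polynomial.C (-b / 2) := by
    rw [← Polynomial.C_add]; congr 1; ring
  rw [h1, h2]
  ring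

theorem evenShift_one {R : Type*} [CommRing R] (h : R) : evenShift 1 h (1 : Polynomial R) = 1 := by
  simp [evenShift]

theorem oddShift_one {R : Type*} [CommRing R] (h : R) : oddShift 1 h (1 : Polynomial R) = 0 := by
  simp [oddShift]

theorem bracket_one_left {M : ℕ} {χ : Polynomial ℚ} (hM : χ.natDegree < M) (a b : ℚ) :
    bracket (a / 2) (b / 2) 1 χ = Polynomial.C a * oddShift M (a / 2) χ := by
  rw [bracket_eq (M := 1) (by simp) hM, evenShift_one, oddShift_one]
  ring

theorem bracket_one_right {M : ℕ} {φ : Polynomial ℚ} (hM : φ.natDegree < M) (a b : ℚ) :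
    bracket (a / 2) (b / 2) φ 1 = Polynomial.C (-b) * oddShift M (-b / 2) φ := by
  rw [bracket_eq (M' := 1) hM (by simp), evenShift_one, oddShift_one]
  ring

variable {m n : ℕ}

/-- The polynomials in the variables `(μ, ν)`. -/
abbrev PolyRing (m n : ℕ) : Type := MvPolynomial (Fin m ⊕ Fin n) ℚ

/-- The homogeneous polynomials of degree `e`, an integer: there are none but `0` if `e < 0`. -/
abbrev Homog (F : PolyRing m n) (e : ℤ) : Prop :=
  MvPolynomial.IsWeightedHomogeneous (fun _ => (1 : ℤ)) F e

/-- The value of a polynomial at a point. -/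
abbrev ev (p : (Fin m → ℕ) × (Fin n → ℕ)) : PolyRing m n →+* ℚ := MvPolynomial.eval (coords p)

variable {c : Set ((Fin m → ℕ) × (Fin n → ℕ))}

/-- The polynomial `F` is homogeneous of degree `e` and non-negative on `c`. -/
structure GoodCoeff (c : Set ((Fin m → ℕ) × (Fin n → ℕ))) (e : ℤ) (F : PolyRing m n) : Prop where
  hom : Homog F e
  nonneg : ∀ p ∈ c, 0 ≤ ev p F

theorem GoodCoeff.zero (e : ℤ) : GoodCoeff c e 0 :=
  ⟨MvPolynomial.isWeightedHomogeneous_zero _ _ _, fun p _ => by simp⟩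

theorem GoodCoeff.add {e : ℤ} {F G : PolyRing m n} (hF : GoodCoeff c e F) (hG : GoodCoeff c e G) :
    GoodCoeff c e (F + G) :=
  ⟨hF.hom.add hG.hom, fun p hp => by
    rw [map_add]; exact add_nonneg (hF.nonneg p hp) (hG.nonneg p hp)⟩

theorem GoodCoeff.sum {ι : Type*} {e : ℤ} {s : Finset ι} {F : ι → PolyRing m n}
    (h : ∀ i ∈ s, GoodCoeff c e (F i)) : GoodCoeff c e (∑ i ∈ s, F i) := by
  classical
  induction s using Finset.induction_on with
  | empty => simpa using GoodCoeff.zero e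
  | insert i s hi ih =>
    rw [sum_insert hi]
    exact (h i (mem_insert_self _ _)).add (ih fun j hj => h j (mem_insert_of_mem hj))

theorem GoodCoeff.mul {e e' : ℤ} {F G : PolyRing m n} (hF : GoodCoeff c e F)
    (hG : GoodCoeff c e' G) : GoodCoeff c (e + e') (F * G) :=
  ⟨hF.hom.mul hG.hom, fun p hp => by
    rw [map_mul]; exact mul_nonneg (hF.nonneg p hp) (hG.nonneg p hp)⟩

theorem GoodCoeff.const {q : ℚ} (hq : 0 ≤ q) : GoodCoeff c 0 (MvPolynomial.C q : PolyRing m n) :=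
  ⟨MvPolynomial.isWeightedHomogeneous_C _ _, fun p _ => by simpa using hq⟩

theorem GoodCoeff.pow {e : ℤ} {F : PolyRing m n} (hF : GoodCoeff c e F) (k : ℕ) :
    GoodCoeff c (k * e) (F ^ k) := by
  induction k with
  | zero => simpa using GoodCoeff.const (c := c) (m := m) (n := n) zero_le_one
  | succ k ih =>
    have := ih.mul hF
    rw [pow_succ]
    convert this using 1
    push_cast
    ring

/-- The coefficient of `x ^ j` in `Φ` is homogeneous of degree `e - j`, non-negative on `c`, and
zero if `j > w`. -/
structure Good (c : Set ((Fin m → ℕ) × (Fin n → ℕ))) (e w : ℤ)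
    (Φ : Polynomial (PolyRing m n)) : Prop where
  coeff : ∀ j : ℕ, GoodCoeff c (e - j) (Φ.coeff j)
  top : ∀ j : ℕ, w < j → Φ.coeff j = 0

theorem Good.zero (e w : ℤ) : Good c e w 0 :=
  ⟨fun j => by simpa using GoodCoeff.zero _, fun j _ => by simp⟩

theorem Good.mono {e w w' : ℤ} {Φ : Polynomial (PolyRing m n)} (h : Good c e w Φ) (hw : w ≤ w') :
    Good c e w' Φ := ⟨h.coeff, fun j hj => h.top j (by lia)⟩

theorem Good.add {e w : ℤ} {Φ Ψ : Polynomial (PolyRing m n)} (hΦ : Good c e w Φ)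
    (hΨ : Good c e w Ψ) : Good c e w (Φ + Ψ) :=
  ⟨fun j => by rw [Polynomial.coeff_add]; exact (hΦ.coeff j).add (hΨ.coeff j),
    fun j hj => by rw [Polynomial.coeff_add, hΦ.top j hj, hΨ.top j hj, add_zero]⟩

theorem Good.sum {ι : Type*} {e w : ℤ} {s : Finset ι} {Φ : ι → Polynomial (PolyRing m n)}
    (h : ∀ i ∈ s, Good c e w (Φ i)) : Good c e w (∑ i ∈ s, Φ i) := by
  classical
  induction s using Finset.induction_on with
  | empty => simpa using Good.zero e w
  | insert i s hi ih =>
    rw [sum_insert hi]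
    exact (h i (mem_insert_self _ _)).add (ih fun j hj => h j (mem_insert_of_mem hj))

theorem Good.mul {e w e' w' : ℤ} {Φ Ψ : Polynomial (PolyRing m n)} (hΦ : Good c e w Φ)
    (hΨ : Good c e' w' Ψ) : Good c (e + e') (w + w') (Φ * Ψ) := by
  constructor
  · intro j
    rw [Polynomial.coeff_mul]
    refine GoodCoeff.sum fun x hx => ?_
    have h1 := (hΦ.coeff x.1).mul (hΨ.coeff x.2)
    have h2 : x.1 + x.2 = j := by simpa using hx
    convert h1 using 1
    rw [← h2]
    push_cast
    ring
  · intro j hj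
    rw [Polynomial.coeff_mul]
    refine sum_eq_zero fun x hx => ?_
    have h2 : x.1 + x.2 = j := by simpa using hx
    rcases lt_or_ge w x.1 with h | h
    · rw [hΦ.top _ h, zero_mul]
    · rw [hΨ.top _ (by lia), mul_zero]

theorem Good.C_mul {e w t : ℤ} {F : PolyRing m n} {Φ : Polynomial (PolyRing m n)}
    (hF : GoodCoeff c t F) (hΦ : Good c e w Φ) : Good c (t + e) w (Polynomial.C F * Φ) := by
  constructor
  · intro j
    rw [Polynomial.coeff_C_mul]
    convert hF.mul (hΦ.coeff j) using 1
    ring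
  · intro j hj
    rw [Polynomial.coeff_C_mul, hΦ.top j hj, mul_zero]

theorem Good.hasseDeriv {e w : ℤ} {Φ : Polynomial (PolyRing m n)} (hΦ : Good c e w Φ) (k : ℕ) :
    Good c (e - k) (w - k) (Polynomial.hasseDeriv k Φ) := by
  constructor
  · intro j
    rw [Polynomial.hasseDeriv_coeff]
    have h1 := (GoodCoeff.const (c := c) (m := m) (n := n)
      (Nat.cast_nonneg ((j + k).choose k) : (0 : ℚ) ≤ _)).mul (hΦ.coeff (j + k))
    rw [map_natCast] at h1
    convert h1 using 1
    push_cast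
    ring
  · intro j hj
    rw [Polynomial.hasseDeriv_coeff, hΦ.top (j + k) (by push_cast; lia), mul_zero]

theorem Good.evenShift {e w : ℤ} {Φ : Polynomial (PolyRing m n)} (hΦ : Good c e w Φ) (M : ℕ)
    {h : PolyRing m n} (hh : GoodCoeff c 1 h) : Good c e w (evenShift M h Φ) := by
  refine Good.sum fun i _ => ?_
  have := (Good.C_mul (hh.pow (2 * i)) (hΦ.hasseDeriv (2 * i))).mono (w' := w) (by push_cast; lia)
  convert this using 1
  push_cast
  ring

theorem Good.oddShift {e w : ℤ} {Φ : Polynomial (PolyRing m n)} (hΦ : Good c e w Φ) (M : ℕ)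
    {h : PolyRing m n} (hh : GoodCoeff c 1 h) : Good c (e - 1) (w - 1) (oddShift M h Φ) := by
  refine Good.sum fun i _ => ?_
  have := (Good.C_mul (hh.pow (2 * i)) (hΦ.hasseDeriv (2 * i + 1))).mono (w' := w - 1)
    (by push_cast; lia)
  convert this using 1
  push_cast
  ring

/-- The coefficient of `x ^ j` in `Φ` is positive on `c`. -/
def PosCoeff (c : Set ((Fin m → ℕ) × (Fin n → ℕ))) (j : ℕ) (Φ : Polynomial (PolyRing m n)) :
    Prop := ∀ p ∈ c, 0 < ev p (Φ.coeff j)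

theorem PosCoeff.add {j : ℕ} {e w : ℤ} {Φ Ψ : Polynomial (PolyRing m n)} (h : PosCoeff c j Φ)
    (hΨ : Good c e w Ψ) : PosCoeff c j (Φ + Ψ) := fun p hp => by
  rw [Polynomial.coeff_add, map_add]
  exact add_pos_of_pos_of_nonneg (h p hp) ((hΨ.coeff j).nonneg p hp)

theorem PosCoeff.sum {ι : Type*} {j : ℕ} {e w : ℤ} {s : Finset ι}
    {Φ : ι → Polynomial (PolyRing m n)} (hg : ∀ i ∈ s, Good c e w (Φ i)) {i : ι} (hi : i ∈ s)
    (h : PosCoeff c j (Φ i)) : PosCoeff c j (∑ i ∈ s, Φ i) := by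
  classical
  rw [← add_sum_erase _ _ hi]
  exact h.add (Good.sum fun k hk => hg k (mem_of_mem_erase hk))

theorem PosCoeff.mul {j j' : ℕ} {e w e' w' : ℤ} {Φ Ψ : Polynomial (PolyRing m n)}
    (hΦ : Good c e w Φ) (hΨ : Good c e' w' Ψ) (h : PosCoeff c j Φ) (h' : PosCoeff c j' Ψ) :
    PosCoeff c (j + j') (Φ * Ψ) := fun p hp => by
  rw [Polynomial.coeff_mul, map_sum]
  refine sum_pos' (fun x _ => ?_) ⟨(j, j'), by simp, ?_⟩
  · rw [map_mul]
    exact mul_nonneg ((hΦ.coeff _).nonneg p hp) ((hΨ.coeff _).nonneg p hp)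
  · rw [map_mul]
    exact mul_pos (h p hp) (h' p hp)

theorem PosCoeff.C_mul {j : ℕ} {F : PolyRing m n} {Φ : Polynomial (PolyRing m n)}
    (hF : ∀ p ∈ c, 0 < ev p F) (h : PosCoeff c j Φ) : PosCoeff c j (Polynomial.C F * Φ) :=
  fun p hp => by
    rw [Polynomial.coeff_C_mul, map_mul]
    exact mul_pos (hF p hp) (h p hp)

theorem PosCoeff.evenShift {j M : ℕ} {e w : ℤ} {Φ : Polynomial (PolyRing m n)}
    (hΦ : Good c e w Φ) {h : PolyRing m n} (hh : GoodCoeff c 1 h) (hM : 0 < M)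
    (hj : PosCoeff c j Φ) : PosCoeff c j (evenShift M h Φ) := by
  refine PosCoeff.sum (e := e) (w := w) (fun i _ => ?_) (mem_range.2 hM) ?_
  · have := (Good.C_mul (hh.pow (2 * i)) (hΦ.hasseDeriv (2 * i))).mono (w' := w)
      (by push_cast; lia)
    convert this using 1
    push_cast
    ring
  · simpa using hj

theorem PosCoeff.oddShift {j M : ℕ} {e w : ℤ} {Φ : Polynomial (PolyRing m n)}
    (hΦ : Good c e w Φ) {h : PolyRing m n} (hh : GoodCoeff c 1 h) (hM : 0 < M)
    (hj : PosCoeff c (j + 1) Φ) : PosCoeff c j (oddShift M h Φ) := by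
  refine PosCoeff.sum (e := e - 1) (w := w - 1) (fun i _ => ?_) (mem_range.2 hM) ?_
  · have := (Good.C_mul (hh.pow (2 * i)) (hΦ.hasseDeriv (2 * i + 1))).mono (w' := w - 1)
      (by push_cast; lia)
    convert this using 1
    push_cast
    ring
  · intro p hp
    have h1 := hj p hp
    simp only [mul_zero, pow_zero, Polynomial.C_1, one_mul, zero_add, Polynomial.hasseDeriv_coeff,
      Nat.choose_one_right, map_mul, map_natCast]
    positivity

end

section

/-! ### Operators indexed by pairs of sets of variables -/

variable {m n : ℕ} {c : Set ((Fin m → ℕ) × (Fin n → ℕ))}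

/-- An operator whose energy is `∑_{i ∈ I} μ_i - ∑_{j ∈ J} ν_j` and whose weight is the polynomial
`Φ`, graded by the numbers `e` and `w`. The correlators that contain it are to be divisible by
`κ`. -/
structure Op (m n : ℕ) where
  I : Multiset (Fin m)
  J : Multiset (Fin n)
  e : ℤ
  w : ℤ
  Φ : Polynomial (PolyRing m n)
  κ : PolyRing m n

namespace Op

/-- The operator of energy `μ_i`. -/
def lo (i : Fin m) : Op m n := ⟨{i}, 0, -1, 0, 1, MvPolynomial.X (Sum.inl i)⟩

/-- The operator of energy `-ν_j`. -/
def hi (j : Fin n) : Op m n := ⟨0, {j}, -1, 0, 1, MvPolynomial.X (Sum.inr j)⟩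

/-- The operators allowed in the induction. -/
inductive Valid (c : Set ((Fin m → ℕ) × (Fin n → ℕ))) : Op m n → Prop
  | lo (i : Fin m) : Valid c (lo i)
  | hi (j : Fin n) : Valid c (hi j)
  | comp (I : Multiset (Fin m)) (J : Multiset (Fin n)) (e w : ℤ)
      (Φ : Polynomial (PolyRing m n)) (h : Good c e w Φ) : Valid c ⟨I, J, e, w, Φ, 1⟩

end Op

/-- The number `∑_{i ∈ I} μ_i - ∑_{j ∈ J} ν_j`. -/
def energy (I : Multiset (Fin m)) (J : Multiset (Fin n)) (p : (Fin m → ℕ) × (Fin n → ℕ)) : ℤ :=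
  (I.map fun i => (p.1 i : ℤ)).sum - (J.map fun j => (p.2 j : ℤ)).sum

/-- The polynomial `∑_{i ∈ I} μ_i - ∑_{j ∈ J} ν_j`. -/
def energyPoly (I : Multiset (Fin m)) (J : Multiset (Fin n)) : PolyRing m n :=
  (I.map fun i => MvPolynomial.X (Sum.inl i)).sum - (J.map fun j => MvPolynomial.X (Sum.inr j)).sum

theorem energy_zero (p : (Fin m → ℕ) × (Fin n → ℕ)) : energy 0 0 p = 0 := by simp [energy]

theorem energy_add (I I' : Multiset (Fin m)) (J J' : Multiset (Fin n))
    (p : (Fin m → ℕ) × (Fin n → ℕ)) :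
    energy (I + I') (J + J') p = energy I J p + energy I' J' p := by
  simp only [energy, Multiset.map_add, Multiset.sum_add]
  ring

theorem energy_univ {p : (Fin m → ℕ) × (Fin n → ℕ)} (hp : p ∈ domain m n) :
    energy univ.val univ.val p = 0 := by
  have h : (∑ i, (p.1 i : ℤ)) = ∑ j, (p.2 j : ℤ) := by exact_mod_cast hp.2.2
  exact sub_eq_zero.2 h

theorem ev_X_inl (p : (Fin m → ℕ) × (Fin n → ℕ)) (i : Fin m) :
    ev p (MvPolynomial.X (Sum.inl i)) = (p.1 i : ℚ) := by simp [coords]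

theorem ev_X_inr (p : (Fin m → ℕ) × (Fin n → ℕ)) (j : Fin n) :
    ev p (MvPolynomial.X (Sum.inr j)) = (p.2 j : ℚ) := by simp [coords]

theorem ev_energyPoly (I : Multiset (Fin m)) (J : Multiset (Fin n))
    (p : (Fin m → ℕ) × (Fin n → ℕ)) : ev p (energyPoly I J) = (energy I J p : ℚ) := by
  rw [energyPoly, map_sub, map_multiset_sum, map_multiset_sum, Multiset.map_map, Multiset.map_map]
  simp only [Function.comp_def, ev_X_inl, ev_X_inr, energy, Int.cast_sub]
  congr 1
  · simp
  · simp

theorem homog_X (x : Fin m ⊕ Fin n) : Homog (MvPolynomial.X x : PolyRing m n) 1 :=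
  MvPolynomial.isWeightedHomogeneous_X _ _ _

theorem homog_sum_X {ι : Type*} (s : Multiset ι) (f : ι → Fin m ⊕ Fin n) :
    Homog (s.map fun i => (MvPolynomial.X (f i) : PolyRing m n)).sum 1 := by
  induction s using Multiset.induction_on with
  | empty => simpa using MvPolynomial.isWeightedHomogeneous_zero _ _ _
  | cons a s ih =>
    rw [Multiset.map_cons, Multiset.sum_cons]
    exact (homog_X _).add ih

theorem homog_energyPoly (I : Multiset (Fin m)) (J : Multiset (Fin n)) :
    Homog (energyPoly I J) 1 := by
  rw [energyPoly, sub_eq_add_neg]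
  refine (homog_sum_X _ _).add ?_
  have := (MvPolynomial.isWeightedHomogeneous_C (fun _ : Fin m ⊕ Fin n => (1 : ℤ)) (-1 : ℚ)).mul
    (homog_sum_X (m := m) J Sum.inr)
  simpa using this

/-- In a chamber the sign of an energy is constant, and it is zero only for the energies that
vanish identically. -/
theorem energy_trichotomy (hc : IsChamber c) {I : Multiset (Fin m)} {J : Multiset (Fin n)}
    (hI : I ≤ univ.val) (hJ : J ≤ univ.val) :
    (∀ p ∈ c, 0 < energy I J p) ∨ (∀ p ∈ c, energy I J p < 0) ∨
      (I = 0 ∧ J = 0 ∨ I = univ.val ∧ J = univ.val) := by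
  obtain ⟨p₀, hp₀, hw, rfl⟩ := hc
  obtain ⟨A, rfl⟩ : ∃ A : Finset (Fin m), A.val = I :=
    ⟨⟨I, Multiset.nodup_of_le hI univ.nodup⟩, rfl⟩
  obtain ⟨B, rfl⟩ : ∃ B : Finset (Fin n), B.val = J :=
    ⟨⟨J, Multiset.nodup_of_le hJ univ.nodup⟩, rfl⟩
  have hen : ∀ p : (Fin m → ℕ) × (Fin n → ℕ), energy A.val B.val p = wallForm A B p :=
    fun p => rfl
  have hpos1 : ∀ p ∈ domain m n, ∀ C : Finset (Fin m), C ≠ ∅ → 0 < ∑ i ∈ C, (p.1 i : ℤ) :=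
    fun p hp C hC => sum_pos (fun i _ => by exact_mod_cast hp.1 i) (nonempty_iff_ne_empty.2 hC)
  have hpos2 : ∀ p ∈ domain m n, ∀ C : Finset (Fin n), C ≠ ∅ → 0 < ∑ i ∈ C, (p.2 i : ℤ) :=
    fun p hp C hC => sum_pos (fun i _ => by exact_mod_cast hp.2.1 i) (nonempty_iff_ne_empty.2 hC)
  have hlt1 : ∀ p ∈ domain m n, ∀ C : Finset (Fin m), C ≠ univ →
      ∑ i ∈ C, (p.1 i : ℤ) < ∑ i, (p.1 i : ℤ) := fun p hp C hC => by
    rw [← sum_add_sum_compl C]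
    have := hpos1 p hp Cᶜ (by simpa using hC)
    lia
  have hlt2 : ∀ p ∈ domain m n, ∀ C : Finset (Fin n), C ≠ univ →
      ∑ i ∈ C, (p.2 i : ℤ) < ∑ i, (p.2 i : ℤ) := fun p hp C hC => by
    rw [← sum_add_sum_compl C]
    have := hpos2 p hp Cᶜ (by simpa using hC)
    lia
  have htot : ∀ p ∈ domain m n, ∑ i, (p.1 i : ℤ) = ∑ j, (p.2 j : ℤ) := fun p hp => by
    exact_mod_cast hp.2.2
  simp only [hen, wallForm]
  by_cases hA0 : A = ∅
  · by_cases hB0 : B = ∅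
    · simp [hA0, hB0]
    · exact Or.inr (Or.inl fun p hp => by simpa [hA0] using hpos2 p hp.1 B hB0)
  by_cases hB0 : B = ∅
  · exact Or.inl fun p hp => by simpa [hB0] using hpos1 p hp.1 A hA0
  by_cases hA1 : A = univ
  · by_cases hB1 : B = univ
    · simp [hA1, hB1]
    · refine Or.inl fun p hp => ?_
      have := hlt2 p hp.1 B hB1
      rw [hA1, htot p hp.1]
      lia
  by_cases hB1 : B = univ
  · refine Or.inr (Or.inl fun p hp => ?_)
    have := hlt1 p hp.1 A hA1
    rw [hB1, ← htot p hp.1]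
    lia
  have hW : IsWallIndex A B :=
    ⟨nonempty_iff_ne_empty.2 hA0, hA1, nonempty_iff_ne_empty.2 hB0, hB1⟩
  rcases lt_or_gt_of_ne (hw A B hW) with h | h
  · refine Or.inr (Or.inl fun p hp => ?_)
    have h1 : SignType.sign (wallForm A B p) = SignType.sign (wallForm A B p₀) := hp.2 A B hW
    rw [sign_neg h, sign_eq_neg_one_iff] at h1
    exact h1
  · refine Or.inl fun p hp => ?_
    have h1 : SignType.sign (wallForm A B p) = SignType.sign (wallForm A B p₀) := hp.2 A B hW
    rw [sign_pos h, sign_eq_one_iff] at h1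
    exact h1

theorem IsChamber.subset_domain (hc : IsChamber c) {p : (Fin m → ℕ) × (Fin n → ℕ)} (hp : p ∈ c) :
    p ∈ domain m n := by
  obtain ⟨p₀, -, -, rfl⟩ := hc
  exact hp.1

theorem IsChamber.nonempty (hc : IsChamber c) : c.Nonempty := by
  obtain ⟨p₀, h₀, -, rfl⟩ := hc
  exact ⟨p₀, h₀, fun _ _ _ => rfl⟩

namespace Op

/-- The energy of an operator at a point. -/
def en (X : Op m n) (p : (Fin m → ℕ) × (Fin n → ℕ)) : ℤ := energy X.I X.J p

/-- The operator at a point, as an entry of a correlator. -/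
def num (p : (Fin m → ℕ) × (Fin n → ℕ)) (X : Op m n) : ℤ × Polynomial ℚ :=
  (X.en p, X.Φ.map (ev p))

theorem en_lo (i : Fin m) (p : (Fin m → ℕ) × (Fin n → ℕ)) : (lo i : Op m n).en p = p.1 i := by
  simp [en, energy, lo]

theorem en_hi (j : Fin n) (p : (Fin m → ℕ) × (Fin n → ℕ)) : (hi j : Op m n).en p = -p.2 j := by
  simp [en, energy, hi]

/-- The coefficient of `x ^ w` in the weight is positive on `c`. -/
def Pos (c : Set ((Fin m → ℕ) × (Fin n → ℕ))) (X : Op m n) : Prop :=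
  ∃ k : ℕ, X.w = k ∧ PosCoeff c k X.Φ

theorem pos_lo (i : Fin m) : (lo i : Op m n).Pos c :=
  ⟨0, rfl, fun p _ => by simp [lo]⟩

theorem pos_hi (j : Fin n) : (hi j : Op m n).Pos c :=
  ⟨0, rfl, fun p _ => by simp [hi]⟩

/-- The operator `Y` is the commutator of `X` and `B`, divided by the change of `κ`. -/
structure IsMerge (c : Set ((Fin m → ℕ) × (Fin n → ℕ))) (X B Y : Op m n) : Prop where
  valid : Y.Valid c
  I : Y.I = X.I + B.I
  J : Y.J = X.J + B.J
  e : Y.e = X.e + B.e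
  w : Y.w = X.w + B.w - 1
  κ : Y.κ = 1
  bracket : ∀ p ∈ c, bracket ((X.en p : ℚ) / 2) ((B.en p : ℚ) / 2) (X.Φ.map (ev p))
    (B.Φ.map (ev p)) = Polynomial.C (ev p (X.κ * B.κ)) * Y.Φ.map (ev p)
  pos : X.Pos c → B.Pos c → (1 ≤ B.w ∨ 1 ≤ X.w ∧ ∃ j, B = hi j) → Y.Pos c

theorem goodCoeff_half {F : PolyRing m n} (h : GoodCoeff c 1 F) :
    GoodCoeff c 1 (MvPolynomial.C (1 / 2) * F) := by
  simpa using (GoodCoeff.const (c := c) (m := m) (n := n) (q := 1 / 2) (by norm_num)).mul h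

theorem ev_half (p : (Fin m → ℕ) × (Fin n → ℕ)) (F : PolyRing m n) :
    ev p (MvPolynomial.C (1 / 2) * F) = ev p F / 2 := by
  rw [map_mul, MvPolynomial.eval_C]; ring

theorem goodCoeff_X (x : Fin m ⊕ Fin n) : GoodCoeff c 1 (MvPolynomial.X x : PolyRing m n) :=
  ⟨homog_X x, fun p _ => by rcases x with i | j <;> simp [coords]⟩

theorem natDegree_map_lt (p : (Fin m → ℕ) × (Fin n → ℕ)) (Φ : Polynomial (PolyRing m n)) :
    (Φ.map (ev p)).natDegree < Φ.natDegree + 1 :=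
  Nat.lt_succ_of_le Polynomial.natDegree_map_le

/-- By `bracket_eq` the merged weight has non-negative coefficients. If one operator has constant
weight, its energy is a factor of the commutator and goes into κ. Each commutator differentiates
once, so the top coefficient persists if the differentiated weight has `w` at least 1, which the
condition in `pos` provides. -/
theorem exists_isMerge (hc : IsChamber c) {X B : Op m n} (hX : X.Valid c) (hB : B.Valid c)
    (hXp : ∀ p ∈ c, 0 < X.en p) (hBp : ∀ p ∈ c, B.en p ≤ 0) : ∃ Y, IsMerge c X B Y := by
  obtain ⟨p₀, hp₀⟩ := hc.nonempty
  have hd := hc.subset_domain hp₀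
  rcases hX with i | j | ⟨I, J, e, w, Φ, hΦ⟩
  · rcases hB with i' | j' | ⟨I', J', e', w', Ψ, hΨ⟩
    · have h1 := hBp p₀ hp₀
      have h2 := hd.1 i'
      rw [en_lo] at h1
      lia
    -- Two constant weights commute up to the central term, so the merged operator is 0, graded by
    -- `w` = -1.
    · refine ⟨⟨{i}, {j'}, -2, -1, 0, 1⟩, .comp _ _ _ _ _ (Good.zero _ _),
        ?_, ?_, ?_, ?_, rfl, ?_, ?_⟩
      · simp [lo, hi]
      · simp [lo, hi]
      · simp [lo, hi]
      · simp [lo, hi]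
      · intro p _
        simp only [lo, hi, Polynomial.map_one, Polynomial.map_zero, mul_zero]
        rw [bracket_one_left (M := 1) (by simp), oddShift_one, mul_zero]
      · rintro - - (h | ⟨h, -⟩) <;> simp [lo, hi] at h
    · refine ⟨⟨{i} + I', J', e' - 1, w' - 1, oddShift (Ψ.natDegree + 1)
        (MvPolynomial.C (1 / 2) * MvPolynomial.X (Sum.inl i)) Ψ, 1⟩,
        .comp _ _ _ _ _ (hΨ.oddShift _ (goodCoeff_half (goodCoeff_X _))), rfl, by simp [lo],
        by simp only [lo]; ring, by simp [lo], rfl, ?_, ?_⟩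
      · intro p _
        simp only [lo, Polynomial.map_one, mul_one]
        rw [bracket_one_left (natDegree_map_lt p Ψ), map_oddShift, ev_half, ev_X_inl]
        congr 2
      · rintro - ⟨k, hk, hpos⟩ h
        have h1 : 1 ≤ w' := by
          rcases h with h | ⟨h, -⟩
          · exact h
          · simp [lo] at h
        obtain ⟨k, rfl⟩ : ∃ k', k = k' + 1 := ⟨k - 1, by simp only at hk; lia⟩
        refine ⟨k, ?_, PosCoeff.oddShift hΨ (goodCoeff_half (goodCoeff_X _)) (by lia) hpos⟩
        simp only at hk ⊢
        lia
  · have h1 := hXp p₀ hp₀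
    rw [en_hi] at h1
    lia
  · rcases hB with i' | j' | ⟨I', J', e', w', Ψ, hΨ⟩
    · have h1 := hBp p₀ hp₀
      have h2 := hd.1 i'
      rw [en_lo] at h1
      lia
    · refine ⟨⟨I, J + {j'}, e - 1, w - 1, oddShift (Φ.natDegree + 1)
        (MvPolynomial.C (1 / 2) * MvPolynomial.X (Sum.inr j')) Φ, 1⟩,
        .comp _ _ _ _ _ (hΦ.oddShift _ (goodCoeff_half (goodCoeff_X _))), by simp [hi], rfl,
        by simp only [hi]; ring, by simp [hi], rfl, ?_, ?_⟩
      · intro p _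
        simp only [hi, Polynomial.map_one, one_mul]
        rw [bracket_one_right (natDegree_map_lt p Φ), map_oddShift, ev_half, ev_X_inr]
        congr 2 <;> simp [en, energy]
      · rintro ⟨k, hk, hpos⟩ - h
        have h1 : 1 ≤ w := by
          rcases h with h | ⟨h, -⟩
          · simp [hi] at h
          · exact h
        obtain ⟨k, rfl⟩ : ∃ k', k = k' + 1 := ⟨k - 1, by simp only at hk; lia⟩
        refine ⟨k, ?_, PosCoeff.oddShift hΦ (goodCoeff_half (goodCoeff_X _)) (by lia) hpos⟩
        simp only at hk ⊢
        lia
    · have hα : GoodCoeff c 1 (energyPoly I J) := ⟨homog_energyPoly _ _, fun p hp => by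
        rw [ev_energyPoly]; exact_mod_cast (hXp p hp).le⟩
      have hβ : GoodCoeff c 1 (-energyPoly I' J') := by
        refine ⟨?_, fun p hp => ?_⟩
        · have := (MvPolynomial.isWeightedHomogeneous_C (fun _ : Fin m ⊕ Fin n => (1 : ℤ))
            (-1 : ℚ)).mul (homog_energyPoly I' J')
          simpa using this
        · rw [map_neg, ev_energyPoly]
          have := hBp p hp
          simp only [en] at this
          exact_mod_cast neg_nonneg.2 this
      have hα2 := goodCoeff_half hα
      have hβ2 := goodCoeff_half hβ
      have hG1 := Good.C_mul hα ((hΦ.evenShift (Φ.natDegree + 1) hβ2).mul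
        (hΨ.oddShift (Ψ.natDegree + 1) hα2))
      have hG2 := Good.C_mul hβ ((hΦ.oddShift (Φ.natDegree + 1) hβ2).mul
        (hΨ.evenShift (Ψ.natDegree + 1) hα2))
      have e1 : 1 + (e + (e' - 1)) = e + e' := by ring
      have e2 : w + (w' - 1) = w + w' - 1 := by ring
      have e3 : 1 + (e - 1 + e') = e + e' := by ring
      have e4 : w - 1 + w' = w + w' - 1 := by ring
      rw [e1, e2] at hG1
      rw [e3, e4] at hG2
      refine ⟨⟨I + I', J + J', e + e', w + w' - 1, _, 1⟩, .comp _ _ _ _ _ (hG1.add hG2), rfl, rfl,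
        rfl, rfl, rfl, ?_, ?_⟩
      · intro p _
        simp only [one_mul, map_one]
        rw [bracket_eq (natDegree_map_lt p Φ) (natDegree_map_lt p Ψ)]
        simp only [Polynomial.map_add, Polynomial.map_mul, Polynomial.map_C, map_evenShift,
          map_oddShift, ev_half, map_neg, ev_energyPoly, en, Polynomial.map_neg]
      · rintro ⟨k, hk, hpos⟩ ⟨k', hk', hpos'⟩ h
        have h1 : 1 ≤ w' := by
          rcases h with h | ⟨h, j, hj⟩
          · exact h
          · exfalso
            -- A composite operator has `κ` = 1 and thus is no `hi j`.
            have h3 : (1 : PolyRing m n) = MvPolynomial.X (Sum.inr j) := congrArg Op.κ hj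
            have h4 := congrArg (MvPolynomial.eval (0 : Fin m ⊕ Fin n → ℚ)) h3
            simp at h4
        obtain ⟨k', rfl⟩ : ∃ k'', k' = k'' + 1 := ⟨k' - 1, by simp only at hk'; lia⟩
        refine ⟨k + k', ?_, (PosCoeff.C_mul (fun p hp => ?_) (PosCoeff.mul
          (hΦ.evenShift _ hβ2) (hΨ.oddShift _ hα2) (hpos.evenShift hΦ hβ2 (by lia))
          (hpos'.oddShift hΨ hα2 (by lia)))).add hG2⟩
        · simp only at hk hk' ⊢
          lia
        · rw [ev_energyPoly]; exact_mod_cast hXp p hp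

end Op

end

section

/-! ### The evaluation of correlators in a chamber -/

variable {m n g : ℕ} {D : ℤ} {c : Set ((Fin m → ℕ) × (Fin n → ℕ))}

/-- The function `V` on `c` is the product of `K` and an alternating sum of `g + 1` homogeneous
polynomials of degrees `D, D - 2, …`, non-negative on `c`, and positive if `b` holds. -/
def Rep (c : Set ((Fin m → ℕ) × (Fin n → ℕ))) (D : ℤ) (g : ℕ) (b : Prop) (K : PolyRing m n)
    (V : (Fin m → ℕ) × (Fin n → ℕ) → ℚ) : Prop :=
  ∃ P : ℕ → PolyRing m n, (∀ k : ℕ, GoodCoeff c (D - 2 * k) (P k)) ∧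
    (b → ∀ k ≤ g, ∀ p ∈ c, 0 < ev p (P k)) ∧
    ∀ p ∈ c, V p = ev p K * ∑ k ∈ range (g + 1), (-1) ^ k * ev p (P k)

theorem Rep.add {b b' : Prop} {K : PolyRing m n} {V V' : (Fin m → ℕ) × (Fin n → ℕ) → ℚ}
    (h : Rep c D g b K V) (h' : Rep c D g b' K V') :
    Rep c D g (b ∨ b') K (fun p => V p + V' p) := by
  obtain ⟨P, h1, h2, h3⟩ := h
  obtain ⟨P', h1', h2', h3'⟩ := h'
  refine ⟨fun k => P k + P' k, fun k => (h1 k).add (h1' k), ?_, fun p hp => ?_⟩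
  · intro hb k hk p hp
    rw [map_add]
    rcases hb with hb | hb
    · exact add_pos_of_pos_of_nonneg (h2 hb k hk p hp) ((h1' k).nonneg p hp)
    · exact add_pos_of_nonneg_of_pos ((h1 k).nonneg p hp) (h2' hb k hk p hp)
  · beta_reduce
    rw [h3 p hp, h3' p hp, ← mul_add, ← sum_add_distrib]
    simp only [map_add, mul_add]

theorem Rep.congr {b b' : Prop} {K K' : PolyRing m n} {V V' : (Fin m → ℕ) × (Fin n → ℕ) → ℚ}
    (h : Rep c D g b K V) (hb : b' → b) (q : PolyRing m n) (hK : K' = q * K)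
    (hV : ∀ p ∈ c, V' p = ev p q * V p) : Rep c D g b' K' V' := by
  obtain ⟨P, h1, h2, h3⟩ := h
  refine ⟨P, h1, fun h => h2 (hb h), fun p hp => ?_⟩
  rw [hV p hp, h3 p hp, hK, map_mul, mul_assoc]

theorem Rep.zero (K : PolyRing m n) {V : (Fin m → ℕ) × (Fin n → ℕ) → ℚ} (hV : ∀ p ∈ c, V p = 0) :
    Rep c D g False K V :=
  ⟨fun _ => 0, fun _ => GoodCoeff.zero _, False.elim, fun p hp => by simp [hV p hp]⟩

/-- The coefficients of the polynomial `centeredSum a F / a`. -/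
def centralPoly (g : ℕ) (F : Polynomial (PolyRing m n)) (α : PolyRing m n) (k : ℕ) :
    PolyRing m n :=
  ∑ j ∈ Icc k g, MvPolynomial.C (centeredCoeff j k) * (F.coeff (2 * j) * α ^ (2 * (j - k)))

theorem goodCoeff_centralPoly {t w : ℤ} {F : Polynomial (PolyRing m n)} {α : PolyRing m n}
    (hF : Good c t w F) (hα : GoodCoeff c 1 α) (k : ℕ) :
    GoodCoeff c (t - 2 * k) (centralPoly g F α k) := by
  refine GoodCoeff.sum fun j hj => ?_
  have hkj := (mem_Icc.1 hj).1
  convert (GoodCoeff.const (centeredCoeff_pos hkj).le).mul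
    ((hF.coeff (2 * j)).mul (hα.pow (2 * (j - k)))) using 1
  push_cast [Nat.cast_sub hkj]
  ring

theorem centralPoly_pos {t w : ℤ} {F : Polynomial (PolyRing m n)} {α : PolyRing m n}
    (hF : Good c t w F) (hα : ∀ p ∈ c, 0 < ev p α) (hpos : PosCoeff c (2 * g) F) {k : ℕ}
    (hk : k ≤ g) {p : (Fin m → ℕ) × (Fin n → ℕ)} (hp : p ∈ c) :
    0 < ev p (centralPoly g F α k) := by
  rw [centralPoly, map_sum]
  simp only [map_mul, map_pow, MvPolynomial.eval_C]
  refine sum_pos' (fun j hj => ?_) ⟨g, by simpa using hk, ?_⟩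
  · have h1 := centeredCoeff_pos (mem_Icc.1 hj).1
    have h2 := (hF.coeff (2 * j)).nonneg p hp
    have h3 := hα p hp
    positivity
  · have h1 := centeredCoeff_pos hk
    have h2 := hpos p hp
    have h3 := hα p hp
    positivity

/-- Odd powers drop out by symmetry. A term x^(2j) yields a factor a times powers a^(2(j-k)) with
sign (-1)^k, and j ≤ g because the degree of F is at most 2g. -/
theorem centeredSum_map {t : ℤ} {F : Polynomial (PolyRing m n)} {α : PolyRing m n}
    (hF : Good c t (2 * g) F) {p : (Fin m → ℕ) × (Fin n → ℕ)} {a : ℕ} (ha : ev p α = a) :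
    centeredSum a (F.map (ev p))
      = a * ∑ k ∈ range (g + 1), (-1) ^ k * ev p (centralPoly g F α k) := by
  have hdeg : (F.map (ev p)).natDegree < 2 * (g + 1) := by
    rw [Nat.lt_iff_le_pred (by lia), Polynomial.natDegree_le_iff_coeff_eq_zero]
    intro N hN
    rw [Polynomial.coeff_map, hF.top N (by zify at hN; lia), map_zero]
  rw [Polynomial.as_sum_range' _ _ hdeg, sum_range_two_mul, centeredSum_sum]
  have h1 : ∀ j ∈ range (g + 1), centeredSum a
      (Polynomial.monomial (2 * j) ((F.map (ev p)).coeff (2 * j))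
        + Polynomial.monomial (2 * j + 1) ((F.map (ev p)).coeff (2 * j + 1)))
      = ∑ k ∈ range (j + 1), (a : ℚ) * ((-1) ^ k *
        (centeredCoeff j k * (ev p (F.coeff (2 * j)) * (a : ℚ) ^ (2 * (j - k))))) := by
    intro j _
    rw [centeredSum_add, ← Polynomial.C_mul_X_pow_eq_monomial, ← Polynomial.C_mul_X_pow_eq_monomial,
      centeredSum_C_mul, centeredSum_C_mul, centeredSum_pow_odd, centeredSum_pow_even, mul_zero,
      add_zero, mul_sum, Polynomial.coeff_map]
    refine sum_congr rfl fun k hk => ?_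
    rw [show 2 * j + 1 - 2 * k = 2 * (j - k) + 1 by have := mem_range.1 hk; lia, pow_succ]
    ring
  rw [sum_congr rfl h1, mul_sum]
  simp only [centralPoly, map_sum, mul_sum, map_mul, map_pow, MvPolynomial.eval_C, ha]
  refine sum_comm' fun j k => ?_
  simp only [mem_range, mem_Icc]
  lia

/-- A bound for the sum of the absolute values of the energies. -/
def size (p : (Fin m → ℕ) × (Fin n → ℕ)) : ℕ := ∑ i, p.1 i + ∑ j, p.2 j

/-- The conditions on a list of operators that are preserved by commutation. -/
structure Inv (c : Set ((Fin m → ℕ) × (Fin n → ℕ))) (D : ℤ) (g : ℕ) (L : List (Op m n)) :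
    Prop where
  valid : ∀ X ∈ L, X.Valid c
  I : (L.map Op.I).sum = univ.val
  J : (L.map Op.J).sum = univ.val
  e : (L.map Op.e).sum = D - 1
  w : (L.map Op.w).sum - L.length = 2 * g - 2

theorem Inv.perm {L L' : List (Op m n)} (h : Inv c D g L) (hp : L.Perm L') : Inv c D g L' :=
  ⟨fun X hX => h.valid X (hp.mem_iff.2 hX), by rw [← h.I, (hp.map _).sum_eq],
    by rw [← h.J, (hp.map _).sum_eq], by rw [← h.e, (hp.map _).sum_eq],
    by rw [← h.w, (hp.map _).sum_eq, hp.length_eq]⟩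

theorem Inv.swap {L₁ L₂ : List (Op m n)} {X B : Op m n} (h : Inv c D g (L₁ ++ X :: B :: L₂)) :
    Inv c D g (L₁ ++ B :: X :: L₂) :=
  h.perm ((List.Perm.swap _ _ _).append_left _)

/-- A merge lowers both the sum of the `w` and the length by one. For the last two operators this
leaves total `w` equal to 2g and total `e` equal to D - 1. -/
theorem Inv.merge {L₁ L₂ : List (Op m n)} {X B Y : Op m n} (h : Inv c D g (L₁ ++ X :: B :: L₂))
    (hY : Op.IsMerge c X B Y) : Inv c D g (L₁ ++ Y :: L₂) := by
  obtain ⟨h1, h2, h3, h4, h5⟩ := h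
  simp only [List.map_append, List.map_cons, List.sum_append, List.sum_cons, List.length_append,
    List.length_cons] at h2 h3 h4 h5
  refine ⟨fun Z hZ => ?_, ?_, ?_, ?_, ?_⟩
  · simp only [List.mem_append, List.mem_cons] at hZ
    rcases hZ with hZ | rfl | hZ
    · exact h1 _ (by simp [hZ])
    · exact hY.valid
    · exact h1 _ (by simp [hZ])
  · simp only [List.map_append, List.map_cons, List.sum_append, List.sum_cons]
    rw [hY.I, ← h2, add_assoc]
  · simp only [List.map_append, List.map_cons, List.sum_append, List.sum_cons]
    rw [hY.J, ← h3, add_assoc]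
  · simp only [List.map_append, List.map_cons, List.sum_append, List.sum_cons]
    rw [hY.e, ← h4, add_assoc]
  · simp only [List.map_append, List.map_cons, List.sum_append, List.sum_cons,
      List.length_append, List.length_cons]
    rw [hY.w, ← h5]
    push_cast
    ring

theorem Inv.I_le {L : List (Op m n)} (h : Inv c D g L) {X : Op m n} (hX : X ∈ L) :
    X.I ≤ univ.val := by
  rw [← h.I]
  exact List.single_le_sum (fun _ _ => Multiset.zero_le _) _ (List.mem_map_of_mem hX)

theorem Inv.J_le {L : List (Op m n)} (h : Inv c D g L) {X : Op m n} (hX : X ∈ L) :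
    X.J ≤ univ.val := by
  rw [← h.J]
  exact List.single_le_sum (fun _ _ => Multiset.zero_le _) _ (List.mem_map_of_mem hX)

theorem sum_map_en (L : List (Op m n)) (p : (Fin m → ℕ) × (Fin n → ℕ)) :
    (L.map fun X => X.en p).sum = energy (L.map Op.I).sum (L.map Op.J).sum p := by
  induction L with
  | nil => simp [energy_zero]
  | cons X L ih => simp only [List.map_cons, List.sum_cons, energy_add, ih]; rfl

theorem Inv.sum_en {L : List (Op m n)} (h : Inv c D g L) {p : (Fin m → ℕ) × (Fin n → ℕ)}
    (hp : p ∈ domain m n) : (L.map fun X => X.en p).sum = 0 := by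
  rw [sum_map_en, h.I, h.J, energy_univ hp]

theorem sum_abs_en_le (L : List (Op m n)) (p : (Fin m → ℕ) × (Fin n → ℕ)) :
    (L.map fun X => |X.en p|).sum ≤ ((L.map Op.I).sum.map fun i => (p.1 i : ℤ)).sum
      + ((L.map Op.J).sum.map fun j => (p.2 j : ℤ)).sum := by
  induction L with
  | nil => simp
  | cons X L ih =>
    have h1 : 0 ≤ (X.I.map fun i => (p.1 i : ℤ)).sum :=
      Multiset.sum_nonneg fun x hx => by
        obtain ⟨i, -, rfl⟩ := Multiset.mem_map.1 hx; positivity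
    have h2 : 0 ≤ (X.J.map fun j => (p.2 j : ℤ)).sum :=
      Multiset.sum_nonneg fun x hx => by
        obtain ⟨i, -, rfl⟩ := Multiset.mem_map.1 hx; positivity
    have h3 : |X.en p| ≤ (X.I.map fun i => (p.1 i : ℤ)).sum
        + (X.J.map fun j => (p.2 j : ℤ)).sum := by
      rw [Op.en, energy, abs_le]
      constructor <;> lia
    simp only [List.map_cons, List.sum_cons, Multiset.map_add, Multiset.sum_add]
    lia

theorem Inv.sum_abs_le {L : List (Op m n)} (h : Inv c D g L) (p : (Fin m → ℕ) × (Fin n → ℕ)) :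
    ((L.map (Op.num p)).map fun x => |x.1|).sum ≤ (size p : ℤ) := by
  have h1 := sum_abs_en_le L p
  rw [h.I, h.J] at h1
  rw [List.map_map, size]
  push_cast
  exact h1

/-- The correlator of a list of operators. -/
def corr (L : List (Op m n)) (p : (Fin m → ℕ) × (Fin n → ℕ)) : ℚ := vev (size p) (L.map (Op.num p))

/-- The divisor of the correlator. -/
def divisor (L : List (Op m n)) : PolyRing m n := (L.map Op.κ).prod

theorem corr_cons_nonpos {X : Op m n} {L : List (Op m n)} {p : (Fin m → ℕ) × (Fin n → ℕ)}
    (h : X.en p ≤ 0) : corr (X :: L) p = 0 :=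
  vev_cons_nonpos (x := Op.num p X) h _

theorem corr_commute {L₁ L₂ : List (Op m n)} {X B Y : Op m n}
    (h : Inv c D g (L₁ ++ X :: B :: L₂)) (hY : Op.IsMerge c X B Y)
    {p : (Fin m → ℕ) × (Fin n → ℕ)} (hp : p ∈ c) (hX : 0 < X.en p) :
    corr (L₁ ++ X :: B :: L₂) p = corr (L₁ ++ B :: X :: L₂) p
      + ev p (X.κ * B.κ) * corr (L₁ ++ Y :: L₂) p
      + (if X.en p + B.en p = 0 then centeredSum (X.en p).toNat ((X.Φ * B.Φ).map (ev p)) else 0)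
        * corr (L₁ ++ L₂) p := by
  have h1 := h.sum_abs_le p
  simp only [List.map_append, List.map_cons, Op.num] at h1
  have h2 := vev_commute (N := size p) (L₁.map (Op.num p)) (L₂.map (Op.num p)) (b := B.en p) hX
    (X.Φ.map (ev p)) (B.Φ.map (ev p)) (by simpa [Op.num] using h1)
  have hen : Y.en p = X.en p + B.en p := by rw [Op.en, hY.I, hY.J, energy_add]; rfl
  rw [hY.bracket p hp, vev_C_mul] at h2
  simp only [corr, List.map_append, List.map_cons, Op.num, hen, Polynomial.map_mul]
  exact h2

/-- The central term of a commutator contributes to no correlator with a third operator. -/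
theorem corr_append_eq_zero (hc : IsChamber c) {L₁ L₂ : List (Op m n)} {X B : Op m n}
    (h : Inv c D g (L₁ ++ X :: B :: L₂)) (hL : L₁ ≠ [] ∨ L₂ ≠ [])
    {p : (Fin m → ℕ) × (Fin n → ℕ)} (hp : p ∈ c) (hX : 0 < X.en p) (h0 : X.en p + B.en p = 0) :
    corr (L₁ ++ L₂) p = 0 := by
  have hI : (L₁.map Op.I).sum + (L₂.map Op.I).sum + (X.I + B.I) = univ.val := by
    rw [← h.I]
    simp only [List.map_append, List.map_cons, List.sum_append, List.sum_cons]
    abel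
  have hJ : (L₁.map Op.J).sum + (L₂.map Op.J).sum + (X.J + B.J) = univ.val := by
    rw [← h.J]
    simp only [List.map_append, List.map_cons, List.sum_append, List.sum_cons]
    abel
  have hen : energy (X.I + B.I) (X.J + B.J) p = 0 := by rw [energy_add]; exact h0
  -- In a chamber the energies of X and B cancel only if the pair involves all variables or none.
  -- None would contradict X having positive energy; if all, the remaining operators have energy 0,
  -- and the leftmost kills the correlator.
  rcases energy_trichotomy hc (hI ▸ Multiset.le_add_left _ _) (hJ ▸ Multiset.le_add_left _ _)
    with h1 | h1 | ⟨h1, h2⟩ | ⟨h1, h2⟩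
  · exact absurd hen (h1 p hp).ne'
  · exact absurd hen (h1 p hp).ne
  · have h3 : X.en p = 0 := by
      rw [Op.en, (add_eq_zero.1 h1).1, (add_eq_zero.1 h2).1, energy_zero]
    lia
  · have hI0 : ((L₁ ++ L₂).map Op.I).sum = 0 := by
      rw [h1] at hI
      simpa using hI
    have hJ0 : ((L₁ ++ L₂).map Op.J).sum = 0 := by
      rw [h2] at hJ
      simpa using hJ
    have hz : ∀ Z ∈ L₁ ++ L₂, Z.en p = 0 := fun Z hZ => by
      have h3 : Z.I ≤ 0 := hI0 ▸
        List.single_le_sum (fun _ _ => Multiset.zero_le _) _ (List.mem_map_of_mem hZ)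
      have h4 : Z.J ≤ 0 := hJ0 ▸
        List.single_le_sum (fun _ _ => Multiset.zero_le _) _ (List.mem_map_of_mem hZ)
      rw [Op.en, Multiset.le_zero.1 h3, Multiset.le_zero.1 h4, energy_zero]
    rcases hL' : L₁ ++ L₂ with _ | ⟨Z, L⟩
    · simp at hL'
      simp [hL'] at hL
    · exact corr_cons_nonpos (hz Z (by rw [hL']; simp)).le

/-- Swapped and merged correlators start with an operator of energy at most 0, so only the central
term remains. Its factor X.en cancels `κ` if one operator is elementary, and otherwise stays as one
more degree. -/
theorem rep_pair (hc : IsChamber c) (hD : 0 ≤ D) {X B : Op m n} (h : Inv c D g [X, B])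
    (hX : ∀ p ∈ c, 0 < X.en p) (hB : ∀ p ∈ c, B.en p ≤ 0) :
    Rep c D g (X.Pos c ∧ B.Pos c) (divisor [X, B]) (corr [X, B]) := by
  have h0 : ∀ p ∈ c, X.en p + B.en p = 0 := fun p hp => by
    simpa using h.sum_en (hc.subset_domain hp)
  have hvX := h.valid X (by simp)
  have hvB := h.valid B (by simp)
  obtain ⟨Y, hY⟩ := Op.exists_isMerge hc hvX hvB hX hB
  have hV : ∀ p ∈ c, corr [X, B] p = centeredSum (X.en p).toNat ((X.Φ * B.Φ).map (ev p)) := by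
    intro p hp
    have h1 := corr_commute (L₁ := []) (L₂ := []) h hY hp (hX p hp)
    simp only [List.nil_append, if_pos (h0 p hp)] at h1
    have hen : Y.en p = X.en p + B.en p := by rw [Op.en, hY.I, hY.J, energy_add]; rfl
    rw [h1, corr_cons_nonpos (hB p hp), corr_cons_nonpos (by rw [hen, h0 p hp])]
    simp [corr, vev_nil]
  have he : X.e + B.e = D - 1 := by simpa using h.e
  have hw : X.w + B.w = 2 * g := by
    have := h.w
    simp at this
    lia
  -- α is the energy of X, F the product of the weights, and q what is left of α after division by
  -- the divisor.
  have key : ∀ (F : Polynomial (PolyRing m n)) (α q : PolyRing m n) (t : ℤ), GoodCoeff c t q →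
      GoodCoeff c 1 α → Good c (D - t) (2 * g) F → (∀ p ∈ c, 0 < ev p q) →
      (∀ p ∈ c, ev p α = X.en p) → X.Φ * B.Φ = F → divisor [X, B] * q = α →
      (X.Pos c ∧ B.Pos c → PosCoeff c (2 * g) F) →
      Rep c D g (X.Pos c ∧ B.Pos c) (divisor [X, B]) (corr [X, B]) := by
    intro F α q t hq hα hF hqp hev hFF hdiv hpos
    refine ⟨fun k => q * centralPoly g F α k, fun k => ?_, fun hb k hk p hp => ?_, fun p hp => ?_⟩
    · convert hq.mul (goodCoeff_centralPoly (g := g) hF hα k) using 1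
      ring
    · rw [map_mul]
      refine mul_pos (hqp p hp) (centralPoly_pos hF (fun p hp => ?_) (hpos hb) hk hp)
      rw [hev p hp]
      exact_mod_cast hX p hp
    · have ha : ev p α = ((X.en p).toNat : ℚ) := by
        rw [hev p hp]
        exact_mod_cast (Int.toNat_of_nonneg (hX p hp).le).symm
      rw [hV p hp, hFF, centeredSum_map hF ha, ← ha, ← hdiv, map_mul, mul_assoc, mul_sum]
      congr 1
      refine sum_congr rfl fun k _ => ?_
      rw [map_mul]
      ring
  obtain ⟨p₀, hp₀⟩ := hc.nonempty
  have hd := hc.subset_domain hp₀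
  have hone : GoodCoeff c 0 (1 : PolyRing m n) := by
    simpa using GoodCoeff.const (c := c) (m := m) (n := n) zero_le_one
  rcases hvX with i | j | ⟨I, J, e, w, Φ, hΦ⟩
  · rcases hvB with i' | j' | ⟨I', J', e', w', Ψ, hΨ⟩
    · have h1 := hB p₀ hp₀
      have h2 := hd.1 i'
      rw [Op.en_lo] at h1
      lia
    -- Two elementary operators would give D - 1 = -2, against D ≥ 0.
    · simp only [Op.lo, Op.hi] at he
      lia
    · refine key Ψ (MvPolynomial.X (Sum.inl i)) 1 0 hone (Op.goodCoeff_X _) ?_ (by simp) ?_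
        (by simp [Op.lo]) (by simp [divisor, Op.lo]) ?_
      · convert hΨ using 1
        · simp only [Op.lo] at he
          lia
        · simpa [Op.lo] using hw.symm
      · intro p _
        rw [ev_X_inl, Op.en_lo]
        simp
      · rintro ⟨-, k, hk, hpos⟩
        have : k = 2 * g := by simp only [Op.lo] at hk hw; lia
        exact this ▸ hpos
  · have h1 := hX p₀ hp₀
    rw [Op.en_hi] at h1
    lia
  · rcases hvB with i' | j' | ⟨I', J', e', w', Ψ, hΨ⟩
    · have h1 := hB p₀ hp₀
      have h2 := hd.1 i'
      rw [Op.en_lo] at h1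
      lia
    · refine key Φ (MvPolynomial.X (Sum.inr j')) 1 0 hone (Op.goodCoeff_X _) ?_ (by simp) ?_
        (by simp [Op.hi]) (by simp [divisor, Op.hi]) ?_
      · convert hΦ using 1
        · simp only [Op.hi] at he
          lia
        · simpa [Op.hi] using hw.symm
      · intro p hp
        have h1 := h0 p hp
        rw [Op.en_hi] at h1
        rw [ev_X_inr]
        exact_mod_cast (show (p.2 j' : ℤ) = _ by lia)
      · rintro ⟨⟨k, hk, hpos⟩, -⟩
        have : k = 2 * g := by simp only [Op.hi] at hk hw; lia
        exact this ▸ hpos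
    · have hev : ∀ p ∈ c, ev p (energyPoly I J) = (Op.en ⟨I, J, e, w, Φ, 1⟩ p : ℚ) :=
        fun p _ => ev_energyPoly I J p
      have hpos : ∀ p ∈ c, 0 < ev p (energyPoly I J) := fun p hp => by
        rw [hev p hp]; exact_mod_cast hX p hp
      have hα : GoodCoeff c 1 (energyPoly I J) :=
        ⟨homog_energyPoly _ _, fun p hp => (hpos p hp).le⟩
      refine key (Φ * Ψ) (energyPoly I J) (energyPoly I J) 1 hα hα ?_ hpos hev rfl
        (by simp [divisor]) ?_
      · convert hΦ.mul hΨ using 1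
        · exact he.symm
        · exact hw.symm
      · rintro ⟨⟨k, hk, hp⟩, ⟨k', hk', hp'⟩⟩
        have : 2 * g = k + k' := by simp only at hk hk' hw; lia
        rw [this]
        exact PosCoeff.mul hΦ hΨ hp hp'

/-- With a third operator present the central term contributes nothing, and both remaining terms
enter with a plus sign. So non-negativity needs both, while strict positivity needs only one. -/
theorem rep_commute (hc : IsChamber c) {L₁ L₂ : List (Op m n)} {X B Y : Op m n} {b b' : Prop}
    (h : Inv c D g (L₁ ++ X :: B :: L₂)) (hL : L₁ ≠ [] ∨ L₂ ≠ [])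
    (hX : ∀ p ∈ c, 0 < X.en p) (hY : Op.IsMerge c X B Y)
    (hswap : Rep c D g b (divisor (L₁ ++ B :: X :: L₂)) (corr (L₁ ++ B :: X :: L₂)))
    (hmerge : Rep c D g b' (divisor (L₁ ++ Y :: L₂)) (corr (L₁ ++ Y :: L₂))) :
    Rep c D g (b ∨ b') (divisor (L₁ ++ X :: B :: L₂)) (corr (L₁ ++ X :: B :: L₂)) := by
  have h1 : Rep c D g b (divisor (L₁ ++ X :: B :: L₂)) (corr (L₁ ++ B :: X :: L₂)) := by
    refine hswap.congr id 1 ?_ (by simp)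
    simp only [divisor, List.map_append, List.map_cons, List.prod_append, List.prod_cons]
    ring
  have h2 : Rep c D g b' (divisor (L₁ ++ X :: B :: L₂))
      (fun p => ev p (X.κ * B.κ) * corr (L₁ ++ Y :: L₂) p) := by
    refine hmerge.congr id (X.κ * B.κ) ?_ (fun p _ => rfl)
    simp only [divisor, List.map_append, List.map_cons, List.prod_append, List.prod_cons, hY.κ]
    ring
  refine (h1.add h2).congr id 1 (by simp) fun p hp => ?_
  rw [corr_commute h hY hp (hX p hp)]
  by_cases h0 : X.en p + B.en p = 0
  · rw [corr_append_eq_zero hc h hL hp (hX p hp) h0]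
    simp
  · rw [if_neg h0]
    simp

end

/-! ### Non-negativity and strict positivity of the components of correlators -/

section

variable {m n g : ℕ} {D : ℤ} {c : Set ((Fin m → ℕ) × (Fin n → ℕ))}

theorem Inv.pos_or_nonpos (hc : IsChamber c) {L : List (Op m n)} (h : Inv c D g L) {X : Op m n}
    (hX : X ∈ L) : (∀ p ∈ c, 0 < X.en p) ∨ ∀ p ∈ c, X.en p ≤ 0 := by
  rcases energy_trichotomy hc (h.I_le hX) (h.J_le hX) with h1 | h1 | ⟨h1, h2⟩ | ⟨h1, h2⟩
  · exact Or.inl h1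
  · exact Or.inr fun p hp => (h1 p hp).le
  · exact Or.inr fun p _ => by rw [Op.en, h1, h2, energy_zero]
  · exact Or.inr fun p hp => by rw [Op.en, h1, h2, energy_univ (hc.subset_domain hp)]

/-- A list of operators has a first one of non-positive energy. -/
theorem Inv.exists_split (hc : IsChamber c) (hm : 0 < m) {L : List (Op m n)} (h : Inv c D g L) :
    ∃ L₁ B L₂, L = L₁ ++ B :: L₂ ∧ (∀ Z ∈ L₁, ∀ p ∈ c, 0 < Z.en p) ∧ ∀ p ∈ c, B.en p ≤ 0 := by
  have key : ∀ L' : List (Op m n), (∀ X ∈ L', X ∈ L) → (∀ X ∈ L', ∀ p ∈ c, 0 < X.en p) ∨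
      ∃ L₁ B L₂, L' = L₁ ++ B :: L₂ ∧ (∀ Z ∈ L₁, ∀ p ∈ c, 0 < Z.en p) ∧
        ∀ p ∈ c, B.en p ≤ 0 := by
    intro L' hL'
    induction L' with
    | nil => simp
    | cons X L' ih =>
      rcases h.pos_or_nonpos hc (hL' X (by simp)) with hX | hX
      · rcases ih fun Z hZ => hL' Z (by simp [hZ]) with h1 | ⟨L₁, B, L₂, rfl, h2, h3⟩
        · left
          simpa using ⟨fun a b => hX (a, b), fun Z hZ a b => h1 Z hZ (a, b)⟩
        · refine Or.inr ⟨X :: L₁, B, L₂, rfl, fun Z hZ => ?_, h3⟩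
          rcases List.mem_cons.1 hZ with rfl | hZ
          · exact hX
          · exact h2 Z hZ
      · exact Or.inr ⟨[], X, L', rfl, by simp, hX⟩
  rcases key L fun _ h => h with h1 | h1
  · exfalso
    obtain ⟨p, hp⟩ := hc.nonempty
    have h2 := h.sum_en (hc.subset_domain hp)
    rcases L with _ | ⟨X, L⟩
    · have h3 := congrArg Multiset.card h.I
      simp at h3
      lia
    · have h3 : 0 ≤ (L.map fun X => X.en p).sum := List.sum_nonneg fun x hx => by
        obtain ⟨Z, hZ, rfl⟩ := List.mem_map.1 hx
        exact (h1 Z (by simp [hZ]) p hp).le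
      have h4 := h1 X (by simp) p hp
      simp only [List.map_cons, List.sum_cons] at h2
      lia
  · exact h1

/-- Commute the first operator of non-positive energy with its left neighbour. The merged list is
shorter; in the swapped list that operator is nearer to the left end, where it kills the correlator.
Hence a double induction. -/
theorem rep_of_inv (hc : IsChamber c) (hm : 0 < m) (hD : 0 ≤ D) {L : List (Op m n)}
    (h : Inv c D g L) : Rep c D g False (divisor L) (corr L) := by
  obtain ⟨ℓ, hℓ⟩ : ∃ ℓ, L.length = ℓ := ⟨_, rfl⟩
  induction ℓ generalizing L with
  | zero =>
    obtain ⟨L₁, B, L₂, rfl, -, -⟩ := h.exists_split hc hm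
    simp at hℓ
  | succ ℓ IH =>
    obtain ⟨L₁, B, L₂, rfl, hL₁, hB⟩ := h.exists_split hc hm
    induction L₁ using List.reverseRecOn generalizing L₂ with
    | nil => exact Rep.zero _ fun p hp => corr_cons_nonpos (hB p hp)
    | append_singleton L₁ X ih =>
      rw [List.append_assoc, List.singleton_append] at h hℓ ⊢
      have hX := hL₁ X (by simp)
      obtain ⟨Y, hY⟩ := Op.exists_isMerge hc (h.valid X (by simp)) (h.valid B (by simp)) hX hB
      by_cases hL : L₁ = [] ∧ L₂ = []
      · obtain ⟨rfl, rfl⟩ := hL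
        exact (rep_pair hc hD h hX hB).congr False.elim 1 (by simp) (by simp)
      · refine (rep_commute hc h (by tauto) hX hY
          (ih (X :: L₂) h.swap ?_ fun Z hZ => hL₁ Z (by simp [hZ]))
          (IH (h.merge hY) ?_)).congr (by simp) 1 (by simp) (by simp)
        · simpa using hℓ
        · simp at hℓ ⊢
          lia

theorem rep_strict_commute (hc : IsChamber c) (hm : 0 < m) (hD : 0 ≤ D) {L₁ L₂ : List (Op m n)}
    {X B : Op m n} (h : Inv c D g (L₁ ++ X :: B :: L₂)) (hX : ∀ p ∈ c, 0 < X.en p)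
    (hB : ∀ p ∈ c, B.en p ≤ 0) (hXpos : X.Pos c) (hBpos : B.Pos c)
    (hw : L₁ ≠ [] ∨ L₂ ≠ [] → 1 ≤ B.w ∨ 1 ≤ X.w ∧ ∃ j, B = Op.hi j)
    (IH : ∀ Y, Op.IsMerge c X B Y → Y.Pos c → L₁ ≠ [] ∨ L₂ ≠ [] → Inv c D g (L₁ ++ Y :: L₂) →
      Rep c D g True (divisor (L₁ ++ Y :: L₂)) (corr (L₁ ++ Y :: L₂))) :
    Rep c D g True (divisor (L₁ ++ X :: B :: L₂)) (corr (L₁ ++ X :: B :: L₂)) := by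
  by_cases hL : L₁ = [] ∧ L₂ = []
  · obtain ⟨rfl, rfl⟩ := hL
    exact (rep_pair hc hD h hX hB).congr (fun _ => ⟨hXpos, hBpos⟩) 1 (by simp) (by simp)
  · have hL' : L₁ ≠ [] ∨ L₂ ≠ [] := by tauto
    obtain ⟨Y, hY⟩ := Op.exists_isMerge hc (h.valid X (by simp)) (h.valid B (by simp)) hX hB
    exact (rep_commute hc h hL' hX hY (rep_of_inv hc hm hD h.swap)
      (IH Y hY (hY.pos hXpos hBpos (hw hL')) hL' (h.merge hY))).congr (fun _ => Or.inr trivial) 1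
      (by simp) (by simp)

/-- The energy of an operator that involves some but not all variables has a strict sign. -/
theorem Inv.pos_or_neg (hc : IsChamber c) {L₁ L₂ : List (Op m n)} {Y : Op m n}
    (h : Inv c D g (L₁ ++ Y :: L₂)) (hY : ¬(Y.I = 0 ∧ Y.J = 0))
    (hL : ∃ Z ∈ L₁ ++ L₂, ¬(Z.I = 0 ∧ Z.J = 0)) :
    (∀ p ∈ c, 0 < Y.en p) ∨ ∀ p ∈ c, Y.en p < 0 := by
  rcases energy_trichotomy hc (h.I_le (X := Y) (by simp)) (h.J_le (X := Y) (by simp))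
    with h1 | h1 | h1 | ⟨h1, h2⟩
  · exact Or.inl h1
  · exact Or.inr h1
  · exact absurd h1 hY
  · exfalso
    obtain ⟨Z, hZ, hZ'⟩ := hL
    have hI0 : ((L₁ ++ L₂).map Op.I).sum = 0 := by
      have hI : ((L₁ ++ L₂).map Op.I).sum + Y.I = univ.val := by
        rw [← h.I]
        simp only [List.map_append, List.map_cons, List.sum_append, List.sum_cons]
        abel
      rw [h1] at hI
      simpa using hI
    have hJ0 : ((L₁ ++ L₂).map Op.J).sum = 0 := by
      have hJ : ((L₁ ++ L₂).map Op.J).sum + Y.J = univ.val := by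
        rw [← h.J]
        simp only [List.map_append, List.map_cons, List.sum_append, List.sum_cons]
        abel
      rw [h2] at hJ
      simpa using hJ
    have h3 : Z.I ≤ 0 := hI0 ▸
      List.single_le_sum (fun _ _ => Multiset.zero_le _) _ (List.mem_map_of_mem hZ)
    have h4 : Z.J ≤ 0 := hJ0 ▸
      List.single_le_sum (fun _ _ => Multiset.zero_le _) _ (List.mem_map_of_mem hZ)
    exact hZ' ⟨Multiset.le_zero.1 h3, Multiset.le_zero.1 h4⟩

/-- The branch with strictly positive components: A absorbs the operators of energy 0, then,
according to the sign of its energy, the next raising operator on its right or the next lowering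
operator on its left. The sign is strict while elementary operators remain. All swapped terms are
covered by `rep_of_inv`. -/
theorem rep_true (hc : IsChamber c) (hm : 0 < m) (hD : 0 ≤ D) (zs los his : List (Op m n))
    (A : Op m n) (hlos : ∀ X ∈ los, ∃ i, X = Op.lo i) (hhis : ∀ X ∈ his, ∃ j, X = Op.hi j)
    (hzs : ∀ Z ∈ zs, Z.I = 0 ∧ Z.J = 0 ∧ 1 ≤ Z.w ∧ Z.Pos c) (hA : A.Pos c)
    (hAen : (∀ p ∈ c, 0 < A.en p) ∨ zs = [] ∧ ∀ p ∈ c, A.en p < 0)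
    (h : Inv c D g (los ++ A :: (zs ++ his))) :
    Rep c D g True (divisor (los ++ A :: (zs ++ his))) (corr (los ++ A :: (zs ++ his))) := by
  obtain ⟨ℓ, hℓ⟩ : ∃ ℓ, (los ++ A :: (zs ++ his)).length = ℓ := ⟨_, rfl⟩
  obtain ⟨p₀, hp₀⟩ := hc.nonempty
  have hd := hc.subset_domain hp₀
  have hlo : ∀ i, ∀ p ∈ c, 0 < (Op.lo i : Op m n).en p := fun i p hp => by
    rw [Op.en_lo]; exact_mod_cast (hc.subset_domain hp).1 i
  have hhi : ∀ j, ∀ p ∈ c, (Op.hi j : Op m n).en p ≤ 0 := fun j p hp => by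
    rw [Op.en_hi]; lia
  induction ℓ generalizing zs los his A with
  | zero => simp at hℓ
  | succ ℓ IH =>
    rcases zs with _ | ⟨Z, zs⟩
    · rw [List.nil_append] at *
      -- The grading forces `w` of A to be at least 1 as long as two elementary operators are left,
      -- so every merge but the final one may differentiate its weight.
      have hwA : A.w = 2 * g - 1 + los.length + his.length := by
        have h1 := h.w
        have h2 : (los.map Op.w).sum = 0 := List.sum_eq_zero fun x hx => by
          obtain ⟨X, hX, rfl⟩ := List.mem_map.1 hx
          obtain ⟨i, rfl⟩ := hlos X hX
          rfl
        have h3 : (his.map Op.w).sum = 0 := List.sum_eq_zero fun x hx => by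
          obtain ⟨X, hX, rfl⟩ := List.mem_map.1 hx
          obtain ⟨i, rfl⟩ := hhis X hX
          rfl
        simp only [List.map_append, List.map_cons, List.sum_append, List.sum_cons, h2, h3,
          List.length_append, List.length_cons] at h1
        push_cast at h1
        lia
      have htot := h.sum_en hd
      simp only [List.map_append, List.map_cons, List.sum_append, List.sum_cons] at htot
      have hIne : ∀ X ∈ los ++ his, ¬(X.I = 0 ∧ X.J = 0) := fun X hX => by
        rcases List.mem_append.1 hX with hX | hX
        · obtain ⟨i, rfl⟩ := hlos X hX
          simp [Op.lo]
        · obtain ⟨j, rfl⟩ := hhis X hX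
          simp [Op.hi]
      rcases hAen with hAen | ⟨-, hAen⟩
      · rcases his with _ | ⟨B, his⟩
        · exfalso
          have h1 : 0 ≤ (los.map fun X => X.en p₀).sum := List.sum_nonneg fun x hx => by
            obtain ⟨X, hX, rfl⟩ := List.mem_map.1 hx
            obtain ⟨i, rfl⟩ := hlos X hX
            exact (hlo i p₀ hp₀).le
          have h2 := hAen p₀ hp₀
          simp at htot
          lia
        · obtain ⟨j, rfl⟩ := hhis B (by simp)
          refine rep_strict_commute hc hm hD h hAen (hhi j) hA (Op.pos_hi j)
            (fun hL => Or.inr ⟨?_, j, rfl⟩) fun Y hY hYpos hL hinv => ?_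
          · simp only [List.length_cons] at hwA
            rcases hL with hL | hL
            · have := List.length_pos_iff.2 hL
              push_cast at hwA
              lia
            · have := List.length_pos_iff.2 hL
              push_cast at hwA
              lia
          · have hne : ∃ Z ∈ los ++ his, ¬(Z.I = 0 ∧ Z.J = 0) := by
              obtain ⟨Z, hZ⟩ := List.exists_mem_of_ne_nil (los ++ his) (by simp; tauto)
              refine ⟨Z, hZ, hIne Z ?_⟩
              simp only [List.mem_append, List.mem_cons] at hZ ⊢
              tauto
            have hs := hinv.pos_or_neg hc (by rw [hY.I, hY.J]; simp [Op.hi]) hne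
            refine IH [] los his Y hlos (fun X hX => hhis X (by simp [hX])) (by simp) hYpos
              (by tauto) hinv ?_
            simp at hℓ ⊢
            lia
      · rcases los.eq_nil_or_concat' with rfl | ⟨los, X, rfl⟩
        · exfalso
          have h1 : 0 ≤ (his.map fun X => -X.en p₀).sum := List.sum_nonneg fun x hx => by
            obtain ⟨X, hX, rfl⟩ := List.mem_map.1 hx
            obtain ⟨j, rfl⟩ := hhis X hX
            exact neg_nonneg.2 (hhi j p₀ hp₀)
          have h2 := hAen p₀ hp₀
          have h3 : (his.map fun X => -X.en p₀).sum = -(his.map fun X => X.en p₀).sum := by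
            rw [List.sum_neg, List.map_map]; rfl
          simp at htot
          lia
        · obtain ⟨i, rfl⟩ := hlos X (by simp)
          rw [List.append_assoc, List.singleton_append] at h hℓ ⊢
          refine rep_strict_commute hc hm hD h (hlo i) (fun p hp => (hAen p hp).le) (Op.pos_lo i)
            hA (fun hL => Or.inl ?_) fun Y hY hYpos hL hinv => ?_
          · simp only [List.length_append, List.length_cons, List.length_nil] at hwA
            rcases hL with hL | hL
            · have := List.length_pos_iff.2 hL
              push_cast at hwA
              lia
            · have := List.length_pos_iff.2 hL
              push_cast at hwA
              lia
          · have hne : ∃ Z ∈ los ++ his, ¬(Z.I = 0 ∧ Z.J = 0) := by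
              obtain ⟨Z, hZ⟩ := List.exists_mem_of_ne_nil (los ++ his) (by simp; tauto)
              refine ⟨Z, hZ, hIne Z ?_⟩
              simp only [List.mem_append, List.mem_singleton] at hZ ⊢
              tauto
            have hs := hinv.pos_or_neg hc (by rw [hY.I, hY.J]; simp [Op.lo]) hne
            refine IH [] los his Y (fun X hX => hlos X (by simp [hX])) hhis (by simp) hYpos
              (by tauto) hinv ?_
            simp at hℓ ⊢
            lia
    · have hAen' : ∀ p ∈ c, 0 < A.en p := by
        rcases hAen with h1 | ⟨h1, -⟩
        · exact h1
        · simp at h1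
      obtain ⟨hZI, hZJ, hZw, hZpos⟩ := hzs Z (by simp)
      have hZen : ∀ p, Z.en p = 0 := fun p => by rw [Op.en, hZI, hZJ, energy_zero]
      rw [List.cons_append] at h hℓ ⊢
      refine rep_strict_commute hc hm hD h hAen' (fun p _ => (hZen p).le) hA hZpos
        (fun _ => Or.inl hZw) fun Y hY hYpos hL hinv => ?_
      refine IH zs los his Y hlos hhis (fun X hX => hzs X (by simp [hX])) hYpos
        (Or.inl fun p hp => ?_) hinv ?_
      · have hen : Y.en p = A.en p + Z.en p := by rw [Op.en, hY.I, hY.J, energy_add]; rfl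
        rw [hen, hZen, add_zero]
        exact hAen' p hp
      · simp at hℓ ⊢
        lia

end

/-! ### The Hurwitz number as a correlator -/

section

variable {m n g r s : ℕ} {D : ℤ} {c : Set ((Fin m → ℕ) × (Fin n → ℕ))}

/-- The operator of a completed `(r + 1)`-cycle. -/
def completedCycle (m n r : ℕ) : Op m n :=
  ⟨0, 0, r + 1, r + 1,
    Polynomial.C (MvPolynomial.C (((r + 1).factorial : ℚ)⁻¹)) * Polynomial.X ^ (r + 1), 1⟩

theorem good_completedCycle :
    Good c (r + 1) (r + 1) (completedCycle m n r).Φ := by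
  have hq : (0 : ℚ) ≤ ((r + 1).factorial : ℚ)⁻¹ := by positivity
  refine ⟨fun j => ?_, fun j hj => ?_⟩
  · simp only [completedCycle, Polynomial.coeff_C_mul_X_pow]
    split_ifs with h
    · subst h
      simpa using GoodCoeff.const hq
    · exact GoodCoeff.zero _
  · simp only [completedCycle, Polynomial.coeff_C_mul_X_pow]
    rw [if_neg (by lia)]

theorem pos_completedCycle : (completedCycle m n r).Pos c := by
  refine ⟨r + 1, by simp [completedCycle], fun p _ => ?_⟩
  simp only [completedCycle, Polynomial.coeff_C_mul_X_pow, if_true, MvPolynomial.eval_C]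
  positivity

/-- The list of operators whose correlator is the sum over partitions in `hurwitz`. -/
def hurwitzOps (m n r s : ℕ) : List (Op m n) :=
  List.ofFn Op.lo ++ (List.replicate s (completedCycle m n r) ++ List.ofFn Op.hi)

theorem inv_hurwitzOps (hD : D = (r + 1) * s + 1 - m - n)
    (hg : 2 * (g : ℤ) - 2 + m + n = r * s) : Inv c D g (hurwitzOps m n r s) := by
  refine ⟨fun X hX => ?_, ?_, ?_, ?_, ?_⟩
  · simp only [hurwitzOps, List.mem_append, List.mem_ofFn, List.mem_replicate] at hX
    rcases hX with ⟨i, rfl⟩ | ⟨-, rfl⟩ | ⟨j, rfl⟩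
    · exact .lo i
    · exact .comp _ _ _ _ _ good_completedCycle
    · exact .hi j
  · simp only [hurwitzOps, List.map_append, List.map_ofFn, List.map_replicate, List.sum_append,
      List.sum_ofFn, List.sum_replicate, Function.comp_def, Op.lo, Op.hi, completedCycle]
    simp [Finset.sum_multiset_singleton]
  · simp only [hurwitzOps, List.map_append, List.map_ofFn, List.map_replicate, List.sum_append,
      List.sum_ofFn, List.sum_replicate, Function.comp_def, Op.lo, Op.hi, completedCycle]
    simp [Finset.sum_multiset_singleton]
  · simp only [hurwitzOps, List.map_append, List.map_ofFn, List.map_replicate, List.sum_append,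
      List.sum_ofFn, List.sum_replicate, Function.comp_def, Op.lo, Op.hi, completedCycle]
    simp
    linarith
  · simp only [hurwitzOps, List.map_append, List.map_ofFn, List.map_replicate, List.sum_append,
      List.sum_ofFn, List.sum_replicate, Function.comp_def, Op.lo, Op.hi, completedCycle]
    simp
    linarith

theorem rep_hurwitzOps (hc : IsChamber c) (hm : 0 < m) (hD0 : 0 ≤ D)
    (hD : D = (r + 1) * s + 1 - m - n) (hg : 2 * (g : ℤ) - 2 + m + n = r * s) :
    Rep c D g True (divisor (hurwitzOps m n r s)) (corr (hurwitzOps m n r s)) := by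
  have hinv := inv_hurwitzOps (c := c) hD hg
  -- The last lowering operator, which stands next to the completed cycles, starts the strictly
  -- positive branch.
  obtain ⟨los, A, hlos⟩ : ∃ los A, (List.ofFn Op.lo : List (Op m n)) = los ++ [A] := by
    rcases (List.ofFn Op.lo : List (Op m n)).eq_nil_or_concat' with h | h
    · have := congrArg List.length h
      simp at this
      lia
    · exact h
  have hmem : ∀ X ∈ los ++ [A], ∃ i, X = Op.lo i := fun X hX => by
    rw [← hlos, List.mem_ofFn] at hX
    obtain ⟨i, rfl⟩ := hX
    exact ⟨i, rfl⟩
  obtain ⟨i, rfl⟩ := hmem A (by simp)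
  have hL : hurwitzOps m n r s = los ++ Op.lo i :: (List.replicate s (completedCycle m n r)
      ++ List.ofFn Op.hi) := by
    rw [hurwitzOps, hlos, List.append_assoc, List.singleton_append]
  rw [hL] at hinv ⊢
  refine rep_true hc hm hD0 _ _ _ _ (fun X hX => hmem X (by simp [hX])) (fun X hX => ?_)
    (fun Z hZ => ?_) (Op.pos_lo i) (Or.inl fun p hp => ?_) hinv
  · obtain ⟨j, rfl⟩ := List.mem_ofFn.1 hX
    exact ⟨j, rfl⟩
  · obtain rfl := List.eq_of_mem_replicate hZ
    exact ⟨rfl, rfl, by simp [completedCycle], pos_completedCycle⟩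
  · rw [Op.en_lo]
    exact_mod_cast (hc.subset_domain hp).1 i

theorem ev_divisor_hurwitzOps (p : (Fin m → ℕ) × (Fin n → ℕ)) :
    ev p (divisor (hurwitzOps m n r s)) = (∏ i, (p.1 i : ℚ)) * ∏ j, (p.2 j : ℚ) := by
  simp [divisor, hurwitzOps, List.prod_ofFn, Function.comp_def, Op.lo, Op.hi, completedCycle,
    coords]

theorem corr_hurwitzOps {p : (Fin m → ℕ) × (Fin n → ℕ)} (hp : p ∈ domain m n) :
    corr (hurwitzOps m n r s) p
      = (∏ i, (p.1 i : ℚ)) * (∏ j, (p.2 j : ℚ)) * hurwitz r s p.1 p.2 := by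
  have h1 : ∏ i, (p.1 i : ℚ) ≠ 0 := prod_ne_zero_iff.2 fun i _ => by
    exact_mod_cast (hp.1 i).ne'
  have h2 : ∏ j, (p.2 j : ℚ) ≠ 0 := prod_ne_zero_iff.2 fun j _ => by
    exact_mod_cast (hp.2.1 j).ne'
  rw [hurwitz, sum_chi_eq_vev (N := size p) (by rw [size, ← hp.2.2]; lia) r s p.1 p.2 hp.1 hp.2.1
    rfl hp.2.2.symm, ← mul_assoc, mul_one_div_cancel (mul_ne_zero h1 h2), one_mul, corr]
  congr 1
  simp only [hurwitzOps, List.map_append, List.map_ofFn, List.map_replicate, Function.comp_def,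
    Op.num, Op.en_lo, Op.en_hi]
  congr 2
  · simp [Op.lo]
  · simp [completedCycle, Op.en, energy]
  · simp [Op.hi]

theorem Homog.isHomogeneous {F : PolyRing m n} {k : ℕ} (h : Homog F k) : F.IsHomogeneous k := by
  intro d hd
  have h1 := h hd
  rw [Finsupp.weight_apply, Finsupp.sum] at h1 ⊢
  simp only [smul_eq_mul, mul_one, nsmul_eq_mul, Pi.one_apply] at h1 ⊢
  exact_mod_cast h1

/-- In a chamber the Hurwitz number is an alternating sum of positive homogeneous polynomials. -/
theorem exists_polynomials_hurwitz (hc : IsChamber c) (hs : 1 ≤ s) (hm : 1 ≤ m)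
    (hg : 2 * (g : ℤ) - 2 + m + n = r * s) {D : ℕ} (hD : (D : ℤ) = (r + 1) * s + 1 - m - n) :
    2 * g ≤ D ∧ ∃ P : ℕ → PolyRing m n, (∀ k ≤ g, (P k).IsHomogeneous (D - 2 * k)) ∧
      (∀ k ≤ g, ∀ p ∈ c, 0 < MvPolynomial.eval (coords p) (P k)) ∧
      ∀ p ∈ c, hurwitz r s p.1 p.2
        = MvPolynomial.eval (coords p) (∑ k ∈ range (g + 1), (-1) ^ k * P k) := by
  have hDg : 2 * g ≤ D := by
    have : (D : ℤ) = 2 * g + s - 1 := by rw [hD]; linarith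
    lia
  obtain ⟨P, h1, h2, h3⟩ := rep_hurwitzOps hc hm (Int.natCast_nonneg D) hD hg
  refine ⟨hDg, P, fun k hk => Homog.isHomogeneous ?_, h2 trivial, fun p hp => ?_⟩
  · convert (h1 k).hom using 1
    push_cast [Nat.cast_sub (show 2 * k ≤ D by lia)]
    ring
  · have hd := hc.subset_domain hp
    have e1 : ∏ i, (p.1 i : ℚ) ≠ 0 := prod_ne_zero_iff.2 fun i _ => by
      exact_mod_cast (hd.1 i).ne'
    have e2 : ∏ j, (p.2 j : ℚ) ≠ 0 := prod_ne_zero_iff.2 fun j _ => by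
      exact_mod_cast (hd.2.1 j).ne'
    have h4 := h3 p hp
    rw [corr_hurwitzOps hd, ev_divisor_hurwitzOps] at h4
    rw [mul_left_cancel₀ (mul_ne_zero e1 e2) h4]
    simp

theorem IsHomogeneous.eval_neg {σ : Type*} {F : MvPolynomial σ ℚ} {k : ℕ} (h : F.IsHomogeneous k)
    (x : σ → ℚ) : MvPolynomial.eval (-x) F = (-1) ^ k * MvPolynomial.eval x F := by
  rw [MvPolynomial.eval_eq, MvPolynomial.eval_eq, mul_sum]
  refine sum_congr rfl fun d hd => ?_
  have h1 := h (MvPolynomial.mem_support_iff.1 hd)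
  rw [Finsupp.weight_apply, Finsupp.sum] at h1
  simp only [smul_eq_mul, mul_one, Pi.one_apply] at h1
  simp only [Pi.neg_apply, neg_pow (x _), prod_mul_distrib, prod_pow_eq_pow_sum]
  rw [h1]
  ring

end

end

end CompletedHurwitz


/-! ### Parity and the range of degrees -/

open CompletedHurwitz MvPolynomial in
theorem theorem6p4 (r s g m n : ℕ) (hs : 1 ≤ s) (hm : 1 ≤ m) (hn : 1 ≤ n)
    (hg : 2 * (g : ℤ) - 2 + m + n = r * s)
    (c : Set ((Fin m → ℕ) × (Fin n → ℕ))) (hc : IsChamber c) :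
    ∃ (P : ℕ → MvPolynomial (Fin m ⊕ Fin n) ℚ) (Q : MvPolynomial (Fin m ⊕ Fin n) ℚ) (D : ℕ),
      (D : ℤ) = (r + 1) * s + 1 - m - n ∧
      Q = ∑ k ∈ Finset.range (g + 1), (-1) ^ k * P k ∧
      (∀ p ∈ c, hurwitz r s p.1 p.2 = eval (coords p) Q) ∧
      (∀ k ≤ g, 2 * k ≤ D ∧ (P k).IsHomogeneous (D - 2 * k)) ∧
      (∀ k ≤ g, ∀ p ∈ c, 0 < eval (coords p) (P k)) ∧
      (∀ x : Fin m ⊕ Fin n → ℚ, eval (-x) Q = (-1) ^ D * eval x Q) ∧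
      IsGreatest (occurringDegrees Q) D ∧
      IsLeast (occurringDegrees Q) (D - 2 * g) := by
  obtain ⟨D, hD⟩ : ∃ D : ℕ, (D : ℤ) = (r + 1) * s + 1 - m - n :=
    -- The genus relation turns (r + 1) s + 1 - m - n into 2g + s - 1, which is at least 2g because
    -- s ≥ 1.
    ⟨2 * g + s - 1, by push_cast [Nat.cast_sub (show 1 ≤ 2 * g + s by lia)]; linarith⟩
  obtain ⟨hDg, P, hhom, hpos, heq⟩ := exists_polynomials_hurwitz hc hs hm hg hD
  have hcomp : ∀ e, homogeneousComponent e (∑ k ∈ Finset.range (g + 1), (-1) ^ k * P k)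
      = ∑ k ∈ Finset.range (g + 1), if e = D - 2 * k then (-1) ^ k * P k else 0 := by
    intro e
    rw [map_sum]
    refine Finset.sum_congr rfl fun k hk => homogeneousComponent_of_mem ?_
    rw [mem_homogeneousSubmodule]
    have h1 : ((-1) ^ k : MvPolynomial (Fin m ⊕ Fin n) ℚ).IsHomogeneous 0 := by
      simpa using isHomogeneous_C (Fin m ⊕ Fin n) ((-1 : ℚ) ^ k)
    simpa using h1.mul (hhom k (by simpa [Nat.lt_succ_iff] using hk))
  -- The degrees D - 2k with k ≤ g are distinct because 2g ≤ D, so each homogeneous component is a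
  -- single signed P k, non-zero at every point of the chamber.
  have hocc : ∀ k ≤ g,
      D - 2 * k ∈ occurringDegrees (∑ k ∈ Finset.range (g + 1), (-1) ^ k * P k) := by
    intro k hk
    obtain ⟨p, hp⟩ := hc.nonempty
    refine ⟨p, hc.subset_domain hp, ?_⟩
    rw [hcomp, Finset.sum_eq_single k, if_pos rfl]
    · have := hpos k hk p hp
      simpa using this.ne'
    · intro l hl hlk
      have := Finset.mem_range.1 hl
      rw [if_neg (by lia)]
    · intro h
      exact absurd (Finset.mem_range.2 (Nat.lt_succ_of_le hk)) h
  have hdeg : ∀ e ∈ occurringDegrees (∑ k ∈ Finset.range (g + 1), (-1) ^ k * P k),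
      ∃ k ≤ g, e = D - 2 * k := by
    rintro e ⟨p, -, he⟩
    by_contra! hne
    refine he ?_
    rw [hcomp, Finset.sum_eq_zero, map_zero]
    intro k hk
    rw [if_neg (hne k (by simpa [Nat.lt_succ_iff] using hk))]
  refine ⟨P, _, D, hD, rfl, heq, fun k hk => ⟨by lia, hhom k hk⟩, hpos, fun x => ?_,
    ⟨by simpa using hocc 0 (Nat.zero_le g), fun e he => ?_⟩, ⟨hocc g le_rfl, fun e he => ?_⟩⟩
  · simp only [map_sum, map_mul, Finset.mul_sum]
    refine Finset.sum_congr rfl fun k hk => ?_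
    have hk' : k ≤ g := by simpa [Nat.lt_succ_iff] using hk
    have h1 : (-1 : ℚ) ^ D = (-1) ^ (D - 2 * k) := by
      conv_lhs => rw [show D = (D - 2 * k) + 2 * k by lia, pow_add, pow_mul]
      simp
    rw [IsHomogeneous.eval_neg (hhom k hk'), h1]
    simp
    ring
  · obtain ⟨k, -, rfl⟩ := hdeg e he
    lia
  · obtain ⟨k, hk, rfl⟩ := hdeg e he
    lia
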